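/- **Model.** There is a set of validators; each is honest or Byzantine. Time is divided into slots, and an epoch consists of $E\ge 2$ consecutive slots; $\mathrm{slot}(t)$, $\mathrm{epoch}(t)$ denote the slot and epoch of time $t$, $\mathrm{st}(s)$ and $\mathrm{st}(e)$ the starting time of a slot or epoch, $\mathrm{first}(e)$, $\mathrm{last}(e)$ the first and last slot of $e$. By time $\max(t,\mathsf{GST})+\Delta$ every honest validator has received every message that another honest validator had received by $t$, and every vote that an honest validator had sent by $t$. $\mathsf{GGST}$ is the start of epoch $\mathrm{epoch}(\mathsf{GST})+1$ if $\mathsf{GST}\le \mathrm{st}(\mathrm{last}(\mathrm{epoch}(\mathsf{GST})))$, and of epoch $\mathrm{epoch}(\mathsf{GST})+2$ otherwise. The view $\mathcal V^{v,t}$ of $v$ at $t$ is the finite set of messages received by then, except blocks of future slots. Every view assigns a committee to every slot. Committees of different slots of one epoch are disjoint, and from $\mathsf{GGST}$ on honest validators agree on all committees; $\overline{W_s^{s'}}$ is the union of the committees of slots $s,\dots,s'$. In each slot in which it is in the committee, an honest validator sends, more than $\Delta$ before the end of the slot, one GHOST vote for its canonical block $b$ and one FFG vote from $\mathrm{VS}(b,e)$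 to $C(b,e)$, where $e$ is the epoch of the slot. It sends no other votes and is never slashed. Blocks form a tree rooted at genesis (slot $0$), with slots strictly increasing from parent to child; $a\preceq b$ means that $a$ is an ancestor of $b$ or $a=b$. A checkpoint is a pair (block, epoch). $C(b,e)$ is the pair of $e$ and the highest block of slot at most $\mathrm{first}(e)$ in the chain of $b$. For a checkpoint $C$: $C\preceq b$ means $C(b,\mathrm{epoch}(C))=C$; $b\preceq C$ means $b\preceq\mathrm{block}(C)$; $C\preceq C'$ means $C=C'$, or $\mathrm{epoch}(C)<\mathrm{epoch}(C')$ and $C\preceq\mathrm{block}(C')$. Blocks $b$ and checkpoints $C$ have effective-balance assignments with finite support; $|X|_C$, $|X|_b$ denote the weight of $X$ under them, and $T_C$, $T_b$ the total weight; $T_C>0$ for every checkpoint $C$ of a chain. $D(b)$ is the set of validators against which the chain of $b$ contains slashing evidence. $U(b)$ is the finite set of unrealized justified checkpoints of the chain of $b$, and contains the finalized checkpoints according to $b$, among them the genesis checkpoint. $\mathrm{GU}(b)$ is its element of greatest epoch. $\mathrm{GJ}(b)$ is $\mathrm{GU}$ of the last ancestor of $b$ from an earlier epoch (the genesis checkpoint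 if $\mathrm{epoch}(b)=0$). $\mathrm{VS}(b,e)$ is $\mathrm{GJ}(b)$ if $\mathrm{epoch}(b)=e$, and $\mathrm{GU}(b)$ otherwise. $\mathrm{GF}(b)$ is the greatest finalized checkpoint according to $b$. $\mathrm{GJ}^{v,t}$ and $\mathrm{GF}^{v,t}$ are the checkpoints of greatest epoch among $\mathrm{VS}(b,\mathrm{epoch}(t))$, respectively $\mathrm{GF}(b)$, for blocks $b$ in the view. Ties are broken arbitrarily. *Fork choice (LMD-GHOST-HFC).* A block $b$ of the view is kept if $b\preceq\mathrm{GJ}^{v,t}$, or if $b\succeq\mathrm{block}(\mathrm{GJ}^{v,t})$ and $b$ has a descendant (or itself) $b'$ in the view that has no children in the view, with $b'\succeq \mathrm{GF}^{v,t}$ and such that $\mathrm{VS}(b',\mathrm{epoch}(t))$ equals $\mathrm{GJ}^{v,t}$ or has epoch at least $\mathrm{epoch}(t)-2$. GHOST votes that are not from past slots, that are by equivocating validators, by validators outside the committee of their slot, or for a block of a slot later than that of the vote are discarded, and only the latest GHOST votes of each validator are retained. The canonical block is found from genesis by moving repeatedly to the heaviest kept child, where the weight of $b$ is the weight, under $\mathrm{GJ}^{v,t}$,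 of the validators with a retained vote for a descendant of $b$ (or $b$), plus $W_p(\mathrm{GJ}^{v,t})$ if $b$ is an ancestor of (or is) the block, if any, of the current slot to which $v$ grants the proposer boost. Here $W_p(C)=\frac{p}{E}T_C$ and $p\ge 0$ is the boost score. **Constants.** $\beta\ge0$; the safety decay $\mathrm{SD}$; $\mathrm{maxSlash}\in[0,\infty]$; the exit, reward, penalty and slashing rates $x,r,q,\sigma\in[0,1)$; a lookahead $L\ge2$. **Assumed properties of Gasper.** (1) $C\preceq b$ and $\mathrm{epoch}(C)\le\mathrm{epoch}(b)$ for $C\in U(b)$. (2) $U(a)\subseteq U(b)$ for $a\preceq b$. (3) $\mathrm{GF}^{v,t}\preceq\mathrm{GJ}^{v,t}$ for honest $v$. And, if $\beta<\frac13-\mathrm{SD}$: (4) at most one checkpoint per epoch is in some $U(b)$. (5) If $C$ is a checkpoint of a chain, $t\ge\mathrm{st}(\mathrm{epoch}(C))$, $C\succeq\mathrm{GJ}^{v,t}$ for an honest $v$, and validators of weight at least $\frac23T_C$ under $C$ have sent FFG votes with target $C$ by a time $t'\ge t$, then no other checkpoint of epoch $\mathrm{epoch}(C)$ is ever in any $U(b)$.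 (6) If $\mathrm{st}(e)\ge\mathsf{GGST}$ and all honest validators in the committees of epoch $e$ have, by the end of $e$, cast FFG votes with targets of epoch $e$ descending from $b$, then no checkpoint of epoch $e$ that conflicts with $b$ is ever in any $U(b')$. **Validator set and balance changes (Property 3).** For a checkpoint $C$ and a block $b\succeq C$ with $\mathrm{epoch}(b)\le\mathrm{epoch}(C)+1$, and likewise for checkpoints $C\preceq C'$ of chains with $\mathrm{epoch}(C')\le\mathrm{epoch}(C)+1$ (with slashed set $D(\mathrm{block}(C'))$): the validators that exit (those of non-zero balance before and zero balance after) weigh at most $xT_C$ before the change; those that enter weigh at most $xT_C$ after it; the balance of a remaining validator is multiplied by at most $1+r$, by at least $1-q$ if it is not slashed, and by at least $1-\sigma$ if it is. Moreover $q\le\sigma$, $x<\frac23$, $q+x(1+r)\le1$, $$\frac{p}{2E}+\frac{2x}{1-q}+\frac{x\,(r(1-x)-q)}{1-q}\le\frac16,$$ and, if $\beta<\frac16$, $$\frac pE<\frac{2(1-q)(1-x)}{(1+r)(1+r+x)}\left(\frac{(1-x)(1-q)}{1+r}\left(\frac23\cdot\frac{1+r-xr}{1-q}+x+\beta-\frac{x}{(1-x)(1-\sigma)}\right)-\frac{x}{1-x}-\beta-\frac{1+r}{2(1-q)}\right).$$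 Finally, if $t\ge\mathsf{GGST}$, $v$ is honest and a checkpoint $C\succeq\mathrm{GJ}^{v,t}$ of a chain has epoch between $\mathrm{epoch}(\mathrm{GJ}^{v,t})$ and $\mathrm{epoch}(\mathrm{GJ}^{v,t})+L$, then the validators with non-zero balance under $C$ are exactly the members of the committees of epoch $\mathrm{epoch}(C)$. **$\beta$-bound.** For honest $v$, $t\ge\mathsf{GGST}$ and slots $s,s'$, the honest part of $\overline{W_s^{s'}}$ weighs under $C$ at least $1-\beta$ times $|\overline{W_s^{s'}}|_C$, both for every $C$ in some $U(b)$ and, if $s,s'$ lie in one epoch $e$, for $C=C(b,e)$ with $b$ in the view of $v$ at $t$. **Slashing bound.** $|D(b)|_C\le\mathrm{maxSlash}$ whenever $C\preceq b$. **Strengthened justification assumption (Assumption 9).** Let $$\mathrm{honFFGRatioVar}(\beta)=\frac1{1-\beta}\left(\frac23\cdot\frac{1+r-xr}{1-q}+x+\beta\right).$$ Then $\beta<\min(\frac16,\frac13-\mathrm{SD})$, and the following holds for every block $b$ and epoch $e\ge\mathrm{epoch}(b)$ with $\mathrm{st}(e+1)\ge\mathsf{GGST}$. Suppose that at every time $t$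 of epoch $e+1$ and for every honest $v$, $b$ is in the canonical chain of $v$, and for every block $b'\succeq C(b,e)$ in the view of $v$ at $t$, the validators outside $D(b')$ that have sent FFG votes from $\mathrm{VS}(b,e)$ to $C(b,e)$ by $t$ weigh at least $\frac23T_{b'}$ under $b'$. Then for every honest $v$ there is a checkpoint $C$ of epoch $e+1$ with $b\preceq C$ such that (i) some block $b'\succeq C$ with $\mathrm{epoch}(b')<e+2$ is in the view of $v$ at $\mathrm{st}(\mathrm{last}(e+1))$ and has $C(b,e)\in U(b')$; and (ii) at every $t'\ge\mathrm{st}(e+2)$, the honest validators whose FFG votes from $\mathrm{VS}(\mathrm{block}(C),e+1)$ to $C$ are in the view of $v$ weigh, under $C$, more than $\mathrm{honFFGRatioVar}(\beta)$ times the weight of all honest validators. **Algorithm 3.** Let $w_C(b,t)$ be the weight under $C$ of $\overline{W}(b,t)=\overline{W_{\mathrm{slot}(\mathrm{parent}(b))+1}^{\mathrm{slot}(t)-1}}$, and $Q(b,v,t,C)$ the fraction of that weight held by the members of $\overline W(b,t)$ with a retained GHOST vote for a descendant of $b$ (or $b$) in the (not HFC-filtered) view of $v$. * $\mathrm{isLMDGHOSTSafeFull}_v(b,C,t)$: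 every $b'\preceq b$ other than genesis satisfies $$Q(b',v,t,C)>\frac{1+r}{2(1-q)}\left(1+\frac{W_p(C)\,(1+x+r)}{w_C(b',t)}\right)+\frac{x\,T_C}{w_C(b',t)}+\beta .$$ * $\mathrm{willChkpBeJustified}_v(b,e,t)$: with $C=C(b,e)$ and $F$ the set of members of the committees of slots $\mathrm{first}(e),\dots,\mathrm{slot}(t)-1$ whose FFG vote from $\mathrm{VS}(b,e)$ to $C$ is in the view of $v$ at $t$, $$|F|_C+(1-\beta)\left|\overline{W_{\mathrm{slot}(t)}^{\mathrm{last}(e)}}\right|_C\ \ge\ T_C\left(\frac23\cdot\frac{1+r-xr}{1-q}+x\right)+\min(\mathrm{maxSlash},\beta T_C).$$ * $\mathrm{isConfirmedNoCaching}_v(b,t)$. If $\mathrm{epoch}(b)=\mathrm{epoch}(t)$: $\mathrm{willChkpBeJustified}_v(b,\mathrm{epoch}(t),t)$, $\mathrm{epoch}(\mathrm{GJ}(b))=\mathrm{epoch}(t)-1$ and $\mathrm{isLMDGHOSTSafeFull}_v(b,\mathrm{GJ}(b),t)$. Otherwise: $t$ is in the first slot of its epoch, $\mathrm{willChkpBeJustified}_v(b,\mathrm{epoch}(t)-1,t)$,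 and there is $b'\succeq b$ with $\mathrm{epoch}(b')<\mathrm{epoch}(t)$ in the view of $v$ at $\mathrm{st}(\mathrm{slot}(t)-1)$ such that $\mathrm{epoch}(\mathrm{VS}(b',\mathrm{epoch}(t)))\ge\mathrm{epoch}(t)-2$ and $\mathrm{isLMDGHOSTSafeFull}_v(b,\mathrm{VS}(b',\mathrm{epoch}(t)),t)$. * $\mathrm{isConfirmed}_v(b,t)$: for every slot $s$ from $\mathrm{first}(\mathrm{epoch}(t)-1)+1$ to $\mathrm{slot}(t)$, take a block of highest slot among the blocks in the view of $v$ at $\mathrm{st}(s)$ that satisfy $\mathrm{isConfirmedNoCaching}_v(\cdot,\mathrm{st}(s))$ (if there are any); let $h$ be one of highest slot among all these blocks. Then $\mathrm{isConfirmed}_v(b,t)$ holds iff $h$ exists and $b\preceq h$. (Here epoch and slot subtractions stop at $0$.) The security guard $\mathrm{sg}(b,t,\mathsf{GGST})$ holds iff $\mathrm{epoch}(b)\ge\mathrm{epoch}(t)-1$ and $\mathrm{st}(\mathrm{epoch}(t)-1)\ge\mathsf{GGST}$. **Theorem.** Under the model, properties and assumptions above, $(\text{Algorithm 3},\mathrm{sg})$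 is a Confirmation Rule for LMD-GHOST-HFC: for every honest validator $v$, block $b$ and time $t$ with $\mathrm{sg}(b,t,\mathsf{GGST})$ and $\mathrm{isConfirmed}_v(b,t)$, * **Safety:** there is a time $t_0$ such that for all $t'\ge t_0$ and all honest $v'$, $b$ is in the canonical chain of $v'$ at $t'$; * **Monotonicity:** $\mathrm{isConfirmed}_v(b,t')$ holds for all $t'\ge t$. -/

import Mathlib

open scoped NNReal ENNReal

/-! ### Messages -/

/-- A checkpoint: a block together with an epoch. -/
structure Chk (B : Type*) where
  block : B
  epoch : ℕ

/-- A (signed) GHOST vote. -/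
structure GhostVote (V B : Type*) where
  signer : V
  slot : ℕ
  block : B

/-- A (signed) FFG vote. -/
structure FFGVote (V B : Type*) where
  signer : V
  source : Chk B
  target : Chk B

/-- Messages exchanged by validators. -/
inductive Msg (V B : Type*) where
  | block (b : B)
  | ghost (a : GhostVote V B)
  | ffg (a : FFGVote V B)

/-- `m` is a (GHOST or FFG) vote signed by `v`. -/
def Msg.IsVoteOf {V B : Type*} (v : V) : Msg V B → Prop
  | .block _ => False
  | .ghost a => a.signer = v
  | .ffg a => a.signer = v

/-- Total weight of the set of validators `X` under an effective-balance assignment. -/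
noncomputable def weight {V : Type*} (bal : V →₀ ℝ≥0) (X : Set V) : ℝ :=
  open Classical in ∑ v ∈ bal.support with v ∈ X, (bal v : ℝ)

/-- Total weight of an effective-balance assignment. -/
noncomputable def totalWeight {V : Type*} (bal : V →₀ ℝ≥0) : ℝ := weight bal Set.univ

/-- The validator set of an effective-balance assignment: validators of non-zero balance. -/
def valset {V : Type*} (bal : V →₀ ℝ≥0) : Set V := {v | 0 < bal v}

/-! ### Protocol and execution -/

/-- The data of an execution of Gasper: `V` is the set of validators, `B` the set of the valid
blocks that can ever be created. -/
structure Gasper (V B : Type*) where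
  /-- The honest validators; all the others are Byzantine. -/
  honest : Set V
  /-- Number of slots of an epoch. -/
  slotsPerEpoch : ℕ
  two_le_slotsPerEpoch : 2 ≤ slotsPerEpoch
  /-- Time at which a slot begins. -/
  slotStart : ℕ → ℝ≥0
  slotStart_zero : slotStart 0 = 0
  slotStart_strictMono : StrictMono slotStart
  slotStart_tendsto : Filter.Tendsto slotStart Filter.atTop Filter.atTop
  /-- Global stabilization time. -/
  GST : ℝ≥0
  /-- Maximal message latency after `GST`. -/
  Δ : ℝ≥0
  genesis : B
  /-- Parent of a block (the value at `genesis`, which has no parent, is a dummy). -/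
  parent : B → B
  parent_genesis : parent genesis = genesis
  /-- Slot of a block. -/
  slot : B → ℕ
  slot_genesis : slot genesis = 0
  slot_parent_lt : ∀ b, b ≠ genesis → slot (parent b) < slot b
  /-- Effective-balance assignment of a block. -/
  eba : B → V →₀ ℝ≥0
  /-- Effective-balance assignment used for a checkpoint (for instance that of its block). -/
  ebaC : Chk B → V →₀ ℝ≥0
  /-- Validators against which the block includes evidence of a slashable offence. -/
  evidence : B → Set V
  /-- Unrealized justified checkpoints of the chain of a block. -/
  unrealized : B → Set (Chk B)
  unrealized_finite : ∀ b, (unrealized b).Finite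
  /-- Finalized checkpoints according to a block. -/
  finalized : B → Set (Chk B)
  finalized_subset : ∀ b, finalized b ⊆ unrealized b
  genesis_mem_finalized : ∀ b, ⟨genesis, 0⟩ ∈ finalized b
  /-- Proposer boost score. -/
  boostScore : ℝ
  boostScore_nonneg : 0 ≤ boostScore
  /-- Maximization over finite sets of blocks; ties are broken arbitrarily. -/
  argmaxB : Set B → (B → ℝ) → B
  argmaxB_spec : ∀ (S : Set B) (f : B → ℝ), S.Finite → S.Nonempty →
    argmaxB S f ∈ S ∧ ∀ b ∈ S, f b ≤ f (argmaxB S f)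
  /-- A checkpoint of greatest epoch in a finite set; ties are broken arbitrarily. -/
  maxChk : Set (Chk B) → Chk B
  maxChk_spec : ∀ S : Set (Chk B), S.Finite → S.Nonempty →
    maxChk S ∈ S ∧ ∀ C ∈ S, C.epoch ≤ (maxChk S).epoch
  /-- Messages received by a validator by a given time. -/
  received : V → ℝ≥0 → Set (Msg V B)
  /-- Messages sent (by anyone) by a given time. -/
  sent : ℝ≥0 → Set (Msg V B)
  /-- `comm v t s`: the committee of slot `s` according to the view of `v` at time `t`. -/
  comm : V → ℝ≥0 → ℕ → Finset V
  /-- Time, within a slot, at which a validator votes if it is in the committee of the slot. -/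
  voteTime : V → ℕ → ℝ≥0
  /-- The proposal of the current slot to which a validator grants the proposer boost, if any. -/
  boosted : V → ℝ≥0 → Option B

/-- The constants known to the users of the Confirmation Rule. -/
structure Constants where
  /-- Bound on the ratio of Byzantine validators. -/
  β : ℝ
  /-- Safety decay. -/
  safetyDecay : ℝ
  /-- Maximal effective balance that Byzantine validators get slashed; it may be infinite. -/
  maxSlash : ℝ≥0∞
  exitRate : ℝ
  rewardRate : ℝ
  penaltyRate : ℝ
  slashRate : ℝ
  /-- Number of epochs ahead for which the validator set is known. -/
  lookahead : ℕ

namespace Gasper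

variable {V B : Type*} (G : Gasper V B)

/-! ### Time -/

def epochOfSlot (s : ℕ) : ℕ := s / G.slotsPerEpoch
def firstSlot (e : ℕ) : ℕ := e * G.slotsPerEpoch
def lastSlot (e : ℕ) : ℕ := (e + 1) * G.slotsPerEpoch - 1
/-- The slot `s` such that `slotStart s ≤ t < slotStart (s + 1)`. -/
noncomputable def slotAt (t : ℝ≥0) : ℕ := sSup {s | G.slotStart s ≤ t}
noncomputable def epochAt (t : ℝ≥0) : ℕ := G.epochOfSlot (G.slotAt t)
/-- Beginning of an epoch. -/
def epochStart (e : ℕ) : ℝ≥0 := G.slotStart (G.firstSlot e)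

open Classical in
/-- The time from which honest validators agree on the committees. -/
noncomputable def GGST : ℝ≥0 :=
  if G.GST ≤ G.slotStart (G.lastSlot (G.epochAt G.GST)) then
    G.epochStart (G.epochAt G.GST + 1)
  else
    G.epochStart (G.epochAt G.GST + 2)

/-! ### Blocks and checkpoints -/

/-- `a ⪯ b`: `a` is an ancestor of `b` (or `b` itself). -/
def Anc (a b : B) : Prop := ∃ k : ℕ, G.parent^[k] b = a

def epochB (b : B) : ℕ := G.epochOfSlot (G.slot b)

/-- The block of highest slot in the chain of `b` that satisfies `P` (if there is one). -/
noncomputable def highestAnc (b : B) (P : B → Prop) : B :=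
  G.parent^[sInf {k | P (G.parent^[k] b)}] b

/-- `C(b, e)`: the checkpoint for epoch `e` in the chain of `b`. -/
noncomputable def chkOf (b : B) (e : ℕ) : Chk B :=
  ⟨G.highestAnc b (fun a => G.slot a ≤ G.firstSlot e), e⟩

def genesisChk : Chk B := ⟨G.genesis, 0⟩

/-- `C ⪯ b` for a checkpoint `C` and a block `b`. -/
def ChkLeBlock (C : Chk B) (b : B) : Prop := G.chkOf b C.epoch = C

/-- `b ⪯ C` for a block `b` and a checkpoint `C`. -/
def BlockLeChk (b : B) (C : Chk B) : Prop := G.Anc b C.block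

/-- `C ⪯ C'` for checkpoints. -/
def ChkLe (C C' : Chk B) : Prop :=
  C = C' ∨ (C.epoch < C'.epoch ∧ G.ChkLeBlock C C'.block)

/-- A checkpoint and a block conflict. -/
def Conflict (C : Chk B) (b : B) : Prop := ¬ G.BlockLeChk b C ∧ ¬ G.ChkLeBlock C b

/-- A pair (block, epoch) that is the checkpoint of some chain. -/
def IsChk (C : Chk B) : Prop := G.ChkLeBlock C C.block

/-- Validators slashed according to the evidence included in the chain of `b`. -/
def slashed (b : B) : Set V := {v | ∃ a, G.Anc a b ∧ v ∈ G.evidence a}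

/-! ### FFG -/

/-- Greatest unrealized justified checkpoint in the chain of `b`. -/
def GU (b : B) : Chk B := G.maxChk (G.unrealized b)

open Classical in
/-- Greatest justified checkpoint in the chain of `b`. -/
noncomputable def GJ (b : B) : Chk B :=
  if G.epochB b = 0 then G.genesisChk
  else G.GU (G.highestAnc b (fun a => G.epochB a < G.epochB b))

open Classical in
/-- Voting source of `b` in epoch `e` (meaningful if `epoch(b) ≤ e`). -/
noncomputable def VS (b : B) (e : ℕ) : Chk B := if G.epochB b = e then G.GJ b else G.GU b

/-- Greatest finalized checkpoint in the chain of `b`. -/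
def GF (b : B) : Chk B := G.maxChk (G.finalized b)

/-- Greatest justified checkpoint in a view at a time. -/
noncomputable def gjView (𝒱 : Set (Msg V B)) (t : ℝ≥0) : Chk B :=
  G.maxChk {C | ∃ b, Msg.block b ∈ 𝒱 ∧ G.slot b ≤ G.slotAt t ∧ C = G.VS b (G.epochAt t)}

/-- Greatest finalized checkpoint in a view at a time. -/
noncomputable def gfView (𝒱 : Set (Msg V B)) (t : ℝ≥0) : Chk B :=
  G.maxChk {C | ∃ b, Msg.block b ∈ 𝒱 ∧ G.slot b ≤ G.slotAt t ∧ C = G.GF b}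

/-! ### Fork choice -/

/-- Children of `b` in a view. -/
def children (b : B) (𝒱 : Set (Msg V B)) : Set B :=
  {b' | Msg.block b' ∈ 𝒱 ∧ b' ≠ G.genesis ∧ G.parent b' = b}

/-- Validators that, according to a view, have GHOST voted in support of `b`. -/
def ghostSupporters (b : B) (𝒱 : Set (Msg V B)) : Set V :=
  {v | ∃ a : GhostVote V B, Msg.ghost a ∈ 𝒱 ∧ a.signer = v ∧ G.Anc b a.block}

/-- Remove the GHOST votes of validators that have equivocated. -/
def filEq (𝒱 : Set (Msg V B)) : Set (Msg V B) :=
  𝒱 \ {m | ∃ a : GhostVote V B, m = .ghost a ∧ ∃ a₁ a₂ : GhostVote V B,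
    Msg.ghost a₁ ∈ 𝒱 ∧ Msg.ghost a₂ ∈ 𝒱 ∧ a₁.signer = a.signer ∧ a₂.signer = a.signer ∧
    a₁.slot = a₂.slot ∧ a₁.block ≠ a₂.block}

/-- Remove the GHOST votes from the current and from future slots. -/
def filCur (𝒱 : Set (Msg V B)) (t : ℝ≥0) : Set (Msg V B) :=
  𝒱 \ {m | ∃ a : GhostVote V B, m = .ghost a ∧ G.slotAt t ≤ a.slot}

/-- Remove the invalid GHOST votes, with respect to the committees `κ`. -/
def filInv (κ : ℕ → Finset V) (𝒱 : Set (Msg V B)) : Set (Msg V B) :=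
  𝒱 \ {m | ∃ a : GhostVote V B, m = .ghost a ∧
    (a.signer ∉ κ a.slot ∨ a.slot < G.slot a.block)}

/-- Keep only the latest GHOST votes of each validator. -/
def filLmd (𝒱 : Set (Msg V B)) : Set (Msg V B) :=
  𝒱 \ {m | ∃ a : GhostVote V B, m = .ghost a ∧ ∃ a' : GhostVote V B,
    Msg.ghost a' ∈ 𝒱 ∧ a'.signer = a.signer ∧ a.slot < a'.slot}

/-- The filters applied by LMD-GHOST. -/
def filLmdGhost (κ : ℕ → Finset V) (𝒱 : Set (Msg V B)) (t : ℝ≥0) : Set (Msg V B) :=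
  filLmd (G.filInv κ (G.filCur (filEq 𝒱) t))

/-- The blocks of a view that are retained by the filter of LMD-GHOST-HFC. -/
def NotFiltered (𝒱 : Set (Msg V B)) (t : ℝ≥0) (b : B) : Prop :=
  G.BlockLeChk b (G.gjView 𝒱 t) ∨
  (G.Anc (G.gjView 𝒱 t).block b ∧ ∃ b', Msg.block b' ∈ 𝒱 ∧ G.Anc b b' ∧
    G.ChkLeBlock (G.gfView 𝒱 t) b' ∧ G.epochB b' ≤ G.epochAt t ∧ G.children b' 𝒱 = ∅ ∧
    (G.VS b' (G.epochAt t) = G.gjView 𝒱 t ∨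
      G.epochAt t ≤ (G.VS b' (G.epochAt t)).epoch + 2))

/-- The filter of LMD-GHOST-HFC. -/
def filHfc (𝒱 : Set (Msg V B)) (t : ℝ≥0) : Set (Msg V B) :=
  𝒱 \ {m | ∃ b, m = .block b ∧ ¬ G.NotFiltered 𝒱 t b}

/-- Proposer boost weight: a fraction of the average weight of a committee. -/
noncomputable def boostWeight (C : Chk B) : ℝ :=
  G.boostScore / G.slotsPerEpoch * totalWeight (G.ebaC C)

open Classical in
/-- One iteration of the loop of GHOST, for the block weights `w`. -/
noncomputable def ghostStep (𝒱 : Set (Msg V B)) (t : ℝ≥0) (w : B → ℝ) (b : B) : B :=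
  if {b' ∈ G.children b 𝒱 | G.slot b' ≤ G.slotAt t}.Nonempty then
    G.argmaxB {b' ∈ G.children b 𝒱 | G.slot b' ≤ G.slotAt t} w
  else b

/-- GHOST. Slots increase along the loop, so that it is over after `slotAt t` iterations. -/
noncomputable def ghost (𝒱 : Set (Msg V B)) (t : ℝ≥0) (w : B → ℝ) : B :=
  (G.ghostStep 𝒱 t w)^[G.slotAt t] G.genesis

open Classical in
/-- LMD-GHOST-HFC, weighing votes (and the proposer boost) according to the greatest justified
checkpoint. -/
noncomputable def lmdGhostHfc (κ : ℕ → Finset V) (𝒱 : Set (Msg V B)) (t : ℝ≥0)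
    (boosted : Option B) : B :=
  G.ghost (G.filLmdGhost κ (G.filHfc 𝒱 t) t) t fun b =>
    weight (G.ebaC (G.gjView 𝒱 t))
      (G.ghostSupporters b (G.filLmdGhost κ (G.filHfc 𝒱 t) t)) +
    if ∃ p, boosted = some p ∧ G.Anc b p then G.boostWeight (G.gjView 𝒱 t) else 0

/-! ### Views and votes in the execution -/

/-- The view of `v` at time `t`. A block received before its slot is considered only from the
beginning of its slot on. -/
def view (v : V) (t : ℝ≥0) : Set (Msg V B) :=
  {m ∈ G.received v t | ∀ b, m = .block b → G.slot b ≤ G.slotAt t}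

/-- Greatest justified checkpoint in the view of `v` at time `t`. -/
noncomputable def gj (v : V) (t : ℝ≥0) : Chk B := G.gjView (G.view v t) t

/-- Greatest finalized checkpoint in the view of `v` at time `t`. -/
noncomputable def gf (v : V) (t : ℝ≥0) : Chk B := G.gfView (G.view v t) t

/-- The canonical chain of `v` at time `t`. -/
noncomputable def canonical (v : V) (t : ℝ≥0) : B :=
  G.lmdGhostHfc (G.comm v t) (G.view v t) t (G.boosted v t)

/-- Union of the committees from slot `s` to slot `s'`, according to `v` at time `t`. -/
def commRange (v : V) (t : ℝ≥0) (s s' : ℕ) : Set V := {u | ∃ k, s ≤ k ∧ k ≤ s' ∧ u ∈ G.comm v t k}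

/-- The validator set of epoch `e`, according to `v` at time `t`. -/
def commEpoch (v : V) (t : ℝ≥0) (e : ℕ) : Set V :=
  G.commRange v t (G.firstSlot e) (G.lastSlot e)

/-- Validators having sent by time `t` an FFG vote from `C₁` to `C₂`. -/
def ffgSent (C₁ C₂ : Chk B) (t : ℝ≥0) : Set V := {u | Msg.ffg ⟨u, C₁, C₂⟩ ∈ G.sent t}

/-- Validators having sent by time `t` an FFG vote with target `C`. -/
def ffgSentTo (C : Chk B) (t : ℝ≥0) : Set V := {u | ∃ C₁, Msg.ffg ⟨u, C₁, C⟩ ∈ G.sent t}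

/-- Validators whose FFG vote from `C₁` to `C₂` is in the view of `v` at time `t`. -/
def ffgSeen (C₁ C₂ : Chk B) (v : V) (t : ℝ≥0) : Set V := {u | Msg.ffg ⟨u, C₁, C₂⟩ ∈ G.view v t}

/-- The checkpoint `C` is never justified. -/
def NeverJustified (C : Chk B) : Prop := ∀ b, C ∉ G.unrealized b

/-- The system model: network, views, committees, behaviour of the honest validators. -/
structure SystemModel : Prop where
  received_finite : ∀ v ∈ G.honest, ∀ t, (G.received v t).Finite
  received_mono : ∀ v ∈ G.honest, Monotone (G.received v)
  received_subset_sent : ∀ v ∈ G.honest, ∀ t, G.received v t ⊆ G.sent t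
  sent_mono : Monotone G.sent
  genesis_received : ∀ v ∈ G.honest, ∀ t, Msg.block G.genesis ∈ G.received v t
  /-- Votes of honest validators are delivered in time. -/
  deliver : ∀ v ∈ G.honest, ∀ v' ∈ G.honest, ∀ t t', max t G.GST + G.Δ ≤ t' →
    ∀ m ∈ G.sent t, m.IsVoteOf v → m ∈ G.received v' t'
  /-- Honest validators gossip the messages that they receive. -/
  gossip : ∀ v ∈ G.honest, ∀ v' ∈ G.honest, ∀ t t', max t G.GST + G.Δ ≤ t' →
    G.received v t ⊆ G.received v' t'
  voteTime_mem : ∀ v ∈ G.honest, ∀ s,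
    G.slotStart s ≤ G.voteTime v s ∧ G.voteTime v s + G.Δ < G.slotStart (s + 1)
  /-- The validator set of an epoch is partitioned into committees. -/
  comm_disjoint : ∀ v ∈ G.honest, ∀ t s s', s ≠ s' → G.epochOfSlot s = G.epochOfSlot s' →
    Disjoint (G.comm v t s) (G.comm v t s')
  /-- From `GGST` on, honest validators agree on the committees. -/
  comm_agree : ∀ v ∈ G.honest, ∀ v' ∈ G.honest, ∀ t t', G.GGST ≤ t → G.GGST ≤ t' →
    ∀ s, G.comm v t s = G.comm v' t' s
  /-- An honest validator casts exactly one GHOST vote, for its canonical chain, in the slots of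
  which it is in the committee. -/
  honest_ghost : ∀ v ∈ G.honest, ∀ t s b, Msg.ghost ⟨v, s, b⟩ ∈ G.sent t ↔
    v ∈ G.comm v (G.voteTime v s) s ∧ G.voteTime v s ≤ t ∧ b = G.canonical v (G.voteTime v s)
  /-- At the same time it casts exactly one FFG vote, and it casts no other FFG vote. -/
  honest_ffg : ∀ v ∈ G.honest, ∀ t C₁ C₂, Msg.ffg ⟨v, C₁, C₂⟩ ∈ G.sent t ↔
    ∃ s, v ∈ G.comm v (G.voteTime v s) s ∧ G.voteTime v s ≤ t ∧
      C₁ = G.VS (G.canonical v (G.voteTime v s)) (G.epochOfSlot s) ∧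
      C₂ = G.chkOf (G.canonical v (G.voteTime v s)) (G.epochOfSlot s)
  /-- Only a received block of the current slot can be granted the proposer boost. -/
  boosted_mem : ∀ v ∈ G.honest, ∀ t b, G.boosted v t = some b →
    Msg.block b ∈ G.view v t ∧ G.slot b = G.slotAt t
  honest_not_slashed : ∀ v ∈ G.honest, ∀ b, v ∉ G.evidence b
  /-- The validator set of a checkpoint is not empty. -/
  ebaC_pos : ∀ C, G.IsChk C → 0 < totalWeight (G.ebaC C)

variable (K : Constants)

/-- The properties of justification and finalization ensured by Gasper. -/
structure GasperProperties : Prop where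
  /-- Justified checkpoints of the chain of `b` are checkpoints in the chain of `b`. -/
  unrealized_chain : ∀ b, ∀ C ∈ G.unrealized b, G.ChkLeBlock C b
  /-- FFG votes included in the chain of a block are included in the chain of its descendants. -/
  unrealized_mono : ∀ a b, G.Anc a b → G.unrealized a ⊆ G.unrealized b
  /-- At most one checkpoint per epoch is ever justified. -/
  justified_unique : K.β < 1 / 3 - K.safetyDecay →
    ∀ b₁ b₂, ∀ C₁ ∈ G.unrealized b₁, ∀ C₂ ∈ G.unrealized b₂, C₁.epoch = C₂.epoch → C₁ = C₂
  /-- The greatest justified checkpoint descends from the greatest finalized checkpoint. -/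
  finalized_le_justified : ∀ v ∈ G.honest, ∀ t, G.ChkLe (G.gf v t) (G.gj v t)
  /-- A checkpoint that descends from the greatest justified checkpoint of an honest validator
  and receives two thirds of the votes prevents any other checkpoint of its epoch from being
  justified. -/
  no_other_of_two_thirds : K.β < 1 / 3 - K.safetyDecay →
    ∀ v ∈ G.honest, ∀ t t' C, G.IsChk C → G.epochStart C.epoch ≤ t → t ≤ t' →
      G.ChkLe (G.gj v t) C →
      2 / 3 * totalWeight (G.ebaC C) ≤ weight (G.ebaC C) (G.ffgSentTo C t') →
      ∀ C', C' ≠ C → C'.epoch = C.epoch → G.NeverJustified C'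
  /-- If all the honest validators of an epoch vote for descendants of `b`, no conflicting
  checkpoint of that epoch is ever justified. -/
  no_conflicting_of_all_honest : K.β < 1 / 3 - K.safetyDecay →
    ∀ v ∈ G.honest, ∀ t, G.GGST ≤ t → ∀ b e, G.GGST ≤ G.epochStart e →
      (∀ u ∈ G.commEpoch v t e ∩ G.honest, ∃ C : Chk B, C.epoch = e ∧ G.BlockLeChk b C ∧
        u ∈ G.ffgSentTo C (G.epochStart (e + 1))) →
      ∀ C : Chk B, C.epoch = e → G.Conflict C b → G.NeverJustified C
  /-- A block justifies no checkpoint of a later epoch. -/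
  unrealized_epoch_le : ∀ b, ∀ C ∈ G.unrealized b, C.epoch ≤ G.epochB b

/-- The changes from the balances `bal` to the balances `bal'`, where `D` are the validators
slashed, are within the exit, reward, penalty and slashing rates. -/
structure ChangeWithin (bal bal' : V →₀ ℝ≥0) (D : Set V) : Prop where
  exit_le : weight bal (valset bal \ valset bal') ≤ totalWeight bal * K.exitRate
  entry_le : weight bal' (valset bal' \ valset bal) ≤ totalWeight bal * K.exitRate
  reward_le : ∀ v ∈ valset bal ∩ valset bal', (bal' v : ℝ) ≤ bal v * (1 + K.rewardRate)
  penalty_le : ∀ v ∈ (valset bal ∩ valset bal') \ D, bal v * (1 - K.penaltyRate) ≤ (bal' v : ℝ)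
  slash_le : ∀ v ∈ (valset bal ∩ valset bal') ∩ D, bal v * (1 - K.slashRate) ≤ (bal' v : ℝ)

/-- Properties on validator set and effective balance changes. -/
structure ChangeProperties : Prop where
  exit_mem : K.exitRate ∈ Set.Ico (0 : ℝ) 1
  reward_mem : K.rewardRate ∈ Set.Ico (0 : ℝ) 1
  penalty_mem : K.penaltyRate ∈ Set.Ico (0 : ℝ) 1
  slash_mem : K.slashRate ∈ Set.Ico (0 : ℝ) 1
  /-- Changes from a checkpoint to a block that descends from it, up to the next epoch. -/
  change_block : ∀ C b, G.ChkLeBlock C b → G.epochB b ≤ C.epoch + 1 →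
    ChangeWithin K (G.ebaC C) (G.eba b) (G.slashed b)
  /-- Changes from a checkpoint to a checkpoint that descends from it, up to the next epoch. -/
  change_chk : ∀ C C', G.IsChk C → G.IsChk C' → G.ChkLe C C' → C'.epoch ≤ C.epoch + 1 →
    ChangeWithin K (G.ebaC C) (G.ebaC C') (G.slashed C'.block)
  penalty_le_slash : K.penaltyRate ≤ K.slashRate
  exit_lt : K.exitRate < 2 / 3
  penalty_exit_reward : K.penaltyRate + K.exitRate * (1 + K.rewardRate) ≤ 1
  boost_exit : G.boostScore / (2 * G.slotsPerEpoch) + 2 * K.exitRate / (1 - K.penaltyRate) +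
    K.exitRate * (K.rewardRate * (1 - K.exitRate) - K.penaltyRate) / (1 - K.penaltyRate) ≤ 1 / 6
  two_le_lookahead : 2 ≤ K.lookahead
  /-- The validator set of a checkpoint is made of the committees of its epoch. -/
  valset_eq : ∀ v ∈ G.honest, ∀ t C, G.IsChk C → G.GGST ≤ t → G.ChkLe (G.gj v t) C →
    (G.gj v t).epoch ≤ C.epoch → C.epoch ≤ (G.gj v t).epoch + K.lookahead →
    valset (G.ebaC C) = G.commEpoch v t C.epoch
  /-- The proposer boost is small enough with respect to the rates. -/
  boost_lt : K.β < 1 / 6 → G.boostScore / G.slotsPerEpoch <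
    2 * (1 - K.penaltyRate) * (1 - K.exitRate) /
        ((1 + K.rewardRate) * (1 + K.rewardRate + K.exitRate)) *
      ((1 - K.exitRate) * (1 - K.penaltyRate) / (1 + K.rewardRate) *
          (2 / 3 * ((1 + K.rewardRate - K.exitRate * K.rewardRate) / (1 - K.penaltyRate)) +
            K.exitRate + K.β - K.exitRate / ((1 - K.exitRate) * (1 - K.slashRate))) -
        K.exitRate / (1 - K.exitRate) - K.β -
        (1 + K.rewardRate) / (2 * (1 - K.penaltyRate)))

/-! ### Assumptions -/

/-- From `GGST` on, Byzantine validators are at most a fraction `β` of the committees of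
consecutive slots. Balances are those of any justified checkpoint or, for slots of a single epoch,
those of a checkpoint for that epoch in the chain of a block in view. -/
structure BetaBound : Prop where
  nonneg : 0 ≤ K.β
  justified : ∀ v ∈ G.honest, ∀ t, G.GGST ≤ t → ∀ s s' b, ∀ C ∈ G.unrealized b,
    (1 - K.β) * weight (G.ebaC C) (G.commRange v t s s') ≤
      weight (G.ebaC C) (G.commRange v t s s' ∩ G.honest)
  inView : ∀ v ∈ G.honest, ∀ t, G.GGST ≤ t → ∀ b, Msg.block b ∈ G.view v t → ∀ e s s',
    G.firstSlot e ≤ s → s' ≤ G.lastSlot e →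
    (1 - K.β) * weight (G.ebaC (G.chkOf b e)) (G.commRange v t s s') ≤
      weight (G.ebaC (G.chkOf b e)) (G.commRange v t s s' ∩ G.honest)

/-- Byzantine validators never get more than `maxSlash` of their effective balance slashed. -/
def SlashBound : Prop :=
  ∀ C b, G.ChkLeBlock C b →
    ENNReal.ofReal (weight (G.ebaC C) (G.slashed b)) ≤ K.maxSlash

end Gasper

/-- The ratio required of the honest FFG votes. -/
noncomputable def Constants.honFFGRatioVar (K : Constants) : ℝ :=
  1 / (1 - K.β) *
    (2 / 3 * ((1 + K.rewardRate - K.exitRate * K.rewardRate) / (1 - K.penaltyRate)) +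
      K.exitRate + K.β)

namespace Gasper

variable {V B : Type*} (G : Gasper V B) (K : Constants)

/-- The strengthened justification assumption. -/
structure StrongJustification : Prop where
  next_justified : ∀ b e, G.epochB b ≤ e → G.GGST ≤ G.epochStart (e + 1) →
    (∀ t, G.epochAt t = e + 1 → ∀ v ∈ G.honest,
      G.Anc b (G.canonical v t) ∧
      ∀ b', Msg.block b' ∈ G.view v t → G.ChkLeBlock (G.chkOf b e) b' →
        2 / 3 * totalWeight (G.eba b') ≤
          weight (G.eba b') (G.ffgSent (G.VS b e) (G.chkOf b e) t \ G.slashed b')) →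
    ∀ v ∈ G.honest, ∃ C : Chk B, C.epoch = e + 1 ∧ G.BlockLeChk b C ∧
      (∃ b', Msg.block b' ∈ G.view v (G.slotStart (G.lastSlot (e + 1))) ∧
        G.ChkLeBlock C b' ∧ G.epochB b' < e + 2 ∧ G.chkOf b e ∈ G.unrealized b') ∧
      ∀ t', G.epochStart (e + 2) ≤ t' →
        K.honFFGRatioVar <
          weight (G.ebaC C) (G.ffgSeen (G.VS C.block C.epoch) C v t' ∩ G.honest) /
            weight (G.ebaC C) G.honest
  beta_lt : K.β < min (1 / 6) (1 / 3 - K.safetyDecay)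

/-! ### The Confirmation Rule -/

/-- The committees from the slot after that of the parent of `b` to slot `s`. -/
def commFrom (b : B) (s : ℕ) (v : V) (t : ℝ≥0) : Set V :=
  G.commRange v t (G.slot (G.parent b) + 1) s

/-- The LMD-GHOST support of `b` among these committees, in the view of `v` at time `t`. -/
def support (b : B) (s : ℕ) (v : V) (t : ℝ≥0) : Set V :=
  G.ghostSupporters b (G.filLmdGhost (G.comm v t) (G.view v t) t) ∩ G.commFrom b s v t

/-- LMD-GHOST safety indicator. -/
noncomputable def indicatorQ (b : B) (s : ℕ) (v : V) (t : ℝ≥0) (C : Chk B) : ℝ :=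
  weight (G.ebaC C) (G.support b s v t) / weight (G.ebaC C) (G.commFrom b s v t)

/-- Full LMD-GHOST safety condition. -/
def isLMDGHOSTSafeFull (v : V) (b : B) (C : Chk B) (t : ℝ≥0) : Prop :=
  ∀ b', G.Anc b' b →
    (1 + K.rewardRate) / (2 * (1 - K.penaltyRate)) *
        (1 + G.boostWeight C * (1 + K.exitRate + K.rewardRate) /
          weight (G.ebaC C) (G.commFrom b' (G.slotAt t - 1) v t)) +
      K.exitRate * totalWeight (G.ebaC C) /
        weight (G.ebaC C) (G.commFrom b' (G.slotAt t - 1) v t) +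
      K.β < G.indicatorQ b' (G.slotAt t - 1) v t C ∨
    b' = G.genesis

/-- FFG votes received so far, plus those expected from the rest of the epoch, suffice to justify
the checkpoint of `b` for epoch `e`. -/
def willChkpBeJustified (v : V) (b : B) (e : ℕ) (t : ℝ≥0) : Prop :=
  totalWeight (G.ebaC (G.chkOf b e)) *
      (2 / 3 * ((1 + K.rewardRate - K.exitRate * K.rewardRate) / (1 - K.penaltyRate)) +
        K.exitRate) +
    (min K.maxSlash (ENNReal.ofReal (K.β * totalWeight (G.ebaC (G.chkOf b e))))).toReal ≤
  weight (G.ebaC (G.chkOf b e))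
      (G.ffgSeen (G.VS b e) (G.chkOf b e) v t ∩
        G.commRange v t (G.firstSlot e) (G.slotAt t - 1)) +
    (1 - K.β) * weight (G.ebaC (G.chkOf b e))
      (G.commRange v t (G.slotAt t) (G.lastSlot e))

open Classical in
def isConfirmedNoCaching (v : V) (b : B) (t : ℝ≥0) : Prop :=
  if G.epochB b = G.epochAt t then
    G.willChkpBeJustified K v b (G.epochAt t) t ∧
    (G.GJ b).epoch + 1 = G.epochAt t ∧
    G.isLMDGHOSTSafeFull K v b (G.GJ b) t
  else
    G.slotAt t = G.firstSlot (G.epochAt t) ∧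
    G.willChkpBeJustified K v b (G.epochAt t - 1) t ∧
    ∃ b', Msg.block b' ∈ G.view v (G.slotStart (G.slotAt t - 1)) ∧
      G.Anc b b' ∧ G.epochB b' < G.epochAt t ∧
      G.epochAt t ≤ (G.VS b' (G.epochAt t)).epoch + 2 ∧
      G.isLMDGHOSTSafeFull K v b (G.VS b' (G.epochAt t)) t

/-- Blocks in view at the beginning of slot `s` that are confirmed, without caching, then. -/
def confirmedAtSlot (v : V) (s : ℕ) : Set B :=
  {b | Msg.block b ∈ G.view v (G.slotStart s) ∧ G.isConfirmedNoCaching K v b (G.slotStart s)}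

/-- For each slot from the second slot of epoch `e` to that of `t`, the highest block confirmed. -/
def highestConfirmedBlocksPerSlot (v : V) (e : ℕ) (t : ℝ≥0) : Set B :=
  {b | ∃ s, G.firstSlot e + 1 ≤ s ∧ s ≤ G.slotAt t ∧ (G.confirmedAtSlot K v s).Nonempty ∧
    b = G.argmaxB (G.confirmedAtSlot K v s) (fun b => G.slot b)}

def highestConfirmedSinceEpoch (v : V) (e : ℕ) (t : ℝ≥0) : B :=
  G.argmaxB (G.highestConfirmedBlocksPerSlot K v e t) (fun b => G.slot b)

/-- The output of the algorithm; nothing is confirmed if there is no highest confirmed block. -/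
def isConfirmed (v : V) (b : B) (t : ℝ≥0) : Prop :=
  (G.highestConfirmedBlocksPerSlot K v (G.epochAt t - 1) t).Nonempty ∧
    G.Anc b (G.highestConfirmedSinceEpoch K v (G.epochAt t - 1) t)

/-- `(conf, sg)` is a Confirmation Rule for the fork choice whose output, for validator `v` at
time `t`, is `fc v t`. -/
def IsConfirmationRule (fc : V → ℝ≥0 → B) (conf : V → B → ℝ≥0 → Prop)
    (sg : B → ℝ≥0 → ℝ≥0 → Prop) : Prop :=
  ∀ b t, sg b t G.GGST → ∀ v ∈ G.honest, conf v b t →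
    (∃ t₀, ∀ v' ∈ G.honest, ∀ t' ≥ t₀, G.Anc b (fc v' t')) ∧
    (∀ t' ≥ t, conf v b t')

/-- The security guard: `b` is not older than the previous epoch, which starts after `ggst`. -/
def securityGuard (b : B) (t ggst : ℝ≥0) : Prop :=
  G.epochAt t ≤ G.epochB b + 1 ∧ ggst ≤ G.epochStart (G.epochAt t - 1)

end Gasper

/-! ### Weights of validator sets, and how balance changes affect them -/

section Weight

variable {V : Type*}

/-! The proof rests on an invariant that reproduces itself from one epoch to the next, `Stage`. For
an epoch `f` it consists of a block `c` whose LMD-GHOST support, measured with a justified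
checkpoint `C` of epoch at least `f - 1`, survives one epoch of balance changes (`RobustSupport`);
of enough FFG votes for the checkpoint of `c` for epoch `f`, which is also the only checkpoint of
that epoch that can ever be justified; and of a descendant `b` of `c` that justifies `C` and is
known to all honest validators from the start of epoch `f + 1`.

During epoch `f + 1` the greatest justified checkpoint of an honest validator can only be `C` or the
checkpoint of `c` for `f`. Balances thus differ from those of `C` by at most one change, which
robust support absorbs (`majority`), while descendants of `b`, or of a block having that checkpoint
as voting source, keep the chain of `c` unfiltered. By induction on slots every honest vote goes to
`c`, which therefore stays canonical (`anc_canonical_of_robust`, `Stage.anc_canonical`).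

The FFG votes of the stage are two thirds of the weight in every relevant block
(`two_thirds_of_ffg`), so the strengthened justification assumption applies. It yields a checkpoint
of epoch `f + 1` whose block `c'` descends from `c` and for which most honest validators vote. Each
of these FFG votes comes with a GHOST vote for a descendant of `c'`; measured with the previous
justified checkpoint, these votes meet the LMD-GHOST safety condition (`safe_of_ffg`). Hence `c'`
carries a stage for `f + 1` and is itself confirmed in the first slot of epoch `f + 2`
(`Stage.next`).

A recent confirmed block carries a stage (`stage_of_confirmed`), and safety follows by iterating.
For monotonicity, blocks of two stages are both canonical later on and so lie on one chain. While
the old confirmed block is within the range of slots searched, it still counts; afterwards a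
descendant coming from `Stage.next` replaces it. A rival confirmed in the first slot of the epoch
may be too old to carry a stage; it then has robust support at the same slot as the stage, and two
robustly supported blocks cannot conflict (`comparable_of_robust`). -/

open Classical in
theorem weight_eq_sum (bal : V →₀ ℝ≥0) (X : Set V) (s : Finset V) (hs : bal.support ⊆ s) :
    weight bal X = ∑ v ∈ s, if v ∈ X then (bal v : ℝ) else 0 := by
  rw [weight, Finset.sum_filter]
  refine Finset.sum_subset hs fun v _ hv => ?_
  simp [Finsupp.notMem_support_iff.1 hv]

theorem weight_nonneg (bal : V →₀ ℝ≥0) (X : Set V) : 0 ≤ weight bal X :=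
  Finset.sum_nonneg fun _ _ => NNReal.coe_nonneg _

theorem weight_mono (bal : V →₀ ℝ≥0) {X Y : Set V} (h : X ⊆ Y) : weight bal X ≤ weight bal Y := by
  classical
  rw [weight_eq_sum bal X _ subset_rfl, weight_eq_sum bal Y _ subset_rfl]
  refine Finset.sum_le_sum fun v _ => ?_
  by_cases hv : v ∈ X
  · simp [hv, h hv]
  · rw [if_neg hv]; split_ifs <;> simp

theorem weight_le_total (bal : V →₀ ℝ≥0) (X : Set V) : weight bal X ≤ totalWeight bal :=
  weight_mono bal (Set.subset_univ X)

theorem weight_inter_add_diff (bal : V →₀ ℝ≥0) (X Y : Set V) :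
    weight bal (X ∩ Y) + weight bal (X \ Y) = weight bal X := by
  classical
  simp only [weight_eq_sum bal _ _ subset_rfl, ← Finset.sum_add_distrib]
  refine Finset.sum_congr rfl fun v _ => ?_
  by_cases hX : v ∈ X <;> by_cases hY : v ∈ Y <;> simp [hX, hY]

theorem weight_union_le (bal : V →₀ ℝ≥0) (X Y : Set V) :
    weight bal (X ∪ Y) ≤ weight bal X + weight bal Y := by
  rw [← weight_inter_add_diff bal (X ∪ Y) X]
  exact add_le_add (weight_mono bal Set.inter_subset_right)
    (weight_mono bal fun v hv => hv.1.resolve_left hv.2)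

theorem weight_union (bal : V →₀ ℝ≥0) {X Y : Set V} (h : Disjoint X Y) :
    weight bal (X ∪ Y) = weight bal X + weight bal Y := by
  rw [← weight_inter_add_diff bal (X ∪ Y) X, Set.union_inter_cancel_left, Set.union_sdiff_left,
    h.sdiff_eq_right]

theorem weight_inter_valset (bal : V →₀ ℝ≥0) (X : Set V) :
    weight bal (X ∩ valset bal) = weight bal X := by
  classical
  simp only [weight_eq_sum bal _ _ subset_rfl]
  refine Finset.sum_congr rfl fun v hv => ?_
  have : v ∈ valset bal := pos_iff_ne_zero.2 (Finsupp.mem_support_iff.1 hv)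
  simp [this]

theorem weight_of_valset_subset (bal : V →₀ ℝ≥0) {X : Set V} (h : valset bal ⊆ X) :
    weight bal X = totalWeight bal := by
  refine le_antisymm (weight_le_total bal X) ?_
  rw [totalWeight, ← weight_inter_valset bal Set.univ, Set.univ_inter]
  exact weight_mono bal h

theorem weight_le_mul {bal bal' : V →₀ ℝ≥0} {X : Set V} {c : ℝ}
    (h : ∀ v ∈ X, (bal' v : ℝ) ≤ bal v * c) : weight bal' X ≤ weight bal X * c := by
  classical
  rw [weight_eq_sum bal' X (bal.support ∪ bal'.support) Finset.subset_union_right,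
    weight_eq_sum bal X (bal.support ∪ bal'.support) Finset.subset_union_left, Finset.sum_mul]
  refine Finset.sum_le_sum fun v _ => ?_
  by_cases hv : v ∈ X
  · simpa [hv] using h v hv
  · simp [hv]

theorem mul_le_weight {bal bal' : V →₀ ℝ≥0} {X : Set V} {c : ℝ}
    (h : ∀ v ∈ X, bal v * c ≤ (bal' v : ℝ)) : weight bal X * c ≤ weight bal' X := by
  classical
  rw [weight_eq_sum bal' X (bal.support ∪ bal'.support) Finset.subset_union_right,
    weight_eq_sum bal X (bal.support ∪ bal'.support) Finset.subset_union_left, Finset.sum_mul]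
  refine Finset.sum_le_sum fun v _ => ?_
  by_cases hv : v ∈ X
  · simpa [hv] using h v hv
  · simp [hv]

theorem nonempty_of_weight_pos {bal : V →₀ ℝ≥0} {X : Set V} (h : 0 < weight bal X) :
    X.Nonempty := by
  by_contra hX
  rw [Set.not_nonempty_iff_eq_empty] at hX
  simp [weight, hX] at h

namespace Gasper.ChangeWithin

variable {K : Constants} {bal bal' : V →₀ ℝ≥0} {D : Set V}

/-- Members of `X` that exit do not contribute to the weight of `X` after the change. -/
theorem weight_le_of_exit (h : ChangeWithin K bal bal' D) (X : Set V) :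
    weight bal' X ≤ (weight bal X - weight bal (X ∩ (valset bal \ valset bal'))) *
      (1 + K.rewardRate) + totalWeight bal * K.exitRate := by
  have h1 := weight_inter_add_diff bal' (X ∩ valset bal') (valset bal)
  rw [weight_inter_valset] at h1
  have h2 : weight bal' (X ∩ valset bal' ∩ valset bal) ≤
      weight bal (X ∩ valset bal' ∩ valset bal) * (1 + K.rewardRate) :=
    weight_le_mul fun v hv => h.reward_le v ⟨hv.2, hv.1.2⟩
  have h3 : weight bal' ((X ∩ valset bal') \ valset bal) ≤ totalWeight bal * K.exitRate :=
    le_trans (weight_mono bal' (Y := valset bal' \ valset bal) fun v hv => ⟨hv.1.2, hv.2⟩)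
      h.entry_le
  have h4 := weight_inter_add_diff bal (X ∩ valset bal) (valset bal')
  rw [weight_inter_valset] at h4
  have h5 : X ∩ valset bal' ∩ valset bal = X ∩ valset bal ∩ valset bal' := by
    ext; simp only [Set.mem_inter_iff]; tauto
  have h6 : X ∩ (valset bal \ valset bal') = (X ∩ valset bal) \ valset bal' := by
    ext; simp only [Set.mem_inter_iff, Set.mem_sdiff]; tauto
  rw [h5] at h2 h1
  rw [h6]
  have h7 : weight bal X - weight bal ((X ∩ valset bal) \ valset bal') =
    weight bal (X ∩ valset bal ∩ valset bal') := by linarith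
  rw [h7]
  linarith

theorem weight_le (h : ChangeWithin K bal bal' D) (hr : 0 ≤ K.rewardRate) (X : Set V) :
    weight bal' X ≤ weight bal X * (1 + K.rewardRate) + totalWeight bal * K.exitRate := by
  have h1 := h.weight_le_of_exit X
  have h2 := weight_nonneg bal (X ∩ (valset bal \ valset bal'))
  nlinarith [mul_nonneg h2 (by linarith : 0 ≤ 1 + K.rewardRate)]

/-- Exits are removed from the set and not subtracted as weight. This lets `safe_of_ffg` apply the
exit bound before the `β`-bound, so that the two losses multiply. -/
theorem inter_weight_ge (h : ChangeWithin K bal bal' D) {X : Set V} (hX : Disjoint X D) :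
    weight bal (X ∩ valset bal') * (1 - K.penaltyRate) ≤ weight bal' X := by
  rw [← weight_inter_valset bal (X ∩ valset bal')]
  refine (mul_le_weight fun v hv => ?_).trans
    (weight_mono bal' (X := X ∩ valset bal' ∩ valset bal) fun v hv => hv.1.1)
  exact h.penalty_le v ⟨⟨hv.2, hv.1.2⟩, fun hD => Set.disjoint_left.1 hX hv.1.1 hD⟩

/-- The exited weight stays a variable so that the same quantity occurs here and in
`weight_le_of_exit`. Taking the worst case separately in the two bounds would be too lossy for the
two-thirds condition. -/
theorem weight_ge_of_exit (h : ChangeWithin K bal bal' D) {X : Set V} (hX : Disjoint X D)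
    (hq : K.penaltyRate ≤ 1) :
    (weight bal X - weight bal (valset bal \ valset bal')) * (1 - K.penaltyRate) ≤
      weight bal' X := by
  refine le_trans (mul_le_mul_of_nonneg_right ?_ (by linarith)) (h.inter_weight_ge hX)
  have h1 := weight_inter_add_diff bal X (valset bal')
  have h2 : weight bal (X \ valset bal') ≤ weight bal (valset bal \ valset bal') := by
    rw [← weight_inter_valset]
    exact weight_mono bal fun v hv => ⟨hv.2, hv.1.2⟩
  linarith

theorem weight_ge (h : ChangeWithin K bal bal' D) {X : Set V} (hX : Disjoint X D)
    (hq : K.penaltyRate ≤ 1) :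
    (weight bal X - totalWeight bal * K.exitRate) * (1 - K.penaltyRate) ≤ weight bal' X :=
  le_trans (mul_le_mul_of_nonneg_right (by linarith [h.exit_le]) (by linarith))
    (h.weight_ge_of_exit hX hq)

end Gasper.ChangeWithin

end Weight

namespace Gasper

variable {V B : Type*} (G : Gasper V B)

/-! ### The block tree and the order of checkpoints -/

section Tree

theorem Anc.refl (b : B) : G.Anc b b := ⟨0, rfl⟩

variable {G}

theorem Anc.trans {a b c : B} : G.Anc a b → G.Anc b c → G.Anc a c := by
  rintro ⟨i, rfl⟩ ⟨j, rfl⟩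
  exact ⟨i + j, Function.iterate_add_apply _ _ _ _⟩

theorem anc_parent (b : B) : G.Anc (G.parent b) b := ⟨1, rfl⟩

theorem slot_parent_le (b : B) : G.slot (G.parent b) ≤ G.slot b := by
  by_cases hb : b = G.genesis
  · rw [hb, G.parent_genesis]
  · exact (G.slot_parent_lt b hb).le

theorem Anc.eq_or_parent {a b : B} (h : G.Anc a b) :
    a = b ∨ (b ≠ G.genesis ∧ G.Anc a (G.parent b)) := by
  obtain ⟨k, rfl⟩ := h
  cases k with
  | zero => exact Or.inl rfl
  | succ k =>
    by_cases hb : b = G.genesis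
    · left
      rw [hb]
      exact Function.iterate_fixed G.parent_genesis _
    · exact Or.inr ⟨hb, k, rfl⟩

theorem Anc.slot_le {a b : B} (h : G.Anc a b) : G.slot a ≤ G.slot b := by
  obtain ⟨k, rfl⟩ := h
  induction k generalizing b with
  | zero => exact le_rfl
  | succ k ih => exact (ih (b := G.parent b)).trans (slot_parent_le b)

theorem Anc.eq_of_slot_le {a b : B} (h : G.Anc a b) (hs : G.slot b ≤ G.slot a) : a = b := by
  rcases h.eq_or_parent with h | ⟨hb, h⟩
  · exact h
  · have h1 := h.slot_le
    have h2 := G.slot_parent_lt b hb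
    omega

theorem Anc.antisymm {a b : B} (h : G.Anc a b) (h' : G.Anc b a) : a = b :=
  h.eq_of_slot_le h'.slot_le

theorem genesis_anc (b : B) : G.Anc G.genesis b := by
  induction h : G.slot b using Nat.strong_induction_on generalizing b with
  | _ n ih =>
    by_cases hb : b = G.genesis
    · rw [hb]; exact Anc.refl G _
    · exact (ih _ (h ▸ G.slot_parent_lt b hb) _ rfl).trans (anc_parent b)

theorem Anc.eq_genesis {a : B} (h : G.Anc a G.genesis) : a = G.genesis :=
  h.antisymm (genesis_anc a)

theorem Anc.comparable {a b c : B} (ha : G.Anc a c) (hb : G.Anc b c) : G.Anc a b ∨ G.Anc b a := by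
  obtain ⟨i, rfl⟩ := ha
  obtain ⟨j, rfl⟩ := hb
  rcases le_total i j with h | h
  · exact Or.inr ⟨j - i, by rw [← Function.iterate_add_apply, Nat.sub_add_cancel h]⟩
  · exact Or.inl ⟨i - j, by rw [← Function.iterate_add_apply, Nat.sub_add_cancel h]⟩

theorem Anc.of_slot_le {a b c : B} (ha : G.Anc a c) (hb : G.Anc b c)
    (h : G.slot a ≤ G.slot b) : G.Anc a b := by
  rcases ha.comparable hb with h1 | h1
  · exact h1
  · rw [h1.eq_of_slot_le h]; exact Anc.refl G _

/-- The child of `a` towards a strict descendant `b`. -/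
theorem Anc.exists_child {a b : B} (h : G.Anc a b) (hne : a ≠ b) :
    ∃ c, c ≠ G.genesis ∧ G.parent c = a ∧ G.Anc c b := by
  obtain ⟨k, hk⟩ := h
  induction k generalizing b with
  | zero => exact absurd hk.symm hne
  | succ k ih =>
    by_cases hb : a = G.parent b
    · refine ⟨b, fun hg => hne ?_, hb.symm, Anc.refl G b⟩
      rw [hb, hg, G.parent_genesis]
    · obtain ⟨c, h1, h2, h3⟩ := ih hb hk
      exact ⟨c, h1, h2, h3.trans (anc_parent b)⟩

/-- Two blocks that do not lie on one chain descend from distinct siblings. -/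
theorem exists_siblings {a b : B} (hab : ¬ G.Anc a b) (hba : ¬ G.Anc b a) :
    ∃ a' b', G.Anc a' a ∧ G.Anc b' b ∧ a' ≠ G.genesis ∧ b' ≠ G.genesis ∧
      G.parent a' = G.parent b' ∧ a' ≠ b' := by
  obtain ⟨k, hk⟩ := genesis_anc (G := G) b
  induction k generalizing b with
  | zero => 
    have hk : b = G.genesis := hk
    exact absurd (hk ▸ genesis_anc a) hba
  | succ k ih =>
    have hb : b ≠ G.genesis := fun h => hba (h ▸ genesis_anc a)
    by_cases h : G.Anc (G.parent b) a
    · have hne : G.parent b ≠ a := fun h' => hab (h' ▸ anc_parent b)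
      obtain ⟨c, h1, h2, h3⟩ := h.exists_child hne
      exact ⟨c, b, h3, Anc.refl G b, h1, hb, h2, fun h' => hba (h' ▸ h3)⟩
    · obtain ⟨a', b', h1, h2, h3⟩ := ih (fun h' => hab (h'.trans (anc_parent b))) h hk
      exact ⟨a', b', h1, h2.trans (anc_parent b), h3⟩

theorem not_anc_of_siblings {a b c : B} (ha : a ≠ G.genesis) (hb : b ≠ G.genesis)
    (hp : G.parent a = G.parent b) (hne : a ≠ b) (hac : G.Anc a c) : ¬ G.Anc b c := by
  intro hbc
  have key : ∀ {x y : B}, x ≠ G.genesis → y ≠ G.genesis → G.parent x = G.parent y →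
      G.Anc x y → x = y := by
    intro x y hx hy hp h
    rcases h.eq_or_parent with h | ⟨_, h⟩
    · exact h
    · rw [← hp] at h
      have h1 := h.slot_le
      have h2 := G.slot_parent_lt x hx
      omega
  rcases hac.comparable hbc with h | h
  · exact hne (key ha hb hp h)
  · exact hne (key hb ha hp.symm h).symm

theorem highestAnc_anc (b : B) (P : B → Prop) : G.Anc (G.highestAnc b P) b := ⟨_, rfl⟩

theorem highestAnc_spec {b a : B} {P : B → Prop} (ha : G.Anc a b) (hP : P a) :
    P (G.highestAnc b P) := by
  obtain ⟨k, rfl⟩ := ha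
  exact Nat.sInf_mem (s := {k | P (G.parent^[k] b)}) ⟨k, hP⟩

theorem anc_highestAnc {b a : B} {P : B → Prop} (ha : G.Anc a b) (hP : P a) :
    G.Anc a (G.highestAnc b P) := by
  obtain ⟨k, rfl⟩ := ha
  have h : sInf {k | P (G.parent^[k] b)} ≤ k := Nat.sInf_le hP
  exact ⟨k - sInf {k | P (G.parent^[k] b)}, by
    rw [highestAnc, ← Function.iterate_add_apply, Nat.sub_add_cancel h]⟩

theorem highestAnc_eq {b a : B} {P : B → Prop} (ha : G.Anc a b) (hP : P a)
    (hmax : ∀ c, G.Anc c b → P c → G.Anc c a) : G.highestAnc b P = a :=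
  (hmax _ (highestAnc_anc b P) (highestAnc_spec ha hP)).antisymm (anc_highestAnc ha hP)

theorem chkOf_anc (b : B) (e : ℕ) : G.Anc (G.chkOf b e).block b :=
  highestAnc_anc b (fun a => G.slot a ≤ G.firstSlot e)

theorem slot_chkOf_le (b : B) (e : ℕ) : G.slot (G.chkOf b e).block ≤ G.firstSlot e :=
  highestAnc_spec (P := fun a => G.slot a ≤ G.firstSlot e) (genesis_anc b)
    (by simp [G.slot_genesis])

theorem anc_chkOf {a b : B} {e : ℕ} (ha : G.Anc a b) (hs : G.slot a ≤ G.firstSlot e) :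
    G.Anc a (G.chkOf b e).block :=
  anc_highestAnc (P := fun a => G.slot a ≤ G.firstSlot e) ha hs

theorem chkOf_eq {b c : B} {e : ℕ} (hc : G.Anc c b) (hs : G.slot c ≤ G.firstSlot e)
    (hmax : ∀ a, G.Anc a b → G.slot a ≤ G.firstSlot e → G.Anc a c) : G.chkOf b e = ⟨c, e⟩ := by
  rw [chkOf, highestAnc_eq (P := fun a => G.slot a ≤ G.firstSlot e) hc hs hmax]

theorem chkOf_of_slot_le {c : B} {e : ℕ} (hs : G.slot c ≤ G.firstSlot e) :
    G.chkOf c e = ⟨c, e⟩ :=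
  chkOf_eq (Anc.refl G c) hs fun _ ha _ => ha

/-- The checkpoint of `b` is that of any block between it and `b`. -/
theorem chkOf_of_between {b c : B} {e : ℕ} (hc : G.Anc c b)
    (h : G.Anc (G.chkOf b e).block c) : G.chkOf c e = G.chkOf b e :=
  chkOf_eq h (slot_chkOf_le b e) fun _ ha hs => anc_chkOf (ha.trans hc) hs

/-- The checkpoint block has slot at most that of `c`, hence is an ancestor of `c`; prolonging the
chain beyond `c` cannot change it. -/
theorem chkOf_of_le_slot {b c : B} {e : ℕ} (hc : G.Anc c b) (hs : G.firstSlot e ≤ G.slot c) :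
    G.chkOf b e = G.chkOf c e :=
  (chkOf_of_between hc ((chkOf_anc b e).of_slot_le hc ((slot_chkOf_le b e).trans hs))).symm

theorem firstSlot_mono : Monotone G.firstSlot := fun _ _ h => Nat.mul_le_mul_right _ h

theorem chkOf_block_anc {b : B} {e e' : ℕ} (h : e ≤ e') :
    G.Anc (G.chkOf b e).block (G.chkOf b e').block :=
  anc_chkOf (chkOf_anc b e) ((slot_chkOf_le b e).trans (firstSlot_mono h))

theorem chkOf_chkOf {b : B} {e e' : ℕ} (h : e ≤ e') :
    G.chkOf (G.chkOf b e').block e = G.chkOf b e :=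
  chkOf_of_between (chkOf_anc b e') (chkOf_block_anc h)

theorem isChk_chkOf (b : B) (e : ℕ) : G.IsChk (G.chkOf b e) := chkOf_chkOf le_rfl

theorem ChkLeBlock.isChk {C : Chk B} {b : B} (h : G.ChkLeBlock C b) : G.IsChk C :=
  h ▸ isChk_chkOf b C.epoch

theorem ChkLeBlock.anc {C : Chk B} {b : B} (h : G.ChkLeBlock C b) : G.Anc C.block b := by
  have := chkOf_anc (G := G) b C.epoch
  rwa [show G.chkOf b C.epoch = C from h] at this

theorem IsChk.slot_le {C : Chk B} (h : G.IsChk C) : G.slot C.block ≤ G.firstSlot C.epoch := by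
  have := slot_chkOf_le (G := G) C.block C.epoch
  rwa [show G.chkOf C.block C.epoch = C from h] at this

theorem chkLe_refl (C : Chk B) : G.ChkLe C C := Or.inl rfl

/-- Checkpoints of a chain are ordered by their epochs. -/
theorem ChkLeBlock.chkLe {C : Chk B} {b : B} {e : ℕ} (h : G.ChkLeBlock C b) (he : C.epoch ≤ e) :
    G.ChkLe C (G.chkOf b e) := by
  rcases he.eq_or_lt with rfl | hlt
  · left; exact h.symm
  · right
    exact ⟨hlt, (chkOf_chkOf he).trans h⟩

theorem ChkLeBlock.chkLe' {C C' : Chk B} {b : B} (h : G.ChkLeBlock C b) (h' : G.ChkLeBlock C' b)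
    (he : C.epoch ≤ C'.epoch) : G.ChkLe C C' := by
  have := h.chkLe he
  rwa [show G.chkOf b C'.epoch = C' from h'] at this

theorem ChkLe.chkLeBlock {C C' : Chk B} {b : B} (h : G.ChkLe C C') (h' : G.ChkLeBlock C' b) :
    G.ChkLeBlock C b := by
  rcases h with rfl | ⟨hlt, h⟩
  · exact h'
  · have h1 : G.chkOf (G.chkOf b C'.epoch).block C.epoch = G.chkOf b C.epoch := chkOf_chkOf hlt.le
    rw [show G.chkOf b C'.epoch = C' from h'] at h1
    exact h1.symm.trans h

end Tree

/-! ### Slots, epochs and their starting times -/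

section Time

variable {G}

theorem slotsPerEpoch_pos : 0 < G.slotsPerEpoch := by
  have := G.two_le_slotsPerEpoch; omega

theorem firstSlot_succ (e : ℕ) : G.firstSlot (e + 1) = G.firstSlot e + G.slotsPerEpoch :=
  Nat.succ_mul _ _

theorem lastSlot_add_one (e : ℕ) : G.lastSlot e + 1 = G.firstSlot (e + 1) := by
  have h := G.two_le_slotsPerEpoch
  have : 1 ≤ (e + 1) * G.slotsPerEpoch := by nlinarith
  rw [lastSlot, firstSlot]; omega

theorem firstSlot_lt_lastSlot (e : ℕ) : G.firstSlot e < G.lastSlot e := by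
  have h := G.two_le_slotsPerEpoch
  have h1 := lastSlot_add_one (G := G) e
  rw [firstSlot_succ] at h1
  omega

theorem le_epochOfSlot_iff {e s : ℕ} : e ≤ G.epochOfSlot s ↔ G.firstSlot e ≤ s :=
  Nat.le_div_iff_mul_le slotsPerEpoch_pos

theorem epochOfSlot_lt_iff {e s : ℕ} : G.epochOfSlot s < e ↔ s < G.firstSlot e := by
  rw [← not_le, le_epochOfSlot_iff, not_le]

theorem epochOfSlot_eq_iff {e s : ℕ} :
    G.epochOfSlot s = e ↔ G.firstSlot e ≤ s ∧ s ≤ G.lastSlot e := by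
  have h1 : s ≤ G.lastSlot e ↔ G.epochOfSlot s < e + 1 := by
    rw [epochOfSlot_lt_iff, ← lastSlot_add_one, Nat.lt_succ_iff]
  rw [← le_epochOfSlot_iff, h1]
  omega

theorem epochOfSlot_mono : Monotone G.epochOfSlot := fun _ _ h => Nat.div_le_div_right h

theorem epochOfSlot_firstSlot (e : ℕ) : G.epochOfSlot (G.firstSlot e) = e :=
  epochOfSlot_eq_iff.2 ⟨le_rfl, (firstSlot_lt_lastSlot e).le⟩

theorem Anc.epochB_le {a b : B} (h : G.Anc a b) : G.epochB a ≤ G.epochB b :=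
  epochOfSlot_mono h.slot_le

theorem bddAbove_slotStart_le (t : ℝ≥0) : BddAbove {s | G.slotStart s ≤ t} := by
  obtain ⟨n, hn⟩ := (G.slotStart_tendsto.eventually_gt_atTop t).exists
  exact ⟨n, fun s hs => le_of_not_gt fun h => absurd (hs.trans_lt hn)
    (not_lt.2 (G.slotStart_strictMono h).le)⟩

theorem slotStart_slotAt_le (t : ℝ≥0) : G.slotStart (G.slotAt t) ≤ t :=
  Nat.sSup_mem (s := {s | G.slotStart s ≤ t}) ⟨0, by simp [G.slotStart_zero]⟩
    (bddAbove_slotStart_le t)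

/-- A Galois connection, through which comparisons of times become arithmetic of slots. -/
theorem le_slotAt_iff {s : ℕ} {t : ℝ≥0} : s ≤ G.slotAt t ↔ G.slotStart s ≤ t :=
  ⟨fun h => (G.slotStart_strictMono.monotone h).trans (slotStart_slotAt_le t),
    fun h => le_csSup (bddAbove_slotStart_le t) h⟩

theorem slotAt_lt_iff {s : ℕ} {t : ℝ≥0} : G.slotAt t < s ↔ t < G.slotStart s := by
  rw [← not_le, le_slotAt_iff, not_le]

theorem slotAt_slotStart (s : ℕ) : G.slotAt (G.slotStart s) = s :=
  le_antisymm (Nat.lt_succ_iff.1 (slotAt_lt_iff.2 (G.slotStart_strictMono s.lt_succ_self)))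
    (le_slotAt_iff.2 le_rfl)

theorem slotAt_mono : Monotone G.slotAt := fun _ _ h =>
  le_slotAt_iff.2 ((slotStart_slotAt_le _).trans h)

theorem epochAt_mono : Monotone G.epochAt := epochOfSlot_mono.comp slotAt_mono

theorem epochAt_slotStart (s : ℕ) : G.epochAt (G.slotStart s) = G.epochOfSlot s := by
  rw [epochAt, slotAt_slotStart]

theorem slotAt_epochStart (e : ℕ) : G.slotAt (G.epochStart e) = G.firstSlot e :=
  slotAt_slotStart _

theorem epochAt_epochStart (e : ℕ) : G.epochAt (G.epochStart e) = e := by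
  rw [epochStart, epochAt_slotStart, epochOfSlot_firstSlot]

theorem epochStart_mono : Monotone G.epochStart :=
  G.slotStart_strictMono.monotone.comp firstSlot_mono

theorem le_epochAt_iff {e : ℕ} {t : ℝ≥0} : e ≤ G.epochAt t ↔ G.epochStart e ≤ t := by
  rw [epochAt, le_epochOfSlot_iff, le_slotAt_iff, epochStart]

/-- This excludes epoch `0` once the security guard holds, so that the truncated subtractions of
epochs are genuine ones. -/
theorem epochStart_one_le_GGST : G.epochStart 1 ≤ G.GGST := by
  unfold GGST
  split_ifs <;> exact epochStart_mono (by omega)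

end Time

end Gasper

namespace Gasper

variable {V B : Type*} {G : Gasper V B} {K : Constants}

/-! ### Voting sources and justified checkpoints of a block -/

section Justification

theorem GU_mem (b : B) : G.GU b ∈ G.unrealized b :=
  (G.maxChk_spec _ (G.unrealized_finite b)
    ⟨_, G.finalized_subset b (G.genesis_mem_finalized b)⟩).1

theorem epoch_le_GU {b : B} {C : Chk B} (h : C ∈ G.unrealized b) : C.epoch ≤ (G.GU b).epoch :=
  (G.maxChk_spec _ (G.unrealized_finite b) ⟨_, h⟩).2 C h

theorem genesisChk_mem (b : B) : G.genesisChk ∈ G.unrealized b :=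
  G.finalized_subset b (G.genesis_mem_finalized b)

theorem epochB_genesis : G.epochB G.genesis = 0 := by
  rw [epochB, G.slot_genesis, epochOfSlot, Nat.zero_div]

theorem slot_lt_of_epochB_lt {a b : B} (h : G.epochB a < G.epochB b) : G.slot a < G.slot b := by
  by_contra hab
  exact absurd (epochOfSlot_mono (G := G) (not_lt.1 hab)) (not_le.2 h)

theorem GJ_of_ne {b : B} (hb : G.epochB b ≠ 0) :
    G.GJ b = G.GU (G.highestAnc b fun a => G.epochB a < G.epochB b) := if_neg hb

theorem epochB_highestAnc_lt {b : B} (hb : G.epochB b ≠ 0) :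
    G.epochB (G.highestAnc b fun a => G.epochB a < G.epochB b) < G.epochB b :=
  highestAnc_spec (P := fun a => G.epochB a < G.epochB b) (genesis_anc b)
    (by rw [epochB_genesis]; omega)

/-- Two blocks of one epoch on one chain have the same last ancestor from an earlier epoch. -/
theorem GJ_eq_of_anc {a b : B} (h : G.Anc a b) (he : G.epochB a = G.epochB b) :
    G.GJ a = G.GJ b := by
  by_cases hb : G.epochB b = 0
  · rw [GJ, GJ, if_pos hb, if_pos (he.trans hb)]
  · have ha : G.epochB a ≠ 0 := he ▸ hb
    rw [GJ_of_ne ha, GJ_of_ne hb]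
    congr 1
    refine (highestAnc_eq ((highestAnc_anc a _).trans h) ?_ fun c hc hlt => ?_).symm
    · exact he ▸ epochB_highestAnc_lt ha
    · refine anc_highestAnc (hc.of_slot_le h (slot_lt_of_epochB_lt ?_).le) ?_ <;> omega

theorem VS_of_lt {b : B} {e : ℕ} (h : G.epochB b < e) : G.VS b e = G.GU b := if_neg h.ne

theorem VS_of_eq {b : B} {e : ℕ} (h : G.epochB b = e) : G.VS b e = G.GJ b := if_pos h

namespace GasperProperties

variable (hP : G.GasperProperties K)
include hP

theorem epoch_GU_mono {a b : B} (h : G.Anc a b) : (G.GU a).epoch ≤ (G.GU b).epoch :=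
  epoch_le_GU (hP.unrealized_mono a b h (GU_mem a))

theorem GJ_mem (b : B) : G.GJ b ∈ G.unrealized b := by
  by_cases hb : G.epochB b = 0
  · rw [GJ, if_pos hb]; exact genesisChk_mem b
  · rw [GJ_of_ne hb]
    exact hP.unrealized_mono _ _ (highestAnc_anc b _) (GU_mem _)

theorem VS_mem (b : B) (e : ℕ) : G.VS b e ∈ G.unrealized b := by
  unfold VS
  split_ifs
  · exact hP.GJ_mem b
  · exact GU_mem b

theorem epoch_GJ_lt {b : B} (hb : G.epochB b ≠ 0) : (G.GJ b).epoch < G.epochB b := by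
  rw [GJ_of_ne hb]
  exact (hP.unrealized_epoch_le _ _ (GU_mem _)).trans_lt (epochB_highestAnc_lt hb)

theorem epoch_VS_lt {b : B} {e : ℕ} (hb : G.epochB b ≤ e) (he : 0 < e) : (G.VS b e).epoch < e := by
  rcases hb.eq_or_lt with h | h
  · rw [VS_of_eq h]
    exact h ▸ hP.epoch_GJ_lt (by omega)
  · rw [VS_of_lt h]
    exact (hP.unrealized_epoch_le _ _ (GU_mem _)).trans_lt h

/-- In the mixed case `b` belongs to epoch `e` and `a` to an earlier one: the last ancestor of `b`
before epoch `e`, which determines its voting source, descends from `a`. This carries the recency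
condition of the filter from a known block to every leaf above it. -/
theorem epoch_VS_mono {a b : B} {e : ℕ} (h : G.Anc a b) (hb : G.epochB b ≤ e) :
    (G.VS a e).epoch ≤ (G.VS b e).epoch := by
  have hab := h.epochB_le
  rcases hb.eq_or_lt with hb | hb
  · rw [VS_of_eq hb]
    rcases (hab.trans hb.le).eq_or_lt with ha | ha
    · rw [VS_of_eq ha, GJ_eq_of_anc h (ha.trans hb.symm)]
    · rw [VS_of_lt ha, GJ_of_ne (by omega)]
      exact hP.epoch_GU_mono (anc_highestAnc h (by omega))
  · rw [VS_of_lt hb, VS_of_lt (by omega)]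
    exact hP.epoch_GU_mono h

theorem chkOf_of_mem {b : B} {C : Chk B} (h : C ∈ G.unrealized b) : G.chkOf b C.epoch = C :=
  hP.unrealized_chain b C h

theorem isChk_of_mem {b : B} {C : Chk B} (h : C ∈ G.unrealized b) : G.IsChk C :=
  (hP.unrealized_chain b C h).isChk

end GasperProperties

end Justification

/-- The assumptions on the execution, put together. -/
structure Assumptions (G : Gasper V B) (K : Constants) : Prop where
  system : G.SystemModel
  gasper : G.GasperProperties K
  change : G.ChangeProperties K
  beta : G.BetaBound K
  slash : G.SlashBound K
  just : G.StrongJustification K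

/-! ### Views of honest validators and delivery of messages -/

section View

theorem finite_blocks {𝒱 : Set (Msg V B)} (h : 𝒱.Finite) : {b | Msg.block b ∈ 𝒱}.Finite :=
  h.preimage fun _ _ _ _ hab => Msg.block.inj hab

/-- Every block of a finite view has a descendant in the view without children in the view. -/
theorem exists_leaf {𝒱 : Set (Msg V B)} (h : 𝒱.Finite) {a : B} (ha : Msg.block a ∈ 𝒱) :
    ∃ b, Msg.block b ∈ 𝒱 ∧ G.Anc a b ∧ G.children b 𝒱 = ∅ := by
  obtain ⟨b, ⟨hb, hab⟩, hmax⟩ := Set.exists_max_image {b | Msg.block b ∈ 𝒱 ∧ G.Anc a b} G.slot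
    ((finite_blocks h).subset fun _ hb => hb.1) ⟨a, ha, Anc.refl G a⟩
  refine ⟨b, hb, hab, Set.eq_empty_of_forall_notMem ?_⟩
  rintro c ⟨hc, hg, rfl⟩
  have h1 := hmax c ⟨hc, hab.trans (anc_parent c)⟩
  have h2 := G.slot_parent_lt c hg
  omega

theorem block_mem_view {v : V} {t : ℝ≥0} {b : B} :
    Msg.block b ∈ G.view v t ↔ Msg.block b ∈ G.received v t ∧ G.slot b ≤ G.slotAt t :=
  ⟨fun h => ⟨h.1, h.2 b rfl⟩, fun h => ⟨h.1, fun _ hb => Msg.block.inj hb ▸ h.2⟩⟩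

theorem ghost_mem_view {v : V} {t : ℝ≥0} {a : GhostVote V B} :
    Msg.ghost a ∈ G.view v t ↔ Msg.ghost a ∈ G.received v t :=
  ⟨fun h => h.1, fun h => ⟨h, by simp⟩⟩

theorem epochB_le_of_mem_view {v : V} {t : ℝ≥0} {b : B} (h : Msg.block b ∈ G.view v t) :
    G.epochB b ≤ G.epochAt t := epochOfSlot_mono (block_mem_view.1 h).2

namespace SystemModel

variable (hS : G.SystemModel)
include hS

theorem view_finite {v : V} (hv : v ∈ G.honest) (t : ℝ≥0) : (G.view v t).Finite :=
  (hS.received_finite v hv t).subset fun _ h => h.1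

theorem genesis_mem_view {v : V} (hv : v ∈ G.honest) (t : ℝ≥0) :
    Msg.block G.genesis ∈ G.view v t :=
  block_mem_view.2 ⟨hS.genesis_received v hv t, by simp [G.slot_genesis]⟩

theorem view_mono {v : V} (hv : v ∈ G.honest) {t t' : ℝ≥0} (h : t ≤ t') :
    G.view v t ⊆ G.view v t' := fun _ hm =>
  ⟨hS.received_mono v hv h hm.1, fun b hb => (hm.2 b hb).trans (slotAt_mono h)⟩

theorem slotStart_add_lt {v : V} (hv : v ∈ G.honest) (s : ℕ) :
    G.slotStart s + G.Δ < G.slotStart (s + 1) :=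
  (add_le_add_left (hS.voteTime_mem v hv s).1 _).trans_lt (hS.voteTime_mem v hv s).2

/-- In both cases of the definition a whole slot fits between `GST` and `GGST`, and the voting
deadline forces every slot to last longer than `Δ`. -/
theorem GST_add_lt {v : V} (hv : v ∈ G.honest) : G.GST + G.Δ < G.GGST := by
  have key : ∀ s, G.GST ≤ G.slotStart s → ∀ e, s < G.firstSlot e → G.GST + G.Δ < G.epochStart e :=
    fun s h e hs => ((add_le_add_left h _).trans_lt (hS.slotStart_add_lt hv s)).trans_le
      (G.slotStart_strictMono.monotone hs)
  unfold GGST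
  split_ifs with h
  · exact key _ h _ (by rw [← lastSlot_add_one]; exact Nat.lt_succ_self _)
  · refine key (G.firstSlot (G.epochAt G.GST + 1)) (le_of_lt ?_) _ ?_
    · rw [← not_le]
      exact fun h' => absurd (le_epochAt_iff.2 (show G.epochStart _ ≤ _ from h')) (by omega)
    · rw [firstSlot_succ (_ + 1)]
      exact Nat.lt_add_of_pos_right slotsPerEpoch_pos

theorem slotAt_voteTime {v : V} (hv : v ∈ G.honest) (s : ℕ) : G.slotAt (G.voteTime v s) = s := by
  have h := hS.voteTime_mem v hv s
  refine le_antisymm (Nat.lt_succ_iff.1 (slotAt_lt_iff.2 ?_)) (le_slotAt_iff.2 h.1)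
  exact (le_add_of_nonneg_right zero_le).trans_lt h.2

theorem epochAt_voteTime {v : V} (hv : v ∈ G.honest) (s : ℕ) :
    G.epochAt (G.voteTime v s) = G.epochOfSlot s := by
  rw [epochAt, hS.slotAt_voteTime hv]

/-- The common deadline of all delivery arguments: what is sent or known when voting in a past slot
has arrived by `t`. -/
theorem max_voteTime_le {v : V} (hv : v ∈ G.honest) {k : ℕ} {t : ℝ≥0} (hk : k < G.slotAt t)
    (ht : G.GGST ≤ t) : max (G.voteTime v k) G.GST + G.Δ ≤ t := by
  rw [max_add]
  refine max_le ((hS.voteTime_mem v hv k).2.le.trans ?_) ((hS.GST_add_lt hv).le.trans ht)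
  exact le_slotAt_iff.1 hk

/-- Honest validators know the blocks that others have known when voting in a past slot. -/
theorem block_mem_view_of_voteTime {u v : V} (hu : u ∈ G.honest) (hv : v ∈ G.honest) {k : ℕ}
    {t : ℝ≥0} (hk : k < G.slotAt t) (ht : G.GGST ≤ t) {b : B}
    (hb : Msg.block b ∈ G.view u (G.voteTime u k)) : Msg.block b ∈ G.view v t := by
  rw [block_mem_view] at hb ⊢
  rw [hS.slotAt_voteTime hu] at hb
  exact ⟨hS.gossip u hu v hv _ _ (hS.max_voteTime_le hu hk ht) hb.1, hb.2.trans hk.le⟩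

/-- Honest validators know the blocks that others have known at the beginning of a past slot. -/
theorem block_mem_view_of_slotStart {u v : V} (hu : u ∈ G.honest) (hv : v ∈ G.honest) {k : ℕ}
    {t : ℝ≥0} (hk : k < G.slotAt t) (ht : G.GGST ≤ t) {b : B}
    (hb : Msg.block b ∈ G.view u (G.slotStart k)) : Msg.block b ∈ G.view v t :=
  hS.block_mem_view_of_voteTime hu hv hk ht
    (hS.view_mono hu (hS.voteTime_mem u hu k).1 hb)

theorem ghost_delivered {u v : V} (hu : u ∈ G.honest) (hv : v ∈ G.honest) {k : ℕ}
    {t : ℝ≥0} (hk : k < G.slotAt t) (ht : G.GGST ≤ t)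
    (hc : u ∈ G.comm u (G.voteTime u k) k) :
    Msg.ghost ⟨u, k, G.canonical u (G.voteTime u k)⟩ ∈ G.received v t :=
  hS.deliver u hu v hv _ _ (hS.max_voteTime_le hu hk ht) _
    ((hS.honest_ghost u hu _ _ _).2 ⟨hc, le_rfl, rfl⟩) rfl

theorem gjSet_finite {v : V} (hv : v ∈ G.honest) (t : ℝ≥0) (f : B → Chk B) :
    {C | ∃ b, Msg.block b ∈ G.view v t ∧ G.slot b ≤ G.slotAt t ∧ C = f b}.Finite :=
  ((finite_blocks (hS.view_finite hv t)).image f).subset fun _ ⟨b, h, _, hC⟩ => ⟨b, h, hC.symm⟩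

theorem gj_spec {v : V} (hv : v ∈ G.honest) (t : ℝ≥0) :
    (∃ b, Msg.block b ∈ G.view v t ∧ G.gj v t = G.VS b (G.epochAt t)) ∧
    ∀ b, Msg.block b ∈ G.view v t → (G.VS b (G.epochAt t)).epoch ≤ (G.gj v t).epoch := by
  have h := G.maxChk_spec _ (hS.gjSet_finite hv t fun b => G.VS b (G.epochAt t))
    ⟨_, G.genesis, hS.genesis_mem_view hv t, (block_mem_view.1 (hS.genesis_mem_view hv t)).2, rfl⟩
  obtain ⟨⟨b, hb, _, hC⟩, hmax⟩ := h
  exact ⟨⟨b, hb, hC⟩, fun b hb => hmax _ ⟨b, hb, (block_mem_view.1 hb).2, rfl⟩⟩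

end SystemModel

namespace Assumptions

variable (hA : G.Assumptions K)
include hA

theorem beta_lt : K.β < 1 / 6 := hA.just.beta_lt.trans_le (min_le_left _ _)

theorem beta_lt' : K.β < 1 / 3 - K.safetyDecay := hA.just.beta_lt.trans_le (min_le_right _ _)

theorem justified_unique {b₁ b₂ : B} {C₁ C₂ : Chk B} (h₁ : C₁ ∈ G.unrealized b₁)
    (h₂ : C₂ ∈ G.unrealized b₂) (h : C₁.epoch = C₂.epoch) : C₁ = C₂ :=
  hA.gasper.justified_unique hA.beta_lt' b₁ b₂ C₁ h₁ C₂ h₂ h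

theorem gj_mem {v : V} (hv : v ∈ G.honest) (t : ℝ≥0) : ∃ b, G.gj v t ∈ G.unrealized b := by
  obtain ⟨b, _, h⟩ := (hA.system.gj_spec hv t).1
  exact ⟨b, h ▸ hA.gasper.VS_mem b _⟩

theorem epoch_gj_lt {v : V} (hv : v ∈ G.honest) {t : ℝ≥0} (ht : 0 < G.epochAt t) :
    (G.gj v t).epoch < G.epochAt t := by
  obtain ⟨b, hb, h⟩ := (hA.system.gj_spec hv t).1
  rw [h]
  exact hA.gasper.epoch_VS_lt (epochB_le_of_mem_view hb) ht

end Assumptions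

end View

end Gasper

namespace Gasper

variable {V B : Type*} {G : Gasper V B} {K : Constants}

/-! ### The walk of GHOST, the vote filters and honest support -/

section ForkChoice

theorem ghostStep_cases {𝒱 : Set (Msg V B)} (h : 𝒱.Finite) (t : ℝ≥0) (w : B → ℝ) (b : B) :
    G.ghostStep 𝒱 t w b = b ∨ (G.ghostStep 𝒱 t w b ∈ G.children b 𝒱 ∧
      G.slot (G.ghostStep 𝒱 t w b) ≤ G.slotAt t) := by
  unfold ghostStep
  split_ifs with hne
  · exact Or.inr (G.argmaxB_spec _ w ((finite_blocks h).subset fun _ hb => hb.1.1) hne).1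
  · exact Or.inl rfl

theorem ghostStep_eq {𝒱 : Set (Msg V B)} (h : 𝒱.Finite) {t : ℝ≥0} {w : B → ℝ} {b : B}
    (hb : b ≠ G.genesis) (hmem : Msg.block b ∈ 𝒱) (hs : G.slot b ≤ G.slotAt t)
    (hw : ∀ c ∈ G.children (G.parent b) 𝒱, c ≠ b → w c < w b) :
    G.ghostStep 𝒱 t w (G.parent b) = b := by
  have hne : b ∈ {b' ∈ G.children (G.parent b) 𝒱 | G.slot b' ≤ G.slotAt t} :=
    ⟨⟨hmem, hb, rfl⟩, hs⟩
  unfold ghostStep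
  rw [if_pos ⟨b, hne⟩]
  obtain ⟨h1, h2⟩ := G.argmaxB_spec {b' ∈ G.children (G.parent b) 𝒱 | G.slot b' ≤ G.slotAt t} w
    ((finite_blocks h).subset fun _ hb => hb.1.1) ⟨b, hne⟩
  by_contra hcb
  exact absurd (hw _ h1.1 hcb) (not_lt.2 (h2 b hne))

/-- If every step towards `h` is to a heaviest child, then GHOST passes through `h`. -/
theorem anc_ghost {𝒱 : Set (Msg V B)} (hf : 𝒱.Finite) {t : ℝ≥0} {w : B → ℝ} {h : B}
    (hs : G.slot h ≤ G.slotAt t)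
    (hstep : ∀ b, G.Anc b h → b ≠ G.genesis → Msg.block b ∈ 𝒱 ∧
      ∀ c ∈ G.children (G.parent b) 𝒱, c ≠ b → w c < w b) : G.Anc h (G.ghost 𝒱 t w) := by
  -- A step towards `h` raises the slot by at least one, so after `n` steps that have not passed `h`
  -- the slot is at least `n`. The `slotAt t` iterations are therefore enough.
  have key : ∀ n, G.Anc h ((G.ghostStep 𝒱 t w)^[n] G.genesis) ∨
      (G.Anc ((G.ghostStep 𝒱 t w)^[n] G.genesis) h ∧
        n ≤ G.slot ((G.ghostStep 𝒱 t w)^[n] G.genesis)) := by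
    intro n
    induction n with
    | zero => exact Or.inr ⟨genesis_anc h, Nat.zero_le _⟩
    | succ n ih =>
      rw [Function.iterate_succ_apply']
      set a := (G.ghostStep 𝒱 t w)^[n] G.genesis
      by_cases hha : G.Anc h a
      · left
        rcases ghostStep_cases hf t w a with h1 | ⟨⟨_, _, h1⟩, _⟩
        · rwa [h1]
        · exact (h1 ▸ hha).trans (anc_parent _)
      · right
        obtain ⟨h1, h2⟩ := ih.resolve_left hha
        obtain ⟨b, hb, hp, hbh⟩ := h1.exists_child fun hah => hha (hah ▸ Anc.refl G a)
        obtain ⟨h3, h4⟩ := hstep b hbh hb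
        rw [← hp, ghostStep_eq hf hb h3 (hbh.slot_le.trans hs) h4]
        have h5 := G.slot_parent_lt b hb
        rw [hp] at h5
        exact ⟨hbh, by omega⟩
  rcases key (G.slotAt t) with h1 | ⟨h1, h2⟩
  · exact h1
  · rw [show G.ghost 𝒱 t w = (G.ghostStep 𝒱 t w)^[G.slotAt t] G.genesis from rfl,
      h1.eq_of_slot_le (hs.trans h2)]
    exact Anc.refl G h

theorem mem_of_anc_ghost {𝒱 : Set (Msg V B)} (hf : 𝒱.Finite) {t : ℝ≥0} {w : B → ℝ} {b : B}
    (h : G.Anc b (G.ghost 𝒱 t w)) :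
    b = G.genesis ∨ (Msg.block b ∈ 𝒱 ∧ G.slot b ≤ G.slotAt t) := by
  have key : ∀ n b, G.Anc b ((G.ghostStep 𝒱 t w)^[n] G.genesis) →
      b = G.genesis ∨ (Msg.block b ∈ 𝒱 ∧ G.slot b ≤ G.slotAt t) := by
    intro n
    induction n with
    | zero => exact fun b hb => Or.inl (Anc.eq_genesis hb)
    | succ n ih =>
      intro b hb
      rw [Function.iterate_succ_apply'] at hb
      rcases ghostStep_cases hf t w ((G.ghostStep 𝒱 t w)^[n] G.genesis) with h1 | ⟨⟨h1, _, h3⟩, h4⟩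
      · exact ih b (h1 ▸ hb)
      · rcases hb.eq_or_parent with h5 | ⟨_, h5⟩
        · subst h5; exact Or.inr ⟨h1, h4⟩
        · exact ih b (h3 ▸ h5)
  exact key _ b h

theorem block_mem_filLmdGhost {κ : ℕ → Finset V} {𝒱 : Set (Msg V B)} {t : ℝ≥0} {b : B} :
    Msg.block b ∈ G.filLmdGhost κ 𝒱 t ↔ Msg.block b ∈ 𝒱 := by
  simp [filLmdGhost, filLmd, filInv, filCur, filEq]

theorem block_mem_filHfc {𝒱 : Set (Msg V B)} {t : ℝ≥0} {b : B} :
    Msg.block b ∈ G.filHfc 𝒱 t ↔ Msg.block b ∈ 𝒱 ∧ G.NotFiltered 𝒱 t b := by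
  simp [filHfc]

theorem ghost_mem_filHfc {𝒱 : Set (Msg V B)} {t : ℝ≥0} {a : GhostVote V B} :
    Msg.ghost a ∈ G.filHfc 𝒱 t ↔ Msg.ghost a ∈ 𝒱 := by
  simp [filHfc]

theorem filLmdGhost_subset {κ : ℕ → Finset V} {𝒱 : Set (Msg V B)} {t : ℝ≥0} :
    G.filLmdGhost κ 𝒱 t ⊆ 𝒱 := fun _ h => h.1.1.1.1

theorem ghost_mem_filInv {κ : ℕ → Finset V} {𝒱 : Set (Msg V B)} {t : ℝ≥0} {a : GhostVote V B} :
    Msg.ghost a ∈ G.filInv κ (G.filCur (filEq 𝒱) t) ↔ Msg.ghost a ∈ 𝒱 ∧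
      (∀ a₁ a₂ : GhostVote V B, Msg.ghost a₁ ∈ 𝒱 → Msg.ghost a₂ ∈ 𝒱 → a₁.signer = a.signer →
        a₂.signer = a.signer → a₁.slot = a₂.slot → a₁.block = a₂.block) ∧
      a.slot < G.slotAt t ∧ a.signer ∈ κ a.slot ∧ G.slot a.block ≤ a.slot := by
  simp only [filInv, filCur, filEq, Set.mem_sdiff, Set.mem_ofPred_eq, Msg.ghost.injEq]
  constructor
  · rintro ⟨⟨⟨h1, h2⟩, h3⟩, h4⟩
    refine ⟨h1, fun a₁ a₂ m₁ m₂ s₁ s₂ h => ?_, ?_, ?_, ?_⟩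
    · by_contra hne
      exact h2 ⟨a, rfl, a₁, a₂, m₁, m₂, s₁, s₂, h, hne⟩
    · exact not_le.1 fun h => h3 ⟨a, rfl, h⟩
    · by_contra h; exact h4 ⟨a, rfl, Or.inl h⟩
    · exact not_lt.1 fun h => h4 ⟨a, rfl, Or.inr h⟩
  · rintro ⟨h1, h2, h3, h4, h5⟩
    refine ⟨⟨⟨h1, ?_⟩, ?_⟩, ?_⟩
    · rintro ⟨_, rfl, a₁, a₂, m₁, m₂, s₁, s₂, h, hne⟩
      exact hne (h2 a₁ a₂ m₁ m₂ s₁ s₂ h)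
    · rintro ⟨_, rfl, h⟩; omega
    · rintro ⟨_, rfl, h | h⟩
      · exact h h4
      · omega

theorem ghost_mem_filLmdGhost {κ : ℕ → Finset V} {𝒱 : Set (Msg V B)} {t : ℝ≥0}
    {a : GhostVote V B} : Msg.ghost a ∈ G.filLmdGhost κ 𝒱 t ↔
      Msg.ghost a ∈ G.filInv κ (G.filCur (filEq 𝒱) t) ∧
      ∀ a' : GhostVote V B, Msg.ghost a' ∈ G.filInv κ (G.filCur (filEq 𝒱) t) →
        a'.signer = a.signer → a'.slot ≤ a.slot := by
  simp only [filLmdGhost, filLmd, Set.mem_sdiff, Set.mem_ofPred_eq, Msg.ghost.injEq]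
  refine and_congr_right fun _ => ⟨fun h a' h1 h2 => ?_, ?_⟩
  · exact not_lt.1 fun h3 => h ⟨a, rfl, a', h1, h2, h3⟩
  · rintro h ⟨_, rfl, a', h1, h2, h3⟩
    exact absurd (h a' h1 h2) (not_le.2 h3)

namespace SystemModel

variable (hS : G.SystemModel)
include hS

theorem filtered_finite {v : V} (hv : v ∈ G.honest) (t : ℝ≥0) :
    (G.filLmdGhost (G.comm v t) (G.filHfc (G.view v t) t) t).Finite :=
  (hS.view_finite hv t).subset fun _ h => (filLmdGhost_subset h).1

/-- Every move of the walk is to a kept block; its starting point, genesis, is kept as an ancestor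
of the justified block. -/
theorem notFiltered_of_anc_canonical {v : V} (hv : v ∈ G.honest) {t : ℝ≥0} {b : B}
    (h : G.Anc b (G.canonical v t)) :
    Msg.block b ∈ G.view v t ∧ G.NotFiltered (G.view v t) t b := by
  rcases mem_of_anc_ghost (hS.filtered_finite hv t) h with rfl | ⟨h1, _⟩
  · exact ⟨hS.genesis_mem_view hv t, Or.inl (genesis_anc _)⟩
  · exact block_mem_filHfc.1 (block_mem_filLmdGhost.1 h1)

theorem mem_view_of_anc_canonical {v : V} (hv : v ∈ G.honest) {t : ℝ≥0} {b : B}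
    (h : G.Anc b (G.canonical v t)) : Msg.block b ∈ G.view v t :=
  (hS.notFiltered_of_anc_canonical hv h).1

theorem slot_canonical_le {u : V} (hu : u ∈ G.honest) (k : ℕ) :
    G.slot (G.canonical u (G.voteTime u k)) ≤ k := by
  have := (block_mem_view.1 (hS.mem_view_of_anc_canonical hu (Anc.refl G (G.canonical u
    (G.voteTime u k))))).2
  rwa [hS.slotAt_voteTime hu] at this

end SystemModel

/-- The block for which an honest validator votes in slot `k`. -/
noncomputable def votedBlock (G : Gasper V B) (u : V) (k : ℕ) : B :=
  G.canonical u (G.voteTime u k)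

/-- The validator `u`, if honest, votes in slot `k`, and the vote is valid for the
committees `κ`. -/
def VotedAt (G : Gasper V B) (κ : ℕ → Finset V) (u : V) (k : ℕ) : Prop :=
  u ∈ G.comm u (G.voteTime u k) k ∧ u ∈ κ k

/-- The honest validators whose latest valid vote before slot `s` supports `b`. -/
def honestSupport (G : Gasper V B) (κ : ℕ → Finset V) (b : B) (s : ℕ) : Set V :=
  {u | u ∈ G.honest ∧ ∃ k < s, G.VotedAt κ u k ∧ G.Anc b (G.votedBlock u k) ∧
    ∀ k', k < k' → k' < s → ¬ G.VotedAt κ u k'}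

/-- The committees on which honest validators agree from `GGST` on. -/
def Agreed (G : Gasper V B) (κ : ℕ → Finset V) : Prop :=
  ∀ v ∈ G.honest, ∀ t, G.GGST ≤ t → G.comm v t = κ

/-- The union of the committees from slot `s` to slot `s'`. -/
def committees (κ : ℕ → Finset V) (s s' : ℕ) : Set V := {u | ∃ k, s ≤ k ∧ k ≤ s' ∧ u ∈ κ k}

theorem Agreed.commRange_eq {κ : ℕ → Finset V} (hκ : G.Agreed κ) {v : V} (hv : v ∈ G.honest)
    {t : ℝ≥0} (ht : G.GGST ≤ t) (s s' : ℕ) : G.commRange v t s s' = committees κ s s' := by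
  rw [commRange, hκ v hv t ht, committees]

theorem SystemModel.agreed (hS : G.SystemModel) {v : V} (hv : v ∈ G.honest) :
    G.Agreed (G.comm v G.GGST) := fun v' hv' t ht =>
  funext fun s => hS.comm_agree v' hv' v hv t G.GGST ht le_rfl s

/-- A valid vote in a new slot becomes the latest one and supports `b` by assumption; without one,
the latest vote is unchanged. The disjunction also admits validators that start supporting `b` only
after slot `s`. -/
theorem honestSupport_step {κ : ℕ → Finset V} {b : B} {s s' : ℕ} {u : V} (hu : u ∈ G.honest)
    (h : u ∈ G.honestSupport κ b s ∨ ∃ k, s ≤ k ∧ k < s' ∧ G.VotedAt κ u k) (hs : s ≤ s')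
    (hv : ∀ k, s ≤ k → k < s' → G.VotedAt κ u k → G.Anc b (G.votedBlock u k)) :
    u ∈ G.honestSupport κ b s' := by
  induction s', hs using Nat.le_induction with
  | base => exact h.resolve_right fun ⟨k, h1, h2, _⟩ => by omega
  | succ n hn ih =>
    by_cases hvn : G.VotedAt κ u n
    · exact ⟨hu, n, n.lt_succ_self, hvn, hv n hn n.lt_succ_self hvn, fun k' h1 h2 => by omega⟩
    · obtain ⟨_, k, h1, h2, h3, h4⟩ := ih (h.imp_right fun ⟨k, h1, h2, h3⟩ =>
        ⟨k, h1, by have : k ≠ n := fun h => hvn (h ▸ h3); omega, h3⟩)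
        fun k h1 h2 => hv k h1 (by omega)
      refine ⟨hu, k, by omega, h2, h3, fun k' h5 h6 h7 => ?_⟩
      have : k' ≠ n := fun h => hvn (h ▸ h7)
      exact h4 k' h5 (by omega) h7

variable {κ : ℕ → Finset V}

/-- Honest validators agree on the support that other honest validators give to a block. -/
theorem SystemModel.mem_ghostSupporters_iff (hS : G.SystemModel) (hκ : G.Agreed κ) {u v : V}
    (hu : u ∈ G.honest) (hv : v ∈ G.honest) {t : ℝ≥0} (ht : G.GGST ≤ t) {𝒱 : Set (Msg V B)}
    (h𝒱 : ∀ a, Msg.ghost a ∈ 𝒱 ↔ Msg.ghost a ∈ G.received v t) (b : B) :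
    u ∈ G.ghostSupporters b (G.filLmdGhost (G.comm v t) 𝒱 t) ↔
      u ∈ G.honestSupport κ b (G.slotAt t) := by
  have hvote : ∀ a : GhostVote V B, Msg.ghost a ∈ 𝒱 → a.signer = u →
      u ∈ G.comm u (G.voteTime u a.slot) a.slot ∧ a.block = G.votedBlock u a.slot := by
    rintro ⟨_, k, c⟩ ha rfl
    have := (hS.honest_ghost _ hu t k c).1 (hS.received_subset_sent v hv t ((h𝒱 _).1 ha))
    exact ⟨this.1, this.2.2⟩
  -- An honest validator has a single GHOST vote per slot, for a block not later than that slot.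
  -- Only the conditions that the slot is past and that the committee is right can fail, and
  -- delivery puts the remaining votes in the view.
  have hmem : ∀ k, Msg.ghost ⟨u, k, G.votedBlock u k⟩ ∈
      G.filInv (G.comm v t) (G.filCur (filEq 𝒱) t) ↔ k < G.slotAt t ∧ G.VotedAt κ u k := by
    intro k
    rw [ghost_mem_filInv, hκ v hv t ht]
    constructor
    · rintro ⟨h1, _, h3, h4, _⟩
      exact ⟨h3, (hvote _ h1 rfl).1, h4⟩
    · rintro ⟨h1, h2, h3⟩
      refine ⟨(h𝒱 _).2 (hS.ghost_delivered hu hv h1 ht h2), ?_, h1, h3, hS.slot_canonical_le hu k⟩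
      intro a₁ a₂ m₁ m₂ s₁ s₂ h
      rw [(hvote a₁ m₁ s₁).2, (hvote a₂ m₂ s₂).2, h]
  have hform : ∀ a : GhostVote V B, Msg.ghost a ∈ G.filInv (G.comm v t) (G.filCur (filEq 𝒱) t) →
      a.signer = u → a = ⟨u, a.slot, G.votedBlock u a.slot⟩ := by
    rintro ⟨_, k, c⟩ ha rfl
    rw [← (hvote _ (ghost_mem_filInv.1 ha).1 rfl).2]
  constructor
  · rintro ⟨a, ha, hau, hb⟩
    obtain ⟨h1, h2⟩ := ghost_mem_filLmdGhost.1 ha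
    have h3 := hform a h1 hau
    obtain ⟨h4, h5⟩ := (hmem a.slot).1 (h3 ▸ h1)
    refine ⟨hu, a.slot, h4, h5, (hvote a (filLmdGhost_subset ha) hau).2 ▸ hb, fun k' h6 h7 h8 => ?_⟩
    exact absurd (h2 _ ((hmem k').2 ⟨h7, h8⟩) hau.symm) (not_le.2 h6)
  · rintro ⟨_, k, h1, h2, h3, h4⟩
    refine ⟨⟨u, k, G.votedBlock u k⟩, ghost_mem_filLmdGhost.2 ⟨(hmem k).2 ⟨h1, h2⟩, ?_⟩, rfl, h3⟩
    intro a' h5 h6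
    have h7 := hform a' h5 h6
    obtain ⟨h8, h9⟩ := (hmem a'.slot).1 (h7 ▸ h5)
    exact not_lt.1 fun h => h4 _ h h8 h9

/-- Only members of the committees since the parent of `b` can support `b`. -/
theorem ghostSupporters_subset (hκ : G.Agreed κ) {v : V} (hv : v ∈ G.honest) {t : ℝ≥0}
    (ht : G.GGST ≤ t) {𝒱 : Set (Msg V B)} {b : B} (hb : b ≠ G.genesis) :
    G.ghostSupporters b (G.filLmdGhost (G.comm v t) 𝒱 t) ⊆
      committees κ (G.slot (G.parent b) + 1) (G.slotAt t - 1) := by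
  rintro _ ⟨a, ha, rfl, hba⟩
  obtain ⟨_, _, h3, h4, h5⟩ := ghost_mem_filInv.1 (ghost_mem_filLmdGhost.1 ha).1
  rw [hκ v hv t ht] at h4
  have h6 := hba.slot_le
  have h7 := G.slot_parent_lt b hb
  exact ⟨a.slot, by omega, by omega, h4⟩

/-- An honest validator does not support two siblings. -/
theorem disjoint_honestSupport {b c : B} (hb : b ≠ G.genesis) (hc : c ≠ G.genesis)
    (hp : G.parent b = G.parent c) (hne : b ≠ c) (s : ℕ) :
    Disjoint (G.honestSupport κ b s) (G.honestSupport κ c s) := by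
  rw [Set.disjoint_left]
  rintro u ⟨_, k, h1, h2, h3, h4⟩ ⟨_, k', h1', h2', h3', h4'⟩
  have : k = k' := by
    rcases lt_trichotomy k k' with h | h | h
    · exact absurd h2' (h4 k' h h1')
    · exact h
    · exact absurd h2 (h4' k h h1)
  subst this
  exact not_anc_of_siblings hb hc hp hne h3 h3'

end ForkChoice

end Gasper

/-- The largest factor by which balance changes alter the ratio of two weights. -/
noncomputable def Constants.rateRatio (K : Constants) : ℝ :=
  (1 + K.rewardRate) / (1 - K.penaltyRate)

/-- The fraction of the weight of a checkpoint for which votes ensure justification whatever the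
balance changes of one epoch are. -/
noncomputable def Constants.ffgRatio (K : Constants) : ℝ :=
  2 / 3 * ((1 + K.rewardRate - K.exitRate * K.rewardRate) / (1 - K.penaltyRate)) + K.exitRate

namespace Gasper

variable {V B : Type*} {G : Gasper V B} {K : Constants} {κ : ℕ → Finset V}

/-! ### Consequences of the bounds on the rates -/

section Rates

namespace ChangeProperties

variable (hC : G.ChangeProperties K)
include hC

theorem one_sub_penalty_pos : 0 < 1 - K.penaltyRate := by linarith [hC.penalty_mem.2]

theorem rateRatio_mul : K.rateRatio * (1 - K.penaltyRate) = 1 + K.rewardRate :=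
  div_mul_cancel₀ _ hC.one_sub_penalty_pos.ne'

theorem one_le_rateRatio : 1 ≤ K.rateRatio := by
  rw [Constants.rateRatio, le_div_iff₀ hC.one_sub_penalty_pos]
  linarith [hC.reward_mem.1, hC.penalty_mem.1]

theorem two_thirds_le_ffgRatio : 2 / 3 ≤ K.ffgRatio := by
  have h1 : 1 ≤ (1 + K.rewardRate - K.exitRate * K.rewardRate) / (1 - K.penaltyRate) := by
    rw [le_div_iff₀ hC.one_sub_penalty_pos]
    nlinarith [mul_nonneg hC.reward_mem.1 (sub_nonneg.2 hC.exit_mem.2.le), hC.penalty_mem.1]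
  unfold Constants.ffgRatio
  linarith [hC.exit_mem.1]

/-- The rates are small, because the bound on the proposer boost is positive. -/
theorem rateRatio_lt (hβ0 : 0 ≤ K.β) (hβ : K.β < 1 / 6) : K.rateRatio < 4 / 3 := by
  obtain ⟨hx0, hx1⟩ := hC.exit_mem
  obtain ⟨hr0, _⟩ := hC.reward_mem
  obtain ⟨hq0, hq1⟩ := hC.penalty_mem
  obtain ⟨hσ0, hσ1⟩ := hC.slash_mem
  have hboost := hC.boost_lt hβ
  have hE : (0 : ℝ) ≤ G.boostScore / G.slotsPerEpoch :=
    div_nonneg G.boostScore_nonneg (Nat.cast_nonneg _)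
  have hpos := pos_of_mul_pos_right (hE.trans_lt hboost) (by
    have := sub_pos.2 hq1; have := sub_pos.2 hx1; positivity)
  set x := K.exitRate
  set r := K.rewardRate
  set q := K.penaltyRate
  set σ := K.slashRate
  have hd : 0 < 1 - q := by linarith
  have hd' : 0 < 1 - x := by linarith
  have hd'' : 0 < 1 - σ := by linarith
  have hc0 : 0 ≤ (1 - x) * (1 - q) / (1 + r) := by positivity
  have hc1 : (1 - x) * (1 - q) / (1 + r) ≤ 1 := by
    rw [div_le_one (by linarith)]; nlinarith
  -- The positive bracket is bounded term by term: the FFG term is at most `2 / 3`, and the terms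
  -- with `x` and `β` add up to at most `0`. What is left is `2 / 3 - rateRatio / 2 > 0`.
  have h1 : (1 - x) * (1 - q) / (1 + r) * (2 / 3 * ((1 + r - x * r) / (1 - q))) ≤ 2 / 3 := by
    have : (1 - x) * (1 - q) / (1 + r) * (2 / 3 * ((1 + r - x * r) / (1 - q))) =
        2 / 3 * ((1 - x) * (1 + r - x * r) / (1 + r)) := by field_simp
    rw [this]
    have : (1 - x) * (1 + r - x * r) / (1 + r) ≤ 1 := by
      rw [div_le_one (by linarith)]
      nlinarith [mul_nonneg hx0 hr0, mul_nonneg hx0 (mul_nonneg hd'.le hr0)]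
    linarith
  have h2 : x ≤ x / ((1 - x) * (1 - σ)) := by
    rw [le_div_iff₀ (by positivity)]
    have : (1 - x) * (1 - σ) ≤ 1 := by nlinarith
    nlinarith
  have h3 : 0 ≤ x / (1 - x) := by positivity
  have h4 : (1 - x) * (1 - q) / (1 + r) * (x + K.β - x / ((1 - x) * (1 - σ))) ≤ K.β := by
    nlinarith [mul_le_mul_of_nonneg_left
      (by linarith : x + K.β - x / ((1 - x) * (1 - σ)) ≤ K.β) hc0]
  have h5 : (1 + r) / (2 * (1 - q)) = K.rateRatio / 2 := by
    rw [Constants.rateRatio, div_div, mul_comm]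
  rw [h5] at hpos
  have h6 : (1 - x) * (1 - q) / (1 + r) * (2 / 3 * ((1 + r - x * r) / (1 - q)) + x + K.β -
      x / ((1 - x) * (1 - σ))) = (1 - x) * (1 - q) / (1 + r) * (2 / 3 * ((1 + r - x * r) / (1 - q)))
      + (1 - x) * (1 - q) / (1 + r) * (x + K.β - x / ((1 - x) * (1 - σ))) := by ring
  rw [h6] at hpos
  linarith

end ChangeProperties

theorem boostWeight_nonneg (C : Chk B) : 0 ≤ G.boostWeight C :=
  mul_nonneg (div_nonneg G.boostScore_nonneg (Nat.cast_nonneg _)) (weight_nonneg _ _)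

/-- This explains the factor `1 + x + r` of the safety condition: rewards scale the total weight by
at most `1 + r`, and entries add at most `x` times the old total. -/
theorem boostWeight_le_of_change {C C' : Chk B} {D : Set V}
    (h : ChangeWithin K (G.ebaC C) (G.ebaC C') D) (hr : 0 ≤ K.rewardRate) :
    G.boostWeight C' ≤ G.boostWeight C * (1 + K.exitRate + K.rewardRate) := by
  have h1 : totalWeight (G.ebaC C') ≤ totalWeight (G.ebaC C) * (1 + K.exitRate + K.rewardRate) := by
    have := h.weight_le hr Set.univ
    unfold totalWeight at *
    linarith
  rw [boostWeight, boostWeight, mul_assoc]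
  exact mul_le_mul_of_nonneg_left h1 (div_nonneg G.boostScore_nonneg (Nat.cast_nonneg _))

end Rates

/-- Multiply the hypothesis by `d * (1 + ρ)` and compare coefficients. New weight needs `ρ ≤ (1 + ρ)
* (1 - β)`, which follows from `ρ < 4 / 3` and `β < 1 / 6`; old weight and the boost need `1 ≤ ρ`
and `1 ≤ d * ρ`. -/
theorem majority_of_ratio {β x r d ρ w w' p' Wp T : ℝ} (hβ0 : 0 ≤ β) (hβ : β < 1 / 6)
    (hr : 0 ≤ r) (hd : 0 < d) (hρd : ρ * d = 1 + r) (hρ1 : 1 ≤ ρ) (hρ2 : ρ < 4 / 3) (hw : 0 ≤ w)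
    (hww : w ≤ w') (hxT : 0 ≤ x * T) (hWp : 0 ≤ Wp)
    (h : (1 - β) * (w' - w) + ρ / 2 * (w + Wp) + x * T < p') :
    (w' - p') * (1 + r) + T * x + Wp < (p' - T * x) * d := by
  have h11 : ρ * (w' - w) ≤ (1 + ρ) * ((1 - β) * (w' - w)) := by
    have : ρ ≤ (1 + ρ) * (1 - β) := by nlinarith
    nlinarith
  have h12 : ρ * w ≤ (1 + ρ) * (ρ / 2 * w) := by
    nlinarith [mul_nonneg (mul_nonneg (sub_nonneg.2 hρ1) (by linarith : 0 ≤ ρ)) hw]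
  have hdρ : 1 ≤ d * ρ := by linarith
  have h13 : Wp ≤ d * ((1 + ρ) * (ρ / 2 * Wp)) := by
    have : 1 ≤ d * ρ * ((1 + ρ) / 2) := one_le_mul_of_one_le_of_one_le hdρ (by linarith)
    calc Wp ≤ (d * ρ * ((1 + ρ) / 2)) * Wp := le_mul_of_one_le_left hWp this
      _ = _ := by ring
  have h14 : x * T * (1 + d) ≤ d * ((1 + ρ) * (x * T)) := by
    nlinarith [mul_le_mul_of_nonneg_right hdρ hxT]
  have h15 := mul_lt_mul_of_pos_left h (mul_pos hd (by linarith : 0 < 1 + ρ))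
  have h16 := mul_le_mul_of_nonneg_left (add_le_add h11 h12) hd.le
  rw [← hρd]
  linarith

/-! ### Robust LMD-GHOST support and its persistence -/

section Robust

/-- The honest support of the chain of `h` before slot `s` is a majority that withstands balance
changes of one epoch. -/
def RobustSupport (G : Gasper V B) (K : Constants) (κ : ℕ → Finset V) (h : B) (C : Chk B)
    (s : ℕ) : Prop :=
  ∀ b, G.Anc b h → b ≠ G.genesis →
    K.rateRatio / 2 * (weight (G.ebaC C) (committees κ (G.slot (G.parent b) + 1) (s - 1)) +
        G.boostWeight C * (1 + K.exitRate + K.rewardRate)) +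
      K.exitRate * totalWeight (G.ebaC C) +
      K.β * weight (G.ebaC C) (committees κ (G.slot (G.parent b) + 1) (s - 1)) <
    weight (G.ebaC C)
      (G.honestSupport κ b s ∩ committees κ (G.slot (G.parent b) + 1) (s - 1)) +
    weight (G.ebaC C) (committees κ (G.slot (G.parent b) + 1) (s - 1) \ G.honest)

namespace Assumptions

variable (hA : G.Assumptions K) (hκ : G.Agreed κ)
include hA hκ

/-- Supporters seen by `v` are either honest, and then all honest validators count them alike, or
Byzantine. The latter are replaced by all Byzantine members of the committees, which makes the
condition independent of `v`. -/
theorem robust_of_safe {v : V} (hv : v ∈ G.honest) {h : B} {C : Chk B} {s : ℕ}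
    (hs : G.GGST ≤ G.slotStart s) (hsafe : G.isLMDGHOSTSafeFull K v h C (G.slotStart s)) :
    G.RobustSupport K κ h C s := by
  intro b hb hg
  have hlt := (hsafe b hb).resolve_right hg
  have hr := hA.change.reward_mem.1
  have hβ := hA.beta.nonneg
  rw [slotAt_slotStart, indicatorQ, support, commFrom, hκ.commRange_eq hv hs] at hlt
  set W := committees κ (G.slot (G.parent b) + 1) (s - 1)
  set S := G.ghostSupporters b
    (G.filLmdGhost (G.comm v (G.slotStart s)) (G.view v (G.slotStart s)) (G.slotStart s)) ∩ W
  have hρ : (1 + K.rewardRate) / (2 * (1 - K.penaltyRate)) = K.rateRatio / 2 := by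
    rw [Constants.rateRatio, div_div, mul_comm 2]
  rw [hρ] at hlt
  have hρ1 := hA.change.one_le_rateRatio
  -- Division by zero yields `0`, so for committees of weight zero the safety condition would say
  -- that a positive number is less than `0`.
  rcases (weight_nonneg (G.ebaC C) W).eq_or_lt with hw | hw
  · rw [← hw] at hlt
    simp only [div_zero] at hlt
    linarith
  · have h1 : weight (G.ebaC C) S ≤ weight (G.ebaC C) (G.honestSupport κ b s ∩ W) +
        weight (G.ebaC C) (W \ G.honest) := by
      rw [← weight_inter_add_diff _ S G.honest]
      refine add_le_add (weight_mono _ ?_) (weight_mono _ fun u hu => ⟨hu.1.2, hu.2⟩)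
      rintro u ⟨⟨hu, hW⟩, hh⟩
      have := (hA.system.mem_ghostSupporters_iff hκ hh hv hs (fun a => ghost_mem_view) b).1 hu
      rw [slotAt_slotStart] at this
      exact ⟨this, hW⟩
    refine lt_of_lt_of_le ?_ h1
    rw [lt_div_iff₀ hw] at hlt
    refine lt_of_eq_of_lt ?_ hlt
    field_simp

theorem byzantine_weight_le {v : V} (hv : v ∈ G.honest) {b : B} {C : Chk B}
    (hC : C ∈ G.unrealized b) (s s' : ℕ) :
    weight (G.ebaC C) (committees κ s s' \ G.honest) ≤
      K.β * weight (G.ebaC C) (committees κ s s') := by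
  have h := hA.beta.justified v hv G.GGST le_rfl s s' b C hC
  rw [hκ.commRange_eq hv le_rfl] at h
  have := weight_inter_add_diff (G.ebaC C) (committees κ s s') G.honest
  linarith

/-- The term with `β` in the robustness condition already covers the Byzantine weight on the other
side, so the honest weight is positive. -/
theorem exists_supporter {v : V} (hv : v ∈ G.honest) {h b b₀ : B} {C : Chk B} {s : ℕ}
    (hR : G.RobustSupport K κ h C s) (hC : C ∈ G.unrealized b₀) (hb : G.Anc b h)
    (hg : b ≠ G.genesis) :
    (G.honestSupport κ b s ∩ committees κ (G.slot (G.parent b) + 1) (s - 1)).Nonempty := by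
  refine nonempty_of_weight_pos (bal := G.ebaC C) ?_
  have h1 := hR b hb hg
  have h2 := hA.byzantine_weight_le hκ hv hC (G.slot (G.parent b) + 1) (s - 1)
  have h3 := hA.change.one_le_rateRatio
  have h4 : 0 ≤ K.rateRatio / 2 *
      (weight (G.ebaC C) (committees κ (G.slot (G.parent b) + 1) (s - 1)) +
        G.boostWeight C * (1 + K.exitRate + K.rewardRate)) :=
    mul_nonneg (by linarith) (add_nonneg (weight_nonneg _ _) (mul_nonneg (boostWeight_nonneg C)
      (by linarith [hA.change.exit_mem.1, hA.change.reward_mem.1])))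
  have h5 : 0 ≤ K.exitRate * totalWeight (G.ebaC C) :=
    mul_nonneg hA.change.exit_mem.1 (weight_nonneg _ _)
  linarith

/-- A robustly supported block has been voted for by an honest validator, after its slot. -/
theorem exists_voter {v : V} (hv : v ∈ G.honest) {h b₀ : B} {C : Chk B} {s : ℕ}
    (hR : G.RobustSupport K κ h C s) (hC : C ∈ G.unrealized b₀) (hg : h ≠ G.genesis) :
    ∃ u ∈ G.honest, ∃ k < s, G.slot h ≤ k ∧ G.Anc h (G.votedBlock u k) := by
  obtain ⟨u, ⟨hu, k, hk, _, hvb, _⟩, _⟩ := hA.exists_supporter hκ hv hR hC (Anc.refl G h) hg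
  exact ⟨u, hu, k, hk, hvb.slot_le.trans (hA.system.slot_canonical_le hu k), hvb⟩

/-- An honest supporter had `h`, and with it all its ancestors, in view when it voted before slot
`s`, and gossip does the rest. -/
theorem mem_view_of_robust {v : V} (hv : v ∈ G.honest) {h b b₀ : B} {C : Chk B} {s : ℕ}
    (hR : G.RobustSupport K κ h C s) (hC : C ∈ G.unrealized b₀) (hb : G.Anc b h) {t : ℝ≥0}
    (ht : G.GGST ≤ t) (hs : s ≤ G.slotAt t) : Msg.block b ∈ G.view v t := by
  by_cases hg : h = G.genesis
  · subst hg
    rw [hb.eq_genesis]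
    exact hA.system.genesis_mem_view hv t
  · obtain ⟨u, hu, k, hk, _, hvb⟩ := hA.exists_voter hκ hv hR hC hg
    exact hA.system.block_mem_view_of_voteTime hu hv (hk.trans_le hs) ht
      (hA.system.mem_view_of_anc_canonical hu (hb.trans hvb))

/-- Robust support remains a majority, also with respect to the next checkpoint, as long as honest
validators vote for the block. -/
theorem majority {v : V} (hv : v ∈ G.honest) {h b b₀ : B} {C C' : Chk B} {D : Set V} {s s' : ℕ}
    (hR : G.RobustSupport K κ h C s) (hC : C ∈ G.unrealized b₀) (hb : G.Anc b h)
    (hg : b ≠ G.genesis) (hs : s ≤ s') (hch : ChangeWithin K (G.ebaC C) (G.ebaC C') D)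
    (hD : Disjoint G.honest D) :
    weight (G.ebaC C') (committees κ (G.slot (G.parent b) + 1) (s' - 1) \
        ((G.honestSupport κ b s ∩ committees κ (G.slot (G.parent b) + 1) (s - 1)) ∪
          (committees κ s (s' - 1) ∩ G.honest))) + G.boostWeight C' <
      weight (G.ebaC C')
        ((G.honestSupport κ b s ∩ committees κ (G.slot (G.parent b) + 1) (s - 1)) ∪
          (committees κ s (s' - 1) ∩ G.honest)) := by
  have hx := hA.change.exit_mem.1
  have hr := hA.change.reward_mem.1
  have hd := hA.change.one_sub_penalty_pos
  have hρd := hA.change.rateRatio_mul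
  have hρ1 := hA.change.one_le_rateRatio
  have hβ := hA.beta.nonneg
  have hρ2 := hA.change.rateRatio_lt hβ hA.beta_lt
  have hT : 0 ≤ totalWeight (G.ebaC C) := weight_nonneg _ _
  have hineq := hR b hb hg
  -- The supporter serves only to show that `s` is positive and that the range of committees before
  -- `s` is not empty; the inclusions below need this because of the truncated `s - 1`.
  obtain ⟨u₀, ⟨_, k₀, hk₀, _⟩, k₁, hk₁, hk₁', _⟩ := hA.exists_supporter hκ hv hR hC hb hg
  have hbyz := hA.byzantine_weight_le hκ hv hC (G.slot (G.parent b) + 1) (s' - 1)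
  set a := G.slot (G.parent b) + 1
  set bal := G.ebaC C
  set W := committees κ a (s - 1)
  set W' := committees κ a (s' - 1)
  set P := G.honestSupport κ b s ∩ W
  set N := committees κ s (s' - 1)
  set P' := P ∪ (N ∩ G.honest)
  have hPh : P ⊆ G.honest := fun u hu => hu.1.1
  have hP'h : P' ⊆ G.honest := Set.union_subset hPh Set.inter_subset_right
  have hP'W : P' ⊆ W' := by
    rintro u (⟨_, k, h1, h2, h3⟩ | ⟨⟨k, h1, h2, h3⟩, _⟩)
    · exact ⟨k, h1, by omega, h3⟩
    · exact ⟨k, by omega, h2, h3⟩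
  have hWW : W ⊆ W' := fun u ⟨k, h1, h2, h3⟩ => ⟨k, h1, by omega, h3⟩
  -- Committees of different epochs overlap, so `W' \ W` need not be the members of a range of
  -- slots. The `β`-bound is therefore used for the whole of `W'`, and only honest members of `W`
  -- outside `P` are written off.
  have h1 : weight bal (W' ∩ G.honest) ≤ weight bal P' + weight bal ((W ∩ G.honest) \ P) := by
    refine (weight_mono _ ?_).trans (weight_union_le _ _ _)
    rintro u ⟨⟨k, h1, h2, h3⟩, hu⟩
    by_cases hk : s ≤ k
    · exact Or.inl (Or.inr ⟨⟨k, hk, h2, h3⟩, hu⟩)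
    · by_cases huP : u ∈ P
      · exact Or.inl (Or.inl huP)
      · exact Or.inr ⟨⟨⟨k, h1, by omega, h3⟩, hu⟩, huP⟩
  have h2 := weight_inter_add_diff bal (W ∩ G.honest) P
  rw [Set.inter_eq_right.2 (Set.subset_inter Set.inter_subset_right hPh)] at h2
  have h3 := weight_inter_add_diff bal W G.honest
  have h4 := weight_inter_add_diff bal W' G.honest
  have h5 := weight_inter_add_diff bal W' P'
  rw [Set.inter_eq_right.2 hP'W] at h5
  have h6 := weight_mono bal hWW
  have h7 := hch.weight_ge (hD.mono_left hP'h) (by linarith)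
  have h8 := hch.weight_le hr (W' \ P')
  have h9 := boostWeight_le_of_change hch hr
  have hWp : 0 ≤ G.boostWeight C * (1 + K.exitRate + K.rewardRate) :=
    mul_nonneg (boostWeight_nonneg C) (by linarith)
  have hw0 : 0 ≤ weight bal W := weight_nonneg _ _
  set Wp := G.boostWeight C * (1 + K.exitRate + K.rewardRate)
  set T := totalWeight bal
  set d := 1 - K.penaltyRate
  set ρ := K.rateRatio
  have hxT : 0 ≤ K.exitRate * T := mul_nonneg hx hT
  -- The Byzantine weight of `W`, kept exact in `RobustSupport`, cancels here. Bounding it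
  -- separately would lose another multiple of `β`.
  have h10 : (1 - K.β) * (weight bal W' - weight bal W) + ρ / 2 * (weight bal W + Wp) +
      K.exitRate * T < weight bal P' := by linarith
  have h11 := majority_of_ratio hβ hA.beta_lt hr hd hρd hρ1 hρ2 hw0 h6 hxT hWp h10
  have h12 : weight bal (W' \ P') = weight bal W' - weight bal P' := by linarith
  rw [h12] at h8
  linarith

/-- A robustly supported block remains canonical, if it is not filtered out. -/
theorem anc_canonical_of_robust {v : V} (hv : v ∈ G.honest) {t : ℝ≥0} {h a b₀ : B} {C : Chk B}
    {s : ℕ} (hR : G.RobustSupport K κ h C s) (hC : C ∈ G.unrealized b₀)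
    (hs : G.GGST ≤ G.slotStart s) (hst : s ≤ G.slotAt t)
    (hvote : ∀ u ∈ G.honest, ∀ k, s ≤ k → k < G.slotAt t → G.Anc h (G.votedBlock u k))
    (hle : G.ChkLe C (G.gj v t)) (hep : (G.gj v t).epoch ≤ C.epoch + 1)
    (hblk : G.Anc (G.gj v t).block h) (ha : Msg.block a ∈ G.view v t) (hha : G.Anc h a)
    (hleaf : ∀ l, G.Anc a l → G.ChkLeBlock (G.gj v t) l)
    (hVS : G.epochAt t ≤ (G.VS a (G.epochAt t)).epoch + 2) : G.Anc h (G.canonical v t) := by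
  have hS := hA.system
  have ht : G.GGST ≤ t := hs.trans (le_slotAt_iff.1 hst)
  have hview : ∀ b, G.Anc b h → Msg.block b ∈ G.view v t := fun b hb =>
    hA.mem_view_of_robust hκ hv hR hC hb ht hst
  obtain ⟨bj, hbj⟩ := hA.gj_mem hv t
  have hch : ChangeWithin K (G.ebaC C) (G.ebaC (G.gj v t)) (G.slashed (G.gj v t).block) :=
    hA.change.change_chk _ _ (hA.gasper.isChk_of_mem hC) (hA.gasper.isChk_of_mem hbj) hle hep
  have hD : Disjoint G.honest (G.slashed (G.gj v t).block) :=
    Set.disjoint_left.2 fun u hu ⟨c, _, hc⟩ => hS.honest_not_slashed u hu c hc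
  -- Blocks beyond the justified one are kept because of any leaf above `a`: it descends from the
  -- justified, hence from the finalized checkpoint, and its voting source is no older than that of
  -- `a`.
  have hNF : ∀ b, G.Anc b h → G.NotFiltered (G.view v t) t b := by
    intro b hb
    rcases hb.comparable hblk with h1 | h1
    · exact Or.inl h1
    · obtain ⟨l, hl, hal, hch⟩ := exists_leaf (G := G) (hS.view_finite hv t) ha
      have hle := epochB_le_of_mem_view hl
      refine Or.inr ⟨h1, l, hl, (hb.trans hha).trans hal, ?_, hle, hch, Or.inr ?_⟩
      · exact (hA.gasper.finalized_le_justified v hv t).chkLeBlock (hleaf l hal)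
      · exact hVS.trans (Nat.add_le_add_right (hA.gasper.epoch_VS_mono hal hle) 2)
  have hiff : ∀ {u}, u ∈ G.honest → ∀ b, u ∈ G.ghostSupporters b
      (G.filLmdGhost (G.comm v t) (G.filHfc (G.view v t) t) t) ↔
        u ∈ G.honestSupport κ b (G.slotAt t) := fun hu b =>
    hS.mem_ghostSupporters_iff hκ hu hv ht (fun a => ghost_mem_filHfc.trans ghost_mem_view) b
  refine anc_ghost (hS.filtered_finite hv t) (block_mem_view.1 (hview h (Anc.refl G h))).2 ?_
  intro b hb hg
  refine ⟨block_mem_filLmdGhost.2 (block_mem_filHfc.2 ⟨hview b hb, hNF b hb⟩), ?_⟩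
  rintro c ⟨_, hcg, hcp⟩ hcb
  have hmaj := hA.majority hκ hv hR hC hb hg hst hch hD
  set P' := (G.honestSupport κ b s ∩ committees κ (G.slot (G.parent b) + 1) (s - 1)) ∪
          (committees κ s (G.slotAt t - 1) ∩ G.honest)
  have hP' : P' ⊆ G.honestSupport κ b (G.slotAt t) := by
    rintro u (⟨h1, _⟩ | ⟨⟨k, h1, h2, h3⟩, hu⟩)
    · exact honestSupport_step h1.1 (Or.inl h1) hst
        fun k h2 h3 _ => hb.trans (hvote u h1.1 k h2 h3)
    · obtain ⟨u₀, ⟨_, k₀, hk₀, _⟩, _⟩ := hA.exists_supporter hκ hv hR hC hb hg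
      refine honestSupport_step hu (Or.inr ⟨k, h1, by omega, ?_, h3⟩) hst
        fun k h2 h3 _ => hb.trans (hvote u hu k h2 h3)
      rw [hκ u hu _ ((hs.trans (G.slotStart_strictMono.monotone h1)).trans
        (hS.voteTime_mem u hu k).1)]
      exact h3
  have hsub : weight (G.ebaC (G.gjView (G.view v t) t)) P' ≤
      weight (G.ebaC (G.gjView (G.view v t) t)) (G.ghostSupporters b
        (G.filLmdGhost (G.comm v t) (G.filHfc (G.view v t) t) t)) :=
    weight_mono _ fun u hu => (hiff (hP' hu).1 b).2 (hP' hu)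
  have hsub' : weight (G.ebaC (G.gjView (G.view v t) t)) (G.ghostSupporters c
        (G.filLmdGhost (G.comm v t) (G.filHfc (G.view v t) t) t)) ≤
      weight (G.ebaC (G.gjView (G.view v t) t))
        (committees κ (G.slot (G.parent b) + 1) (G.slotAt t - 1) \ P') := by
    refine weight_mono _ fun u hu => ⟨hcp ▸ ghostSupporters_subset hκ hv ht hcg hu, fun huP => ?_⟩
    exact Set.disjoint_left.1 (disjoint_honestSupport hg hcg hcp.symm (Ne.symm hcb) _) (hP' huP)
      ((hiff (hP' huP).1 c).1 hu)
  have hpos := boostWeight_nonneg (G := G) (G.gjView (G.view v t) t)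
  have hmaj' : weight (G.ebaC (G.gjView (G.view v t) t))
      (committees κ (G.slot (G.parent b) + 1) (G.slotAt t - 1) \ P') +
        G.boostWeight (G.gjView (G.view v t) t) <
      weight (G.ebaC (G.gjView (G.view v t) t)) P' := hmaj
  -- The majority leaves room for the boost, so `b` wins even if the boost goes to its sibling
  -- alone.
  split_ifs <;> linarith

/-- Blocks with robust support lie on one chain. -/
theorem comparable_of_robust {v : V} (hv : v ∈ G.honest) {h₁ h₂ b₁ b₂ : B} {C₁ C₂ : Chk B}
    {s : ℕ} (hR₁ : G.RobustSupport K κ h₁ C₁ s) (hC₁ : C₁ ∈ G.unrealized b₁)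
    (hR₂ : G.RobustSupport K κ h₂ C₂ s) (hC₂ : C₂ ∈ G.unrealized b₂)
    (hle : G.ChkLe C₁ C₂) (hep : C₂.epoch ≤ C₁.epoch + 1) : G.Anc h₁ h₂ ∨ G.Anc h₂ h₁ := by
  by_contra hcon
  obtain ⟨a, b, ha, hb, hag, hbg, hp, hne⟩ := exists_siblings (fun h => hcon (Or.inl h))
    fun h => hcon (Or.inr h)
  have hD : Disjoint G.honest (G.slashed C₂.block) :=
    Set.disjoint_left.2 fun u hu ⟨c, _, hc⟩ => hA.system.honest_not_slashed u hu c hc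
  have hi₁ := hA.gasper.isChk_of_mem hC₁
  have hi₂ := hA.gasper.isChk_of_mem hC₂
  -- Both supports are measured with `C₂` at slot `s`, without later votes. The siblings share their
  -- parent, hence the range of committees, in which two disjoint sets cannot both be majorities.
  have m₁ := hA.majority hκ hv hR₁ hC₁ ha hag le_rfl (hA.change.change_chk _ _ hi₁ hi₂ hle hep) hD
  have m₂ := hA.majority hκ hv hR₂ hC₂ hb hbg le_rfl
    (hA.change.change_chk _ _ hi₂ hi₂ (chkLe_refl _) (Nat.le_succ _)) hD
  obtain ⟨_, ⟨_, k₀, hk₀, _⟩, _⟩ := hA.exists_supporter hκ hv hR₁ hC₁ ha hag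
  have hN : committees κ s (s - 1) = ∅ :=
    Set.eq_empty_of_forall_notMem fun u ⟨k, h1, h2, _⟩ => by omega
  rw [hN, Set.empty_inter, Set.union_empty] at m₁ m₂
  rw [hp] at m₁
  have hpos := boostWeight_nonneg (G := G) C₂
  have hdis := disjoint_honestSupport (κ := κ) hag hbg hp hne s
  set W := committees κ (G.slot (G.parent b) + 1) (s - 1)
  have h1 : weight (G.ebaC C₂) (G.honestSupport κ b s ∩ W) ≤
      weight (G.ebaC C₂) (W \ (G.honestSupport κ a s ∩ W)) :=
    weight_mono _ fun u hu => ⟨hu.2, fun h => Set.disjoint_left.1 hdis h.1 hu.1⟩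
  have h2 : weight (G.ebaC C₂) (G.honestSupport κ a s ∩ W) ≤
      weight (G.ebaC C₂) (W \ (G.honestSupport κ b s ∩ W)) :=
    weight_mono _ fun u hu => ⟨hu.2, fun h => Set.disjoint_left.1 hdis hu.1 h.1⟩
  linarith

end Assumptions

end Robust

/-! ### What FFG votes imply for justification and for LMD-GHOST safety -/

section FFG

/-- The weight of FFG votes for a checkpoint that ensures its justification, even if Byzantine
validators get slashed. -/
noncomputable def ffgThreshold (G : Gasper V B) (K : Constants) (C : Chk B) : ℝ :=
  totalWeight (G.ebaC C) * K.ffgRatio +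
    (min K.maxSlash (ENNReal.ofReal (K.β * totalWeight (G.ebaC C)))).toReal

/-- As `X` grows, the right-hand side falls at rate `1 - q` and the left-hand side at the smaller
rate `2 / 3 * (1 + r)`, by `ρ < 4 / 3`. The worst case is `X = T * x`, and the threshold for `z` is
exactly what is needed there. -/
theorem two_thirds_of_change {x r q ρ T X z : ℝ} (hd : 0 < 1 - q) (hρ : ρ * (1 - q) = 1 + r)
    (hρ2 : ρ < 4 / 3) (hX : X ≤ T * x)
    (hz : T * (2 / 3 * ((1 + r - x * r) / (1 - q)) + x) ≤ z) :
    2 / 3 * ((T - X) * (1 + r) + T * x) ≤ (z - X) * (1 - q) := by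
  have h1 := mul_le_mul_of_nonneg_right hz hd.le
  have h2 : T * (2 / 3 * ((1 + r - x * r) / (1 - q)) + x) * (1 - q) =
      T * (2 / 3 * (1 + r - x * r) + x * (1 - q)) := by field_simp
  rw [h2] at h1
  have h3 : 2 / 3 * (1 + r) ≤ 1 - q := by nlinarith
  nlinarith [mul_nonneg (sub_nonneg.2 hX) (sub_nonneg.2 h3)]

/-- The bound on the proposer boost, solved for the safety threshold. -/
theorem ChangeProperties.threshold_lt (hC : G.ChangeProperties K)
    (hβ : K.β < 1 / 6) :
    (1 + K.rewardRate) / (2 * (1 - K.penaltyRate)) *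
        (1 + G.boostScore / G.slotsPerEpoch * (1 + K.exitRate + K.rewardRate) /
          (1 - K.exitRate)) + K.exitRate / (1 - K.exitRate) + K.β <
      ((K.ffgRatio + K.β) * (1 - K.penaltyRate) * (1 - K.exitRate) - K.exitRate) /
        (1 + K.rewardRate) := by
  obtain ⟨hx0, hx1⟩ := hC.exit_mem
  obtain ⟨hr0, _⟩ := hC.reward_mem
  obtain ⟨hq0, hq1⟩ := hC.penalty_mem
  obtain ⟨hσ0, hσ1⟩ := hC.slash_mem
  have hqσ := hC.penalty_le_slash
  have hboost := hC.boost_lt hβ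
  unfold Constants.ffgRatio
  set x := K.exitRate
  set r := K.rewardRate
  set q := K.penaltyRate
  set σ := K.slashRate
  set A := 2 / 3 * ((1 + r - x * r) / (1 - q))
  set p := G.boostScore / G.slotsPerEpoch
  have hd : 0 < 1 - q := by linarith
  have hd' : 0 < 1 - x := by linarith
  have hd'' : 0 < 1 - σ := by linarith
  have hr1 : 0 < 1 + r := by linarith
  have hr2 : 0 < 1 + r + x := by linarith
  set Y := (1 - x) * (1 - q) / (1 + r) * (A + x + K.β - x / ((1 - x) * (1 - σ))) -
    x / (1 - x) - K.β - (1 + r) / (2 * (1 - q)) with hY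
  have h1 : p * ((1 + r) * (1 + r + x) / (2 * (1 - q) * (1 - x))) < Y := by
    have h := mul_lt_mul_of_pos_right hboost
      (by positivity : 0 < (1 + r) * (1 + r + x) / (2 * (1 - q) * (1 - x)))
    refine h.trans_eq ?_
    field_simp
  have h2 : (1 + r) / (2 * (1 - q)) * (1 + p * (1 + x + r) / (1 - x)) =
      p * ((1 + r) * (1 + r + x) / (2 * (1 - q) * (1 - x))) + (1 + r) / (2 * (1 - q)) := by
    field_simp
    ring
  have h3 : (1 - x) * (1 - q) / (1 + r) * (A + x + K.β - x / ((1 - x) * (1 - σ))) ≤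
      ((A + x + K.β) * (1 - q) * (1 - x) - x) / (1 + r) := by
    -- The assumed bound contains the slashing rate, the goal only the penalty rate; `q ≤ σ` makes
    -- the former the stronger one.
    have h4 : x ≤ (1 - x) * (1 - q) * (x / ((1 - x) * (1 - σ))) := by
      have : (1 - x) * (1 - q) * (x / ((1 - x) * (1 - σ))) = x * (1 - q) / (1 - σ) := by
        field_simp
      rw [this, le_div_iff₀ hd'']
      nlinarith
    rw [div_mul_eq_mul_div]
    refine div_le_div_of_nonneg_right ?_ hr1.le
    linarith
  rw [h2]
  linarith

namespace Assumptions

variable (hA : G.Assumptions K) (hκ : G.Agreed κ)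
include hA hκ

/-- A lookahead of two epochs is enough: a target of the current epoch is compared with a justified
checkpoint at most two epochs older. -/
theorem valset_eq_committees {v : V} (hv : v ∈ G.honest) {t : ℝ≥0} (ht : G.GGST ≤ t) {C : Chk B}
    (hC : G.IsChk C) (hle : G.ChkLe (G.gj v t) C) (hep : C.epoch ≤ (G.gj v t).epoch + 2) :
    valset (G.ebaC C) = committees κ (G.firstSlot C.epoch) (G.lastSlot C.epoch) := by
  rw [hA.change.valset_eq v hv t C hC ht hle ?_ (hep.trans
    (Nat.add_le_add_left hA.change.two_le_lookahead _)), commEpoch, hκ.commRange_eq hv ht]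
  rcases hle with h | h
  · rw [h]
  · exact h.1.le

/-- Honest validators are most of the validator set of a checkpoint of a block in view. -/
theorem honest_weight_ge {v : V} (hv : v ∈ G.honest) {t : ℝ≥0} (ht : G.GGST ≤ t) {b : B}
    (hb : Msg.block b ∈ G.view v t) {e : ℕ} (hval : valset (G.ebaC (G.chkOf b e)) =
      committees κ (G.firstSlot e) (G.lastSlot e)) :
    (1 - K.β) * totalWeight (G.ebaC (G.chkOf b e)) ≤
      weight (G.ebaC (G.chkOf b e)) G.honest := by
  have h := hA.beta.inView v hv t ht b hb e _ _ le_rfl le_rfl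
  rw [hκ.commRange_eq hv ht, weight_of_valset_subset _ hval.le] at h
  exact h.trans (weight_mono _ Set.inter_subset_right)

/-- Enough FFG votes for a checkpoint are two thirds of the weight in any block that could include
them by the end of the next epoch. -/
theorem two_thirds_of_ffg {v : V} (hv : v ∈ G.honest) {t : ℝ≥0} (ht : G.GGST ≤ t) {c b : B}
    {e : ℕ} (hc : Msg.block c ∈ G.view v t) (hle : G.ChkLe (G.gj v t) (G.chkOf c e))
    (hep : e ≤ (G.gj v t).epoch + 2) {Z : Set V}
    (hZ : G.ffgThreshold K (G.chkOf c e) ≤ weight (G.ebaC (G.chkOf c e)) Z)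
    (hb : G.ChkLeBlock (G.chkOf c e) b) (hbe : G.epochB b ≤ e + 1) :
    2 / 3 * totalWeight (G.eba b) ≤ weight (G.eba b) (Z \ G.slashed b) := by
  have hβ := hA.beta.nonneg
  have hval := hA.valset_eq_committees hκ hv ht (isChk_chkOf c e) hle hep
  have hhon := hA.honest_weight_ge hκ hv ht hc hval
  have hch := hA.change.change_block _ b hb hbe
  set bal := G.ebaC (G.chkOf c e)
  set D := G.slashed b
  have hD : weight bal D ≤ K.β * totalWeight bal := by
    have h1 : weight bal D ≤ weight bal (Set.univ \ G.honest) :=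
      weight_mono _ fun u ⟨a, _, hu⟩ => ⟨trivial, fun h => hA.system.honest_not_slashed u h a hu⟩
    have h2 := weight_inter_add_diff bal Set.univ G.honest
    rw [Set.univ_inter] at h2
    unfold totalWeight at *
    linarith
  -- Slashed validators are Byzantine, so both bounds apply and the votes lost to slashing are
  -- covered by the smaller one.
  have hD' : weight bal D ≤
      (min K.maxSlash (ENNReal.ofReal (K.β * totalWeight bal))).toReal := by
    refine (ENNReal.ofReal_le_iff_le_toReal (ne_top_of_le_ne_top ENNReal.ofReal_ne_top
      (min_le_right _ _))).1 (le_min (hA.slash _ b hb) (ENNReal.ofReal_le_ofReal hD))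
  have h1 := weight_inter_add_diff bal Z D
  have h2 := weight_mono bal (Set.inter_subset_right : Z ∩ D ⊆ D)
  have h3 := hch.weight_ge_of_exit (Set.disjoint_sdiff_left : Disjoint (Z \ D) D)
    hA.change.penalty_mem.2.le
  have h4 := hch.weight_le_of_exit Set.univ
  rw [Set.univ_inter] at h4
  have h5 := two_thirds_of_change (z := weight bal (Z \ D)) hA.change.one_sub_penalty_pos
    hA.change.rateRatio_mul (hA.change.rateRatio_lt hβ hA.beta_lt) hch.exit_le (by
      have : totalWeight bal * K.ffgRatio ≤ weight bal (Z \ D) := by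
        have := hZ
        unfold ffgThreshold at this
        linarith
      exact this)
  refine le_trans ?_ h3
  refine le_trans ?_ h5
  exact mul_le_mul_of_nonneg_left h4 (by norm_num)

/-- If most honest validators have cast FFG votes for a checkpoint, then they are a safe majority
also with respect to the previous one. -/
theorem safe_of_ffg {v : V} (hv : v ∈ G.honest) {C C' : Chk B} {b : B} (hC : C ∈ G.unrealized b)
    (hch : ChangeWithin K (G.ebaC C) (G.ebaC C') (G.slashed C'.block)) {a a' : ℕ}
    (hval : valset (G.ebaC C') = committees κ a a') {S W : Set V}
    (hS : K.honFFGRatioVar < weight (G.ebaC C') S / weight (G.ebaC C') G.honest)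
    (hW : committees κ a a' ⊆ W) :
    (1 + K.rewardRate) / (2 * (1 - K.penaltyRate)) *
        (1 + G.boostWeight C * (1 + K.exitRate + K.rewardRate) / weight (G.ebaC C) W) +
      K.exitRate * totalWeight (G.ebaC C) / weight (G.ebaC C) W + K.β <
    weight (G.ebaC C) S / weight (G.ebaC C) W := by
  have hβ := hA.beta.nonneg
  have hβ1 := hA.beta_lt
  have hthr := hA.change.threshold_lt hβ1
  obtain ⟨hx0, hx1⟩ := hA.change.exit_mem
  have hr0 := hA.change.reward_mem.1
  have hd := hA.change.one_sub_penalty_pos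
  have hffg := hA.change.two_thirds_le_ffgRatio
  have hT : 0 < totalWeight (G.ebaC C) := hA.system.ebaC_pos C (hA.gasper.isChk_of_mem hC)
  set bal := G.ebaC C
  set bal' := G.ebaC C'
  set T := totalWeight bal
  have hx : 0 < 1 - K.exitRate := by linarith
  have hb1 : 0 < 1 - K.β := by linarith
  have h1 : (1 - K.exitRate) * T ≤ weight bal (committees κ a a') := by
    have h1 := weight_inter_add_diff bal (valset bal) (valset bal')
    rw [weight_of_valset_subset bal le_rfl] at h1
    have h2 := weight_mono bal (Set.inter_subset_right : valset bal ∩ valset bal' ⊆ _)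
    rw [← hval]
    have := hch.exit_le
    linarith
  have h2 : (1 - K.β) * weight bal (committees κ a a') ≤
      weight bal (committees κ a a' ∩ G.honest) := by
    have h := hA.byzantine_weight_le hκ hv hC a a'
    have := weight_inter_add_diff bal (committees κ a a') G.honest
    linarith
  have hD : Disjoint G.honest (G.slashed C'.block) :=
    Set.disjoint_left.2 fun u hu ⟨c, _, hc⟩ => hA.system.honest_not_slashed u hu c hc
  have h3 := hch.inter_weight_ge hD
  rw [hval, Set.inter_comm] at h3
  have h4 : (1 - K.β) * ((1 - K.exitRate) * T) * (1 - K.penaltyRate) ≤ weight bal' G.honest :=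
    le_trans (mul_le_mul_of_nonneg_right
      ((mul_le_mul_of_nonneg_left h1 hb1.le).trans h2) hd.le) h3
  have hpos : 0 < (1 - K.β) * ((1 - K.exitRate) * T) * (1 - K.penaltyRate) := by positivity
  rw [lt_div_iff₀ (hpos.trans_le h4)] at hS
  -- The factor `1 / (1 - β)` of `honFFGRatioVar` cancels the Byzantine loss in the lower bound `h4`
  -- for the honest weight; the factors for exits and penalties remain.
  have h5 : (K.ffgRatio + K.β) * (1 - K.penaltyRate) * (1 - K.exitRate) * T ≤
      K.honFFGRatioVar * weight bal' G.honest := by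
    have e : K.honFFGRatioVar = 1 / (1 - K.β) * (K.ffgRatio + K.β) := rfl
    have h : 0 ≤ K.honFFGRatioVar := by
      rw [e]; exact mul_nonneg (by positivity) (by linarith)
    refine le_trans (le_of_eq ?_) (mul_le_mul_of_nonneg_left h4 h)
    rw [e]
    field_simp
  have h6 := hch.weight_le hr0 S
  have hw1 : (1 - K.exitRate) * T ≤ weight bal W := h1.trans (weight_mono _ hW)
  have hw2 : weight bal W ≤ T := weight_le_total _ _
  have hw0 : 0 < weight bal W := (by positivity : 0 < (1 - K.exitRate) * T).trans_le hw1
  have h7 : T / weight bal W ≤ 1 / (1 - K.exitRate) := by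
    rw [div_le_div_iff₀ hw0 hx]; linarith
  have h8 : ((K.ffgRatio + K.β) * (1 - K.penaltyRate) * (1 - K.exitRate) - K.exitRate) /
        (1 + K.rewardRate) ≤ weight bal S / weight bal W := by
    have h9 : ((K.ffgRatio + K.β) * (1 - K.penaltyRate) * (1 - K.exitRate) - K.exitRate) * T ≤
        weight bal S * (1 + K.rewardRate) := by linarith
    have h10 : weight bal S / T ≤ weight bal S / weight bal W :=
      div_le_div_of_nonneg_left (weight_nonneg _ _) hw0 hw2
    refine le_trans ?_ h10
    rw [div_le_div_iff₀ (by linarith) hT]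
    exact h9
  refine lt_of_le_of_lt ?_ (hthr.trans_le h8)
  have hp : 0 ≤ G.boostScore / G.slotsPerEpoch :=
    div_nonneg G.boostScore_nonneg (Nat.cast_nonneg _)
  have h11 : G.boostWeight C * (1 + K.exitRate + K.rewardRate) / weight bal W ≤
      G.boostScore / G.slotsPerEpoch * (1 + K.exitRate + K.rewardRate) / (1 - K.exitRate) := by
    have e : G.boostWeight C * (1 + K.exitRate + K.rewardRate) / weight bal W =
        G.boostScore / G.slotsPerEpoch * (1 + K.exitRate + K.rewardRate) *
          (T / weight bal W) := by
      rw [boostWeight]; ring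
    rw [e, ← mul_one_div _ (1 - K.exitRate)]
    exact mul_le_mul_of_nonneg_left h7 (mul_nonneg hp (by linarith))
  have h12 : K.exitRate * T / weight bal W ≤ K.exitRate / (1 - K.exitRate) := by
    rw [mul_div_assoc, ← mul_one_div _ (1 - K.exitRate)]
    exact mul_le_mul_of_nonneg_left h7 hx0
  have hc : 0 ≤ (1 + K.rewardRate) / (2 * (1 - K.penaltyRate)) := by positivity
  have h13 := mul_le_mul_of_nonneg_left (add_le_add_right h11 1) hc
  linarith

end Assumptions

end FFG

/-! ### The inductive step from one epoch to the next -/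

section Stage

/-- The situation at the beginning of epoch `f + 1` in which `c` stays canonical during that epoch:
its LMD-GHOST support, measured with the justified checkpoint `C` of the chain of `b` since slot
`s`, is robust, and its checkpoint for epoch `f` has enough FFG votes. -/
structure Stage (G : Gasper V B) (K : Constants) (κ : ℕ → Finset V) (f : ℕ) (c b : B) (C : Chk B)
    (s : ℕ) : Prop where
  ggst : G.GGST ≤ G.epochStart f
  le_slot : G.firstSlot f ≤ s
  slot_le : s ≤ G.firstSlot (f + 1)
  anc : G.Anc c b
  epoch_le : G.epochB b ≤ f
  seen : ∀ v ∈ G.honest, ∀ t, G.epochStart (f + 1) ≤ t → Msg.block b ∈ G.view v t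
  mem : C ∈ G.unrealized b
  le_epoch : f ≤ C.epoch + 1
  robust : G.RobustSupport K κ c C s
  voted : ∀ u ∈ G.honest, ∀ k, s ≤ k → k < G.firstSlot (f + 1) → G.Anc c (G.votedBlock u k)
  chk_eq : G.chkOf b f = G.chkOf c f
  unique : ∀ b', ∀ D ∈ G.unrealized b', D.epoch = f → D = G.chkOf c f
  ffg : G.ffgThreshold K (G.chkOf c f) ≤ weight (G.ebaC (G.chkOf c f))
    (G.ffgSent (G.VS c f) (G.chkOf c f) (G.epochStart (f + 1)))

theorem lt_slotAt_of_lt_firstSlot {k f : ℕ} {t : ℝ≥0} (hk : k < G.firstSlot f)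
    (ht : G.epochStart f ≤ t) : k < G.slotAt t := hk.trans_le (le_slotAt_iff.2 ht)

namespace Stage

variable (hA : G.Assumptions K) (hκ : G.Agreed κ) {f : ℕ} {c b : B} {C : Chk B} {s : ℕ}

theorem chkLe (h : G.Stage K κ f c b C s) (hA : G.Assumptions K) : G.ChkLe C (G.chkOf c f) := by
  rw [← h.chk_eq]
  exact (hA.gasper.unrealized_chain b C h.mem).chkLe
    ((hA.gasper.unrealized_epoch_le b C h.mem).trans h.epoch_le)

theorem block_anc (h : G.Stage K κ f c b C s) (hA : G.Assumptions K) : G.Anc C.block c := by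
  have h1 := chkOf_block_anc (G := G) (b := b)
    ((hA.gasper.unrealized_epoch_le b C h.mem).trans h.epoch_le)
  rw [hA.gasper.chkOf_of_mem h.mem, h.chk_eq] at h1
  exact h1.trans (chkOf_anc c f)

include hA

/-- The greatest justified checkpoint of honest validators in epoch `f + 1`. -/
theorem gj_cases (h : G.Stage K κ f c b C s) {v : V} (hv : v ∈ G.honest) {t : ℝ≥0}
    (ht : G.epochAt t = f + 1) :
    G.gj v t = C ∨ (G.gj v t = G.chkOf c f ∧ f = C.epoch + 1) := by
  have h1 := hA.epoch_gj_lt hv (t := t) (by omega)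
  have hb := h.seen v hv t (le_epochAt_iff.1 ht.ge)
  have h2 := (hA.system.gj_spec hv t).2 b hb
  have he := h.epoch_le
  rw [ht, VS_of_lt (by omega)] at h2
  have h3 := (epoch_le_GU h.mem).trans h2
  have h4 := h.le_epoch
  obtain ⟨b', hb'⟩ := hA.gj_mem hv t
  by_cases heq : (G.gj v t).epoch = C.epoch
  · exact Or.inl (hA.justified_unique hb' h.mem heq)
  · exact Or.inr ⟨h.unique b' _ hb' (by omega), by omega⟩

theorem gj_spec (h : G.Stage K κ f c b C s) {v : V} (hv : v ∈ G.honest) {t : ℝ≥0}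
    (ht : G.epochAt t = f + 1) :
    G.ChkLe C (G.gj v t) ∧ G.ChkLe (G.gj v t) (G.chkOf c f) ∧ (G.gj v t).epoch ≤ C.epoch + 1 ∧
      f ≤ (G.gj v t).epoch + 1 ∧ G.Anc (G.gj v t).block c := by
  have h1 := h.le_epoch
  rcases h.gj_cases hA hv ht with h2 | ⟨h2, h3⟩ <;> rw [h2]
  · exact ⟨chkLe_refl C, h.chkLe hA, Nat.le_succ _, h1, h.block_anc hA⟩
  · exact ⟨h.chkLe hA, chkLe_refl _, h3.le, Nat.le_succ _, chkOf_anc c f⟩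

/-- The greatest justified checkpoint of an honest validator, when it votes for `C'` in epoch
`f + 1`, is in the chain of `C'`. -/
theorem gj_chkLe (h : G.Stage K κ f c b C s) {C' : Chk B} {b' : B} (hce : C'.epoch = f + 1)
    (hcC : G.Anc c C'.block) (hb' : G.ChkLeBlock C' b') (hmem : G.chkOf c f ∈ G.unrealized b')
    {u : V} (hu : u ∈ G.honest) {t : ℝ≥0} (ht : G.epochAt t = f + 1)
    (hvote : C' = G.chkOf (G.canonical u t) (f + 1)) : G.ChkLe (G.gj u t) C' := by
  obtain ⟨bj, hbj⟩ := hA.gj_mem hu t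
  obtain ⟨g1, g2, g3, g4, g5⟩ := h.gj_spec hA hu ht
  have hlt := hA.epoch_gj_lt hu (t := t) (by omega)
  have hle := h.le_epoch
  rcases h.gj_cases hA hu ht with hg | ⟨hg, _⟩
  · rcases (show C.epoch = f ∨ C.epoch < f by
      have : C.epoch < f + 1 := by rw [← hg]; omega
      omega) with hCf | hCf
    · have : G.gj u t = G.chkOf c f := h.unique bj _ hbj (by rw [hg, hCf])
      rw [this]
      exact (hA.gasper.unrealized_chain b' _ hmem).chkLe' hb' (by rw [hce]; exact Nat.le_succ f)
    · have hca : G.Anc C'.block (G.canonical u t) := hvote ▸ chkOf_anc _ _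
      have hNF := (hA.system.notFiltered_of_anc_canonical hu (Anc.refl G (G.canonical u t))).2
      -- If the canonical block precedes the justified block, then the latter equals `C'.block`.
      -- Otherwise the leaf that keeps it has the greatest justified checkpoint as its voting
      -- source, by maximality of epochs and uniqueness, so this checkpoint lies in the voted chain.
      rcases hNF with h1 | ⟨h1, b'', hb'', hcb, _, _, _, hVS⟩
      · have e1 : (G.gj u t).block = C'.block :=
          (g5.trans hcC).antisymm (hca.trans h1)
        right
        refine ⟨by omega, ?_⟩
        rw [← e1]
        exact hA.gasper.isChk_of_mem hbj
      · have hVS' : G.VS b'' (G.epochAt t) = G.gj u t := by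
          rcases hVS with hVS | hVS
          · exact hVS
          · have := (hA.system.gj_spec hu t).2 b'' hb''
            refine hA.justified_unique (hA.gasper.VS_mem b'' _) hbj ?_
            have : (G.gj u t).epoch = C.epoch := by rw [hg]
            omega
        have h2 : G.chkOf b'' (G.gj u t).epoch = G.gj u t :=
          hA.gasper.chkOf_of_mem (hVS' ▸ hA.gasper.VS_mem b'' _)
        have h3 : G.ChkLeBlock (G.gj u t) (G.canonical u t) :=
          (chkOf_of_between hcb (h2.symm ▸ h1)).trans h2
        rw [hvote]
        exact h3.chkLe (by omega)
  · rw [hg]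
    exact (hA.gasper.unrealized_chain b' _ hmem).chkLe' hb' (by rw [hce]; exact Nat.le_succ f)

include hκ

/-- By strong induction on the slot: honest votes of epoch `f + 1` before `t` support `c` by the
induction hypothesis, and those from `s` to the end of epoch `f` by the definition of a stage. -/
theorem anc_canonical (h : G.Stage K κ f c b C s) {v : V} (hv : v ∈ G.honest) {t : ℝ≥0}
    (ht : G.epochAt t = f + 1) : G.Anc c (G.canonical v t) := by
  induction hn : G.slotAt t using Nat.strong_induction_on generalizing v t with
  | _ n ih =>
  have hst : G.epochStart (f + 1) ≤ t := le_epochAt_iff.1 ht.ge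
  have hs : s ≤ G.slotAt t := h.slot_le.trans (le_slotAt_iff.2 hst)
  have hle := h.epoch_le
  have hle' := h.le_epoch
  obtain ⟨g1, g2, g3, g4, g5⟩ := h.gj_spec hA hv ht
  have hvote : ∀ u ∈ G.honest, ∀ k, s ≤ k → k < G.slotAt t → G.Anc c (G.votedBlock u k) := by
    intro u hu k hk hkt
    by_cases hkf : k < G.firstSlot (f + 1)
    · exact h.voted u hu k hk hkf
    · refine ih k (hn ▸ hkt) hu ?_ (hA.system.slotAt_voteTime hu k)
      rw [hA.system.epochAt_voteTime hu]
      refine le_antisymm ?_ (le_epochOfSlot_iff.2 (not_lt.1 hkf))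
      rw [← ht]
      exact epochOfSlot_mono hkt.le
  have hGs : G.GGST ≤ G.slotStart s :=
    h.ggst.trans (G.slotStart_strictMono.monotone h.le_slot)
  have hbv := h.seen v hv t hst
  have hbVS : G.epochAt t ≤ (G.VS b (G.epochAt t)).epoch + 2 := by
    rw [ht, VS_of_lt (by omega)]
    have := epoch_le_GU h.mem
    omega
  have hfin : ∀ a, Msg.block a ∈ G.view v t → G.Anc c a →
      (∀ l, G.Anc a l → G.ChkLeBlock (G.gj v t) l) →
      G.epochAt t ≤ (G.VS a (G.epochAt t)).epoch + 2 → G.Anc c (G.canonical v t) :=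
    fun a ha hca hl hVS => hA.anc_canonical_of_robust hκ hv h.robust h.mem hGs hs hvote g1 g3 g5
      ha hca hl hVS
  rcases h.gj_cases hA hv ht with hg | ⟨hg, _⟩
  · refine hfin b hbv h.anc (fun l hl => ?_) hbVS
    rw [hg]
    exact hA.gasper.unrealized_chain l C (hA.gasper.unrealized_mono b l hl h.mem)
  -- If `c` is its own checkpoint block, any block with the justified checkpoint as voting source
  -- descends from `c` and can serve as witness for the filter. Otherwise the checkpoint is already
  -- settled at `c`, and `b` serves.
  · by_cases hcs : G.slot c ≤ G.firstSlot f
    · obtain ⟨a, ha, hga⟩ := (hA.system.gj_spec hv t).1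
      have hmem : G.gj v t ∈ G.unrealized a := hga ▸ hA.gasper.VS_mem a _
      refine hfin a ha ?_ (fun l hl => ?_) ?_
      · have := (hA.gasper.unrealized_chain a _ hmem).anc
        rwa [hg, chkOf_of_slot_le hcs] at this
      · exact hA.gasper.unrealized_chain l _ (hA.gasper.unrealized_mono a l hl hmem)
      · rw [← hga, ht]; omega
    · refine hfin b hbv h.anc (fun l hl => ?_) hbVS
      rw [hg]
      exact chkOf_of_le_slot (h.anc.trans hl) (not_le.1 hcs).le

theorem two_thirds (h : G.Stage K κ f c b C s) {v : V} (hv : v ∈ G.honest) {t : ℝ≥0}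
    (ht : G.epochAt t = f + 1) {b' : B} (hb' : Msg.block b' ∈ G.view v t)
    (hC : G.ChkLeBlock (G.chkOf c f) b') :
    2 / 3 * totalWeight (G.eba b') ≤
      weight (G.eba b') (G.ffgSent (G.VS c f) (G.chkOf c f) t \ G.slashed b') := by
  have hst : G.epochStart (f + 1) ≤ t := le_epochAt_iff.1 ht.ge
  obtain ⟨_, g2, _, g4, _⟩ := h.gj_spec hA hv ht
  have hG : G.GGST ≤ t := h.ggst.trans ((epochStart_mono (Nat.le_succ f)).trans hst)
  refine hA.two_thirds_of_ffg hκ hv hG ?_ g2 (by omega) (h.ffg.trans (weight_mono _ ?_)) hC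
    ((epochB_le_of_mem_view hb').trans ht.le)
  · exact hA.mem_view_of_robust hκ hv h.robust h.mem (Anc.refl G c) hG
      (h.slot_le.trans (le_slotAt_iff.2 hst))
  · exact fun u hu => hA.system.sent_mono hst hu

/-- The next stage is reached, and its block gets confirmed. -/
theorem next (h : G.Stage K κ f c b C s) {v : V} (hv : v ∈ G.honest) :
    ∃ c' b', G.Anc c c' ∧ G.Stage K κ (f + 1) c' b' (G.GU b') (G.firstSlot (f + 2)) ∧
      c' ∈ G.confirmedAtSlot K v (G.firstSlot (f + 2)) ∧ ∃ D ∈ G.unrealized b', D.epoch = f := by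
  have hS := hA.system
  have hggst : G.GGST ≤ G.epochStart (f + 1) := h.ggst.trans (epochStart_mono (Nat.le_succ f))
  have hggst2 : G.GGST ≤ G.epochStart (f + 2) := hggst.trans (epochStart_mono (Nat.le_succ _))
  obtain ⟨⟨c', e⟩, hce, hcC, ⟨b', hb'v, hb'C, hb'e, hmem⟩, hvotes⟩ :=
    hA.just.next_justified c f (h.anc.epochB_le.trans h.epoch_le) hggst
      (fun t ht u hu => ⟨h.anc_canonical hA hκ hu ht, fun b' => h.two_thirds hA hκ hu ht⟩) v hv
  obtain rfl : e = f + 1 := hce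
  change G.Anc c c' at hcC
  have hratio := hvotes (G.epochStart (f + 2)) le_rfl
  dsimp only at hratio
  set C' : Chk B := ⟨c', f + 1⟩
  set S := G.ffgSeen (G.VS c' (f + 1)) C' v (G.epochStart (f + 2)) ∩ G.honest
  have hffg := hA.change.two_thirds_le_ffgRatio
  have hβ := hA.beta.nonneg
  have hβ1 := hA.beta_lt
  have hhf : K.honFFGRatioVar = 1 / (1 - K.β) * (K.ffgRatio + K.β) := rfl
  have hb1 : 0 < 1 - K.β := by linarith
  have hh0 : 0 ≤ K.honFFGRatioVar := by
    rw [hhf]; exact mul_nonneg (by positivity) (by linarith)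
  have hvoter : ∀ u ∈ S, ∃ k, G.firstSlot (f + 1) ≤ k ∧ k ≤ G.lastSlot (f + 1) ∧
      G.VotedAt κ u k ∧ C' = G.chkOf (G.votedBlock u k) (f + 1) := by
    rintro u ⟨hu, huh⟩
    obtain ⟨k, hk, _, _, hk2⟩ := (hS.honest_ffg u huh _ _ _).1 (hS.received_subset_sent v hv _ hu.1)
    have hke : f + 1 = G.epochOfSlot k := congrArg Chk.epoch hk2
    obtain ⟨hk3, hk4⟩ := epochOfSlot_eq_iff.1 hke.symm
    refine ⟨k, hk3, hk4, ⟨hk, ?_⟩, hke ▸ hk2⟩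
    rwa [hκ u huh _ ((hggst.trans (G.slotStart_strictMono.monotone hk3)).trans
      (hS.voteTime_mem u huh k).1)] at hk
  obtain ⟨u₀, hu₀⟩ : S.Nonempty := by
    refine nonempty_of_weight_pos (bal := G.ebaC C') ((weight_nonneg _ _).lt_of_ne fun h0 => ?_)
    rw [← h0, zero_div] at hratio
    linarith
  obtain ⟨k₀, hk₀, hk₀', hvt₀, hc₀⟩ := hvoter u₀ hu₀
  have hτ : G.epochAt (G.voteTime u₀ k₀) = f + 1 := by
    rw [hS.epochAt_voteTime hu₀.2]; exact epochOfSlot_eq_iff.2 ⟨hk₀, hk₀'⟩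
  have hτG : G.GGST ≤ G.voteTime u₀ k₀ :=
    (hggst.trans (G.slotStart_strictMono.monotone hk₀)).trans (hS.voteTime_mem u₀ hu₀.2 k₀).1
  have hgj : G.ChkLe (G.gj u₀ (G.voteTime u₀ k₀)) C' :=
    h.gj_chkLe hA rfl hcC hb'C hmem hu₀.2 hτ hc₀
  obtain ⟨_, _, _, hgje, _⟩ := h.gj_spec hA hu₀.2 hτ
  have hchk : G.IsChk C' := hb'C.isChk
  have hval : valset (G.ebaC C') =
      committees κ (G.firstSlot (f + 1)) (G.lastSlot (f + 1)) :=
    hA.valset_eq_committees hκ hu₀.2 hτG hchk hgj (Nat.add_le_add_right hgje 1)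
  have hb'chk : G.chkOf b' (f + 1) = C' := hb'C
  have hTpos := hS.ebaC_pos C' hchk
  have hlast : G.GGST ≤ G.slotStart (G.lastSlot (f + 1)) :=
    hggst.trans (G.slotStart_strictMono.monotone (firstSlot_lt_lastSlot _).le)
  have hhon : (1 - K.β) * totalWeight (G.ebaC C') ≤ weight (G.ebaC C') G.honest := by
    have := hA.honest_weight_ge hκ hv hlast hb'v (e := f + 1) (by rw [hb'chk]; exact hval)
    rwa [hb'chk] at this
  have hwS : (K.ffgRatio + K.β) * totalWeight (G.ebaC C') ≤ weight (G.ebaC C') S := by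
    have h1 : 0 < weight (G.ebaC C') G.honest := lt_of_lt_of_le (by positivity) hhon
    have h2 := hratio
    rw [lt_div_iff₀ h1] at h2
    refine le_trans (le_of_eq ?_) ((mul_le_mul_of_nonneg_left hhon hh0).trans h2.le)
    rw [hhf]
    field_simp
  have hthr : G.ffgThreshold K C' ≤ weight (G.ebaC C') S := by
    have h1 : (min K.maxSlash (ENNReal.ofReal (K.β * totalWeight (G.ebaC C')))).toReal ≤
        K.β * totalWeight (G.ebaC C') :=
      ENNReal.toReal_le_of_le_ofReal (by positivity) (min_le_right _ _)
    unfold ffgThreshold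
    linarith
  have hc'chk : G.chkOf c' (f + 1) = C' := hchk
  have hSsent : S ⊆ G.ffgSent (G.VS c' (f + 1)) C' (G.epochStart (f + 2)) :=
    fun u hu => hS.received_subset_sent v hv _ hu.1.1
  -- The vote of `u₀` provides a time at which the greatest justified checkpoint of an honest
  -- validator is below `C'`; two thirds of the votes then exclude every rival.
  have hunique : ∀ b'', ∀ D ∈ G.unrealized b'', D.epoch = f + 1 → D = C' := by
    intro b'' D hD hDe
    by_contra hne
    refine hA.gasper.no_other_of_two_thirds hA.beta_lt' u₀ hu₀.2 (G.voteTime u₀ k₀)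
      (max (G.voteTime u₀ k₀) (G.epochStart (f + 2))) C' hchk (le_epochAt_iff.1 hτ.ge)
      (le_max_left _ _) hgj ?_ D hne hDe b'' hD
    refine le_trans ?_ (weight_mono _ (X := S) fun u hu =>
      ⟨_, hS.sent_mono (le_max_right _ _) (hSsent hu)⟩)
    refine le_trans ?_ hwS
    exact mul_le_mul_of_nonneg_right (by linarith) hTpos.le
  have hanc : G.Anc c' b' := ChkLeBlock.anc hb'C
  have hGUe : (G.GU b').epoch ≤ f + 1 :=
    (hA.gasper.unrealized_epoch_le _ _ (GU_mem b')).trans (by omega)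
  have hGUe' : f ≤ (G.GU b').epoch := epoch_le_GU hmem
  have hGU : G.ChkLe (G.GU b') C' := by
    rw [← hb'chk]
    exact (hA.gasper.unrealized_chain _ _ (GU_mem b')).chkLe hGUe
  have hch : ChangeWithin K (G.ebaC (G.GU b')) (G.ebaC C') (G.slashed C'.block) :=
    hA.change.change_chk _ _ (hA.gasper.isChk_of_mem (GU_mem b')) hchk hGU
      (Nat.add_le_add_right hGUe' 1)
  have hslot : G.slotAt (G.epochStart (f + 2)) = G.firstSlot (f + 2) := slotAt_epochStart _
  have hlast1 : G.firstSlot (f + 2) - 1 = G.lastSlot (f + 1) := by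
    rw [← lastSlot_add_one]; rfl
  have hlt : ∀ {k}, k ≤ G.lastSlot (f + 1) → k < G.firstSlot (f + 2) := by
    intro k hk; rw [← lastSlot_add_one]; omega
  have hsafe : G.isLMDGHOSTSafeFull K v c' (G.GU b') (G.epochStart (f + 2)) := by
    intro d hd
    by_cases hdg : d = G.genesis
    · exact Or.inr hdg
    left
    rw [indicatorQ, support, commFrom, hslot, hκ.commRange_eq hv hggst2]
    -- Being a checkpoint block, `c'` is not later than the first slot of epoch `f + 1`. For each of
    -- its ancestors the range of committees thus contains the whole epoch.
    have hds : G.slot (G.parent d) + 1 ≤ G.firstSlot (f + 1) := by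
      have h1 := G.slot_parent_lt d hdg
      have h2 := hd.slot_le
      have h3 : G.slot c' ≤ G.firstSlot (f + 1) := hchk.slot_le
      omega
    have hsub : committees κ (G.firstSlot (f + 1)) (G.lastSlot (f + 1)) ⊆
        committees κ (G.slot (G.parent d) + 1) (G.firstSlot (f + 2) - 1) :=
      fun u ⟨k, h1, h2, h3⟩ => ⟨k, hds.trans h1, hlast1 ▸ h2, h3⟩
    refine (hA.safe_of_ffg hκ hv (GU_mem b') hch hval hratio hsub).trans_le ?_
    refine div_le_div_of_nonneg_right (weight_mono _ fun u hu => ?_) (weight_nonneg _ _)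
    obtain ⟨k, hk1, hk2, hk3, hk4⟩ := hvoter u hu
    refine ⟨?_, hsub ⟨k, hk1, hk2, hk3.2⟩⟩
    rw [hS.mem_ghostSupporters_iff hκ hu.2 hv hggst2 (fun a => ghost_mem_view) d, hslot]
    refine ⟨hu.2, k, hlt hk2, hk3, hd.trans (?_ : G.Anc C'.block _), fun k' h1 h2 h3 => ?_⟩
    · rw [hk4]; exact chkOf_anc _ _
    -- Committees of one epoch are disjoint, so the GHOST vote that accompanies the FFG vote is the
    -- last one before epoch `f + 2`.
    · have e1 : G.epochOfSlot k = f + 1 := epochOfSlot_eq_iff.2 ⟨hk1, hk2⟩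
      have e2 : G.epochOfSlot k' = f + 1 := by
        refine epochOfSlot_eq_iff.2 ⟨by omega, ?_⟩
        rw [← hlast1]; omega
      have hd := hS.comm_disjoint u hu.2 G.GGST k k' h1.ne (e1.trans e2.symm)
      rw [hκ u hu.2 _ le_rfl] at hd
      exact Finset.disjoint_left.1 hd hk3.2 h3.2
  have hstage : G.Stage K κ (f + 1) c' b' (G.GU b') (G.firstSlot (f + 2)) :=
    { ggst := hggst
      le_slot := firstSlot_mono (Nat.le_succ _)
      slot_le := le_rfl
      anc := hanc
      epoch_le := by omega
      seen := fun u hu t ht => hS.block_mem_view_of_slotStart hv hu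
        ((hlt le_rfl).trans_le (le_slotAt_iff.2 ht)) (hggst2.trans ht) hb'v
      mem := GU_mem b'
      le_epoch := by omega
      robust := hA.robust_of_safe hκ hv hggst2 hsafe
      voted := fun u hu k h1 h2 => absurd h2 (not_lt.2 h1)
      chk_eq := hb'chk.trans hc'chk.symm
      unique := by rw [hc'chk]; exact hunique
      ffg := by rw [hc'chk]; exact hthr.trans (weight_mono _ hSsent) }
  refine ⟨c', b', hcC, hstage, ⟨?_, ?_⟩, _, hmem, rfl⟩
  · exact hA.mem_view_of_robust hκ hv hstage.robust (GU_mem b') (Anc.refl G c') hggst2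
      (le_slotAt_iff.2 le_rfl)
  · have hne : G.epochB c' ≠ f + 2 := by have := hanc.epochB_le; omega
    have hVS : G.VS b' (f + 2) = G.GU b' := VS_of_lt (by omega)
    change G.isConfirmedNoCaching K v c' (G.epochStart (f + 2))
    rw [isConfirmedNoCaching, epochAt_epochStart, if_neg hne, hslot, hlast1]
    refine ⟨rfl, ?_, b', hb'v, hanc, by omega, by rw [hVS]; omega, by rwa [hVS]⟩
    -- Epoch `f + 1` is over, so the received votes have to reach the threshold without the term for
    -- expected votes.
    rw [willChkpBeJustified, Nat.add_sub_cancel (n := f + 1) (m := 1), hc'chk, hslot, hlast1]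
    refine le_add_of_le_of_nonneg (hthr.trans (weight_mono _ fun u hu => ⟨hu.1, ?_⟩))
      (mul_nonneg hb1.le (weight_nonneg _ _))
    obtain ⟨k, hk1, hk2, hk3, _⟩ := hvoter u hu
    rw [hκ.commRange_eq hv hggst2]
    exact ⟨k, hk1, hk2, hk3.2⟩

end Stage

end Stage

/-! ### Confirmed blocks, safety and monotonicity -/

section Confirmed

namespace Assumptions

variable (hA : G.Assumptions K) (hκ : G.Agreed κ)
include hA

theorem two_thirds_le_threshold (C : Chk B) :
    2 / 3 * totalWeight (G.ebaC C) ≤ G.ffgThreshold K C := by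
  rw [mul_comm]
  exact (mul_le_mul_of_nonneg_left hA.change.two_thirds_le_ffgRatio (weight_nonneg _ _)).trans
    (le_add_of_nonneg_right ENNReal.toReal_nonneg)

include hκ

/-- A block of the current epoch that gets confirmed stays canonical during the epoch, and a stage
is reached at its end. -/
theorem stage_of_current_epoch {v : V} (hv : v ∈ G.honest) {h : B} {s e : ℕ}
    (he : G.epochB h = e) (hse : G.epochOfSlot s = e) (hG : G.GGST ≤ G.epochStart e)
    (hmem : Msg.block h ∈ G.view v (G.slotStart s))
    (hwill : G.willChkpBeJustified K v h e (G.slotStart s)) (hGJ : (G.GJ h).epoch + 1 = e)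
    (hsafe : G.isLMDGHOSTSafeFull K v h (G.GJ h) (G.slotStart s)) :
    G.slot h < s ∧ G.Stage K κ e h h (G.GJ h) s := by
  have hS := hA.system
  have hP := hA.gasper
  obtain ⟨hs1, hs2⟩ := epochOfSlot_eq_iff.1 hse
  have hGs : G.GGST ≤ G.slotStart s := hG.trans (G.slotStart_strictMono.monotone hs1)
  have hR := hA.robust_of_safe hκ hv hGs hsafe
  have hGm := hP.GJ_mem h
  have hg : h ≠ G.genesis := by
    rintro rfl
    rw [epochB_genesis] at he
    omega
  have hfs : G.firstSlot e ≤ G.slot h := (le_epochOfSlot_iff (G := G)).1 he.ge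
  obtain ⟨_, _, k₀, hk₀, hk₀', _⟩ := hA.exists_voter hκ hv hR hGm hg
  have hlt : G.slot h < s := by omega
  have hview : ∀ u ∈ G.honest, ∀ t, s ≤ G.slotAt t → Msg.block h ∈ G.view u t := fun u hu t ht =>
    hA.mem_view_of_robust hκ hu hR hGm (Anc.refl G h) (hGs.trans (le_slotAt_iff.1 ht)) ht
  -- The chain of `h` justifies epoch `e - 1`, and nothing newer can be justified during epoch `e`;
  -- uniqueness then fixes the checkpoint.
  have hgj : ∀ u ∈ G.honest, ∀ t, s ≤ G.slotAt t → G.epochAt t = e → G.gj u t = G.GJ h := by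
    intro u hu t ht hte
    obtain ⟨bj, hbj⟩ := hA.gj_mem hu t
    refine hA.justified_unique hbj hGm ?_
    have h1 := hA.epoch_gj_lt hu (t := t) (by omega)
    have h2 := (hS.gj_spec hu t).2 h (hview u hu t ht)
    rw [hte, VS_of_eq he] at h2
    omega
  have hcan : ∀ n, ∀ u ∈ G.honest, ∀ t, G.slotAt t = n → s ≤ n → G.epochAt t = e →
      G.Anc h (G.canonical u t) := by
    intro n
    induction n using Nat.strong_induction_on with
    | _ n ih =>
    intro u hu t hn hsn hte
    have hg := hgj u hu t (hn ▸ hsn) hte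
    refine hA.anc_canonical_of_robust hκ hu hR hGm hGs (hn ▸ hsn) ?_ ?_ ?_ ?_
      (hview u hu t (hn ▸ hsn)) (Anc.refl G h) ?_ ?_
    · intro w hw k hk hkt
      refine ih k (hn ▸ hkt) w hw _ (hS.slotAt_voteTime hw k) hk ?_
      rw [hS.epochAt_voteTime hw]
      refine le_antisymm ?_ (hse ▸ epochOfSlot_mono hk)
      exact hte ▸ epochOfSlot_mono hkt.le
    · rw [hg]; exact chkLe_refl _
    · rw [hg]; exact Nat.le_succ _
    · rw [hg]; exact (hP.unrealized_chain h _ hGm).anc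
    · intro l hl
      rw [hg]
      exact hP.unrealized_chain l _ (hP.unrealized_mono h l hl hGm)
    · rw [hte, VS_of_eq he]; omega
  have hvoted : ∀ u ∈ G.honest, ∀ k, s ≤ k → k < G.firstSlot (e + 1) →
      G.epochOfSlot k = e ∧ G.Anc h (G.votedBlock u k) := by
    intro u hu k hk hke
    have h1 : G.epochOfSlot k = e := by
      refine epochOfSlot_eq_iff.2 ⟨hs1.trans hk, ?_⟩
      rw [← lastSlot_add_one] at hke
      omega
    exact ⟨h1, hcan k u hu _ (hS.slotAt_voteTime hu k) hk ((hS.epochAt_voteTime hu k).trans h1)⟩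
  have hsent : ∀ u ∈ G.honest, ∀ k, s ≤ k → k ≤ G.lastSlot e → u ∈ κ k →
      u ∈ G.ffgSent (G.VS h e) (G.chkOf h e) (G.epochStart (e + 1)) := by
    intro u hu k hk hke huk
    have hkf : k < G.firstSlot (e + 1) := by rw [← lastSlot_add_one]; omega
    obtain ⟨h1, h2⟩ := hvoted u hu k hk hkf
    have hτ := hS.voteTime_mem u hu k
    have h3 : G.epochB (G.votedBlock u k) = e :=
      le_antisymm (h1 ▸ epochOfSlot_mono (hS.slot_canonical_le hu k)) (he ▸ h2.epochB_le)
    refine (hS.honest_ffg u hu _ _ _).2 ⟨k, ?_, ?_, ?_, ?_⟩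
    · rw [hκ u hu _ ((hGs.trans (G.slotStart_strictMono.monotone hk)).trans hτ.1)]
      exact huk
    · exact ((le_add_of_nonneg_right zero_le).trans hτ.2.le).trans
        (G.slotStart_strictMono.monotone hkf)
    · rw [h1, VS_of_eq he]
      exact (GJ_eq_of_anc h2 (he.trans h3.symm)).trans (VS_of_eq h3).symm
    · rw [h1]
      exact (chkOf_of_le_slot h2 hfs).symm
  have hffg : G.ffgThreshold K (G.chkOf h e) ≤ weight (G.ebaC (G.chkOf h e))
      (G.ffgSent (G.VS h e) (G.chkOf h e) (G.epochStart (e + 1))) := by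
    -- The votes expected by the algorithm are at least as good as cast: the `β`-bound gives the
    -- honest weight of the remaining committees, and `hsent` their votes.
    have h1 := hA.beta.inView v hv _ hGs h hmem e s _ hs1 le_rfl
    rw [willChkpBeJustified, slotAt_slotStart] at hwill
    rw [hκ.commRange_eq hv hGs] at hwill h1
    rw [hκ.commRange_eq hv hGs] at hwill
    have hdis : Disjoint (G.ffgSeen (G.VS h e) (G.chkOf h e) v (G.slotStart s) ∩
        committees κ (G.firstSlot e) (s - 1)) (committees κ s (G.lastSlot e) ∩ G.honest) := by
      rw [Set.disjoint_left]
      rintro u ⟨_, k, h1, h2, h3⟩ ⟨⟨k', h1', h2', h3'⟩, _⟩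
      have hd := hS.comm_disjoint v hv G.GGST k k' (by omega)
        ((epochOfSlot_eq_iff.2 ⟨h1, by omega⟩).trans
          (epochOfSlot_eq_iff.2 ⟨hs1.trans h1', h2'⟩).symm)
      rw [hκ v hv _ le_rfl] at hd
      exact Finset.disjoint_left.1 hd h3 h3'
    refine hwill.trans ((add_le_add_right h1 _).trans ?_)
    rw [← weight_union _ hdis]
    refine weight_mono _ ?_
    rintro u (⟨hu, _⟩ | ⟨⟨k, h1, h2, h3⟩, hu⟩)
    · refine hS.sent_mono ?_ (hS.received_subset_sent v hv _ hu.1)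
      refine G.slotStart_strictMono.monotone ?_
      rw [← lastSlot_add_one]; omega
    · exact hsent u hu k h1 h2 h3
  refine ⟨hlt, ?_⟩
  exact
    { ggst := hG
      le_slot := hs1
      slot_le := by rw [← lastSlot_add_one]; omega
      anc := Anc.refl G h
      epoch_le := he.le
      seen := fun u hu t ht => hview u hu t (by
        have := lt_slotAt_of_lt_firstSlot (G := G) (k := s) (by rw [← lastSlot_add_one]; omega) ht
        omega)
      mem := hGm
      le_epoch := hGJ.ge
      robust := hR
      voted := fun u hu k h1 h2 => (hvoted u hu k h1 h2).2
      chk_eq := rfl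
      unique := by
        intro b' D hD hDe
        by_contra hne
        refine hP.no_other_of_two_thirds hA.beta_lt' v hv (G.slotStart s)
          (G.epochStart (e + 1)) (G.chkOf h e) (isChk_chkOf h e)
          (G.slotStart_strictMono.monotone hs1)
          (G.slotStart_strictMono.monotone (by rw [← lastSlot_add_one]; omega)) ?_ ?_ D hne hDe b' hD
        · rw [hgj v hv _ (slotAt_slotStart s).ge ((epochAt_slotStart s).trans hse)]
          exact (hP.unrealized_chain h _ hGm).chkLe (by omega)
        · exact ((hA.two_thirds_le_threshold _).trans hffg).trans
            (weight_mono _ fun u hu => ⟨_, hu⟩)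
      ffg := hffg }

/-- A block of the previous epoch that gets confirmed at the beginning of an epoch defines a
stage. -/
theorem stage_of_previous_epoch {v : V} (hv : v ∈ G.honest) {h b : B} {f : ℕ}
    (hfh : f ≤ G.epochB h) (hG : G.GGST ≤ G.epochStart f)
    (hwill : G.willChkpBeJustified K v h f (G.epochStart (f + 1)))
    (hb : Msg.block b ∈ G.view v (G.slotStart (G.lastSlot f))) (hhb : G.Anc h b)
    (hbe : G.epochB b < f + 1) (hVS : f + 1 ≤ (G.VS b (f + 1)).epoch + 2)
    (hsafe : G.isLMDGHOSTSafeFull K v h (G.VS b (f + 1)) (G.epochStart (f + 1))) :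
    G.Stage K κ f h b (G.GU b) (G.firstSlot (f + 1)) := by
  have hS := hA.system
  have hP := hA.gasper
  rw [VS_of_lt hbe] at hVS hsafe
  have hf : 1 ≤ f := by
    have := le_epochAt_iff.2 (epochStart_one_le_GGST.trans hG)
    rwa [epochAt_epochStart] at this
  have hG' : G.GGST ≤ G.epochStart (f + 1) := hG.trans (epochStart_mono (Nat.le_succ f))
  have hR := hA.robust_of_safe hκ hv hG' hsafe
  have hfs : G.firstSlot f ≤ G.slot h := (le_epochOfSlot_iff (G := G)).1 hfh
  have hg : h ≠ G.genesis := by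
    rintro rfl
    rw [epochB_genesis] at hfh
    omega
  have hchk : G.chkOf b f = G.chkOf h f := chkOf_of_le_slot hhb hfs
  have hlast : G.lastSlot f < G.firstSlot (f + 1) := by rw [← lastSlot_add_one]; omega
  have hffg : G.ffgThreshold K (G.chkOf h f) ≤ weight (G.ebaC (G.chkOf h f))
      (G.ffgSent (G.VS h f) (G.chkOf h f) (G.epochStart (f + 1))) := by
    rw [willChkpBeJustified, slotAt_epochStart] at hwill
    -- Again the epoch is over, and its range of remaining slots is empty.
    have hempty : G.commRange v (G.epochStart (f + 1)) (G.firstSlot (f + 1)) (G.lastSlot f) = ∅ :=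
      Set.eq_empty_of_forall_notMem fun u ⟨k, h1, h2, _⟩ => by omega
    have h0 : weight (G.ebaC (G.chkOf h f)) (∅ : Set V) = 0 := by simp [weight]
    rw [hempty, h0, mul_zero, add_zero] at hwill
    exact hwill.trans (weight_mono _ fun u hu => hS.received_subset_sent v hv _ hu.1.1)
  have hCe : (G.GU b).epoch ≤ f := (hP.unrealized_epoch_le _ _ (GU_mem b)).trans (by omega)
  have hCle : G.ChkLe (G.GU b) (G.chkOf h f) :=
    hchk ▸ (hP.unrealized_chain b _ (GU_mem b)).chkLe hCe
  have hunique : ∀ b', ∀ D ∈ G.unrealized b', D.epoch = f → D = G.chkOf h f := by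
    intro b' D hD hDe
    -- Either epoch `f` is already justified in the chain of `b`, and uniqueness is an assumption,
    -- or an honest voter for `h` in epoch `f` supplies the justified checkpoint below that of `h`
    -- which the two-thirds argument needs.
    rcases hCe.eq_or_lt with hCf | hCf
    · rw [hA.justified_unique hD (GU_mem b) (hDe.trans hCf.symm), ← hchk, ← hCf]
      exact (hP.chkOf_of_mem (GU_mem b)).symm
    obtain ⟨u, hu, k, hk, hk', hvb⟩ := hA.exists_voter hκ hv hR (GU_mem b) hg
    have hτ : G.epochAt (G.voteTime u k) = f := by
      rw [hS.epochAt_voteTime hu]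
      exact epochOfSlot_eq_iff.2 ⟨hfs.trans hk', by rw [← lastSlot_add_one] at hk; omega⟩
    have hle : G.ChkLe (G.gj u (G.voteTime u k)) (G.chkOf h f) := by
      obtain ⟨bj, hbj⟩ := hA.gj_mem hu (G.voteTime u k)
      have hlt := hA.epoch_gj_lt hu (t := G.voteTime u k) (by omega)
      rw [hτ] at hlt
      by_cases hgC : (G.gj u (G.voteTime u k)).epoch = (G.GU b).epoch
      · rwa [hA.justified_unique hbj (GU_mem b) hgC]
      -- Here the justified checkpoint is older than epoch `f - 1`. Its block is too old to descend
      -- from `h`, so the voted block was kept because of a leaf, whose voting source has to be that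
      -- checkpoint.
      · rcases (hS.notFiltered_of_anc_canonical hu (Anc.refl G (G.votedBlock u k))).2 with
          h1 | ⟨h1, b'', hb'', hcb, _, _, _, hVS'⟩
        · exfalso
          have h2 := (hvb.trans h1).slot_le
          have h3 := (hP.isChk_of_mem hbj).slot_le
          have h4 : G.firstSlot ((G.gj u (G.voteTime u k)).epoch + 1) ≤ G.firstSlot f :=
            firstSlot_mono hlt
          rw [firstSlot_succ] at h4
          have h5 := slotsPerEpoch_pos (G := G)
          change G.slot h ≤ G.slot (G.gj u (G.voteTime u k)).block at h2
          omega
        · have hVSe : G.VS b'' (G.epochAt (G.voteTime u k)) = G.gj u (G.voteTime u k) := by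
            rcases hVS' with hVS' | hVS'
            · exact hVS'
            · have := (hS.gj_spec hu (G.voteTime u k)).2 b'' hb''
              exact hA.justified_unique (hP.VS_mem b'' _) hbj (by omega)
          have h2 : G.ChkLeBlock (G.gj u (G.voteTime u k)) b'' :=
            hP.chkOf_of_mem (hVSe ▸ hP.VS_mem b'' _)
          have h3 : G.ChkLeBlock (G.gj u (G.voteTime u k)) h :=
            (chkOf_of_le_slot (hvb.trans hcb) ((firstSlot_mono hlt.le).trans hfs)).symm.trans h2
          exact h3.chkLe hlt.le
    by_contra hne
    refine hP.no_other_of_two_thirds hA.beta_lt' u hu (G.voteTime u k)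
      (max (G.voteTime u k) (G.epochStart (f + 1))) _ (isChk_chkOf h f) (le_epochAt_iff.1 hτ.ge)
      (le_max_left _ _) hle ?_ D hne hDe b' hD
    exact ((hA.two_thirds_le_threshold _).trans hffg).trans
      (weight_mono _ fun u hu => ⟨_, hS.sent_mono (le_max_right _ _) hu⟩)
  exact
    { ggst := hG
      le_slot := firstSlot_mono (Nat.le_succ f)
      slot_le := le_rfl
      anc := hhb
      epoch_le := by omega
      seen := fun u hu t ht => hS.block_mem_view_of_slotStart hv hu
        (lt_slotAt_of_lt_firstSlot hlast ht) (hG'.trans ht) hb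
      mem := GU_mem b
      le_epoch := by omega
      robust := hR
      voted := fun u hu k h1 h2 => absurd h2 (not_lt.2 h1)
      chk_eq := hchk
      unique := hunique
      ffg := hffg }

/-- The inequality `slot h < s` in the first alternative matters for monotonicity: the search of the
next epoch starts only at the second slot of this one, and still includes `s`. -/
theorem stage_of_confirmed {v : V} (hv : v ∈ G.honest) {h : B} {s g : ℕ}
    (hh : h ∈ G.confirmedAtSlot K v s) (hG : G.GGST ≤ G.epochStart g)
    (hgs : g ≤ G.epochOfSlot s) (hsg : G.epochOfSlot s ≤ g + 1) (hgh : g ≤ G.epochB h) :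
    ∃ f b C s', G.Stage K κ f h b C s' ∧ g ≤ f ∧
      (f = G.epochOfSlot s ∧ f = G.epochB h ∧ G.slot h < s ∨ f + 1 = G.epochOfSlot s) := by
  obtain ⟨hmem, hc⟩ := hh
  have hle := epochB_le_of_mem_view hmem
  rw [epochAt_slotStart] at hle
  rw [isConfirmedNoCaching, epochAt_slotStart, slotAt_slotStart] at hc
  split_ifs at hc with he
  · obtain ⟨h1, h2⟩ := hA.stage_of_current_epoch hκ hv he rfl (hG.trans (epochStart_mono hgs))
      hmem hc.1 hc.2.1 hc.2.2
    exact ⟨_, _, _, _, h2, hgs, Or.inl ⟨rfl, he.symm, h1⟩⟩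
  · obtain ⟨hs, hwill, b, hb, hhb, hbe, hVS, hsafe⟩ := hc
    have hgs : G.epochOfSlot s = g + 1 := by omega
    rw [hgs] at hs hwill hbe hVS hsafe
    have hlast : s - 1 = G.lastSlot g := by rw [hs, ← lastSlot_add_one]; rfl
    have hst : G.slotStart s = G.epochStart (g + 1) := by rw [hs]; rfl
    rw [hlast] at hb
    rw [hst] at hwill hsafe
    exact ⟨g, b, _, _, hA.stage_of_previous_epoch hκ hv hgh hG hwill hb hhb hbe hVS hsafe, le_rfl,
      Or.inr hgs.symm⟩

end Assumptions

namespace Stage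

variable (hA : G.Assumptions K) (hκ : G.Agreed κ) {f : ℕ} {c b : B} {C : Chk B} {s : ℕ}
include hA hκ

theorem exists_later (h : G.Stage K κ f c b C s) {v : V} (hv : v ∈ G.honest) (n : ℕ) :
    ∃ c' b' C' s', G.Anc c c' ∧ G.Stage K κ (f + n) c' b' C' s' := by
  induction n with
  | zero => exact ⟨c, b, C, s, Anc.refl G c, h⟩
  | succ n ih =>
    obtain ⟨c', b', C', s', h1, h2⟩ := ih
    obtain ⟨c'', b'', h3, h4, _⟩ := h2.next hA hκ hv
    exact ⟨c'', b'', _, _, h1.trans h3, h4⟩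

theorem anc_canonical_of_le (h : G.Stage K κ f c b C s) {v : V} (hv : v ∈ G.honest) {t : ℝ≥0}
    (ht : f + 1 ≤ G.epochAt t) : G.Anc c (G.canonical v t) := by
  obtain ⟨c', b', C', s', h1, h2⟩ := h.exists_later hA hκ hv (G.epochAt t - (f + 1))
  exact h1.trans (h2.anc_canonical hA hκ hv (by omega))

/-- Both blocks are canonical for one validator after the later of the two epochs. -/
theorem comparable {f' : ℕ} {c' b' : B} {C' : Chk B} {s' : ℕ} (h : G.Stage K κ f c b C s)
    (h' : G.Stage K κ f' c' b' C' s') {v : V} (hv : v ∈ G.honest) : G.Anc c c' ∨ G.Anc c' c := by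
  have h1 := epochAt_epochStart (G := G) (max f f' + 1)
  exact (h.anc_canonical_of_le hA hκ hv (t := G.epochStart (max f f' + 1)) (by omega)).comparable
    (h'.anc_canonical_of_le hA hκ hv (by omega))

/-- The block of a stage and a confirmed block of an earlier epoch lie on one chain. -/
theorem comparable_of_confirmed (h : G.Stage K κ f c b C (G.firstSlot (f + 1))) {D : Chk B}
    (hD : D ∈ G.unrealized b) (hDe : D.epoch + 1 = f) {v : V} (hv : v ∈ G.honest) {h' : B}
    (hh' : h' ∈ G.confirmedAtSlot K v (G.firstSlot (f + 1))) (hne : G.epochB h' ≠ f + 1) :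
    G.Anc c h' ∨ G.Anc h' c := by
  have hG : G.GGST ≤ G.epochStart (f + 1) := h.ggst.trans (epochStart_mono (Nat.le_succ f))
  have hc := hh'.2
  rw [isConfirmedNoCaching, epochAt_slotStart, epochOfSlot_firstSlot, if_neg hne] at hc
  obtain ⟨_, _, b', _, _, hbe, hVS, hsafe⟩ := hc
  rw [VS_of_lt hbe] at hVS hsafe
  have hR := hA.robust_of_safe hκ hv hG hsafe
  have hm := GU_mem (G := G) b'
  have hle := hA.gasper.unrealized_epoch_le _ _ hm
  have hle' := (hA.gasper.unrealized_epoch_le _ _ h.mem).trans h.epoch_le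
  have hge := h.le_epoch
  -- Both checkpoints have epoch `f - 1` or `f`. The older one precedes the newer one: of epoch `f -
  -- 1` there is only `D`, which is in the chain of `b`, and of epoch `f` only the checkpoint of
  -- `c`.
  rcases lt_trichotomy (G.GU b').epoch C.epoch with hlt | heq | hlt
  · refine (hA.comparable_of_robust hκ hv hR hm h.robust h.mem ?_ (by omega)).symm
    have hDU : D ∈ G.unrealized b := hD
    rw [hA.justified_unique hm hDU (by omega)]
    exact (hA.gasper.unrealized_chain b D hD).chkLe' (hA.gasper.unrealized_chain b C h.mem)
      (by omega)
  · have := hA.justified_unique hm h.mem heq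
    exact hA.comparable_of_robust hκ hv h.robust h.mem hR hm (Or.inl this.symm) (by omega)
  · refine hA.comparable_of_robust hκ hv h.robust h.mem hR hm ?_ (by omega)
    rw [h.unique b' _ hm (by omega)]
    exact h.chkLe hA

end Stage

section Highest

theorem highestConfirmed_nonempty {v : V} {e s : ℕ} {t : ℝ≥0} (h1 : G.firstSlot e + 1 ≤ s)
    (h2 : s ≤ G.slotAt t) {c : B} (hc : c ∈ G.confirmedAtSlot K v s) :
    (G.highestConfirmedBlocksPerSlot K v e t).Nonempty := ⟨_, s, h1, h2, ⟨c, hc⟩, rfl⟩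

variable (hS : G.SystemModel)
include hS

theorem confirmedAtSlot_finite {v : V} (hv : v ∈ G.honest) (s : ℕ) :
    (G.confirmedAtSlot K v s).Finite :=
  (finite_blocks (hS.view_finite hv (G.slotStart s))).subset fun _ h => h.1

theorem highestConfirmed_spec {v : V} (hv : v ∈ G.honest) {e : ℕ} {t : ℝ≥0}
    (hne : (G.highestConfirmedBlocksPerSlot K v e t).Nonempty) :
    (∃ s, G.firstSlot e + 1 ≤ s ∧ s ≤ G.slotAt t ∧
      G.highestConfirmedSinceEpoch K v e t ∈ G.confirmedAtSlot K v s) ∧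
    ∀ s, G.firstSlot e + 1 ≤ s → s ≤ G.slotAt t → ∀ c ∈ G.confirmedAtSlot K v s,
      G.slot c ≤ G.slot (G.highestConfirmedSinceEpoch K v e t) := by
  have hfin : (G.highestConfirmedBlocksPerSlot K v e t).Finite := by
    refine ((Set.finite_Iic (G.slotAt t)).image fun s =>
      G.argmaxB (G.confirmedAtSlot K v s) fun b => G.slot b).subset ?_
    rintro _ ⟨s, _, h2, _, rfl⟩
    exact ⟨s, h2, rfl⟩
  obtain ⟨⟨s, h1, h2, h3, h4⟩, hmax⟩ := G.argmaxB_spec _ (fun b => (G.slot b : ℝ)) hfin hne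
  have hspec := fun s h => G.argmaxB_spec _ (fun b => (G.slot b : ℝ))
    (confirmedAtSlot_finite (K := K) hS hv s) h
  refine ⟨⟨s, h1, h2, ?_⟩, fun s h1 h2 c hc => ?_⟩
  · rw [highestConfirmedSinceEpoch, h4]
    exact (hspec s h3).1
  · have := (hspec s ⟨c, hc⟩).2 c hc
    exact_mod_cast this.trans (hmax _ ⟨s, h1, h2, ⟨c, hc⟩, rfl⟩)

end Highest

/-- Confirmation persists once an eventually canonical block descending from `b` has been confirmed
recently enough. -/
theorem isConfirmed_of_comparable (hS : G.SystemModel) {v : V} (hv : v ∈ G.honest) {b c : B}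
    {s : ℕ} {t : ℝ≥0} (h1 : G.firstSlot (G.epochAt t - 1) + 1 ≤ s) (h2 : s ≤ G.slotAt t)
    (hc : c ∈ G.confirmedAtSlot K v s) (hbc : G.Anc b c)
    (hcomp : ∀ s', G.firstSlot (G.epochAt t - 1) + 1 ≤ s' → s' ≤ G.slotAt t →
      ∀ h ∈ G.confirmedAtSlot K v s', G.slot c ≤ G.slot h → G.Anc c h ∨ G.Anc h c) :
    G.isConfirmed K v b t := by
  have hne := highestConfirmed_nonempty (K := K) h1 h2 hc
  obtain ⟨⟨s', h3, h4, h5⟩, hmax⟩ := highestConfirmed_spec hS hv hne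
  have hle := hmax s h1 h2 c hc
  refine ⟨hne, hbc.trans ?_⟩
  rcases hcomp s' h3 h4 _ h5 hle with h | h
  · exact h
  · rw [h.eq_of_slot_le hle]; exact Anc.refl G c

theorem Assumptions.isConfirmationRule (hA : G.Assumptions K) :
    G.IsConfirmationRule G.canonical (G.isConfirmed K) G.securityGuard := by
  rintro b t ⟨hbt, hG⟩ v hv ⟨hne, hbh⟩
  have hκ := hA.system.agreed hv
  obtain ⟨⟨s₀, hs₁, hs₂, hconf⟩, -⟩ := highestConfirmed_spec hA.system hv hne
  set h₀ := G.highestConfirmedSinceEpoch K v (G.epochAt t - 1) t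
  have ht : 1 ≤ G.epochAt t - 1 := by
    have := le_epochAt_iff.2 (epochStart_one_le_GGST.trans hG)
    rwa [epochAt_epochStart] at this
  have hs₃ : G.epochAt t - 1 ≤ G.epochOfSlot s₀ := le_epochOfSlot_iff.2 (by omega)
  have hs₄ : G.epochOfSlot s₀ ≤ G.epochAt t := epochOfSlot_mono hs₂
  have hbe := hbh.epochB_le
  obtain ⟨f, b₀, C₀, s, hstage, hgf, hf⟩ := hA.stage_of_confirmed hκ hv hconf hG hs₃ (by omega)
    (by omega)
  refine ⟨⟨G.epochStart (f + 1), fun v' hv' t' ht' =>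
    hbh.trans (hstage.anc_canonical_of_le hA hκ hv' (le_epochAt_iff.2 ht'))⟩, fun t' htt' => ?_⟩
  have hee : G.epochAt t ≤ G.epochAt t' := epochAt_mono htt'
  have hG' : G.GGST ≤ G.epochStart (G.epochAt t' - 1) := hG.trans (epochStart_mono (by omega))
  have hrange : ∀ s', G.firstSlot (G.epochAt t' - 1) + 1 ≤ s' → s' ≤ G.slotAt t' →
      G.epochAt t' - 1 ≤ G.epochOfSlot s' ∧ G.epochOfSlot s' ≤ G.epochAt t' := fun s' h1 h2 =>
    ⟨le_epochOfSlot_iff.2 (by omega), epochOfSlot_mono h2⟩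
  by_cases hcase : G.epochAt t' ≤ f + 1
  · have hs₅ : G.firstSlot (G.epochAt t' - 1) + 1 ≤ s₀ := by
      -- If the epoch has changed since `t`, then `h₀` was confirmed in its own epoch `f`, the one
      -- before that of `t'`, and strictly after its slot.
      rcases hee.eq_or_lt with heq | hlt
      · rwa [← heq]
      · rcases hf with ⟨_, h2, h3⟩ | h2
        · have : G.firstSlot f ≤ G.slot h₀ := (le_epochOfSlot_iff (G := G)).1 h2.le
          rw [show G.epochAt t' - 1 = f by omega]
          omega
        · omega
    have hh₀ : G.epochAt t' - 1 ≤ G.epochB h₀ := by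
      rcases hf with ⟨_, h2, _⟩ | h2 <;> omega
    refine isConfirmed_of_comparable hA.system hv hs₅ (hs₂.trans (slotAt_mono htt')) hconf hbh ?_
    intro s' h1 h2 h hh hle
    obtain ⟨h3, h4⟩ := hrange s' h1 h2
    -- A rival only matters if its slot is at least that of `h₀`; it is then recent enough to carry
    -- a stage.
    have h5 : G.epochB h₀ ≤ G.epochB h := epochOfSlot_mono hle
    obtain ⟨_, _, _, _, hst, _⟩ := hA.stage_of_confirmed hκ hv hh hG' h3 (by omega) (by omega)
    exact hstage.comparable hA hκ hst hv
  -- The count of epochs makes the last application of `Stage.next` confirm its block exactly in the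
  -- first slot of the epoch of `t'`.
  · obtain ⟨c₁, b₁, C₁, s₁, hc₁, hst₁⟩ := hstage.exists_later hA hκ hv (G.epochAt t' - (f + 2))
    obtain ⟨c, b', hcc, hst, hcconf, D, hD, hDe⟩ := hst₁.next hA hκ hv
    have e1 : f + (G.epochAt t' - (f + 2)) + 1 = G.epochAt t' - 1 := by omega
    have e2 : f + (G.epochAt t' - (f + 2)) + 2 = G.epochAt t' - 1 + 1 := by omega
    rw [e1, e2] at hst
    rw [e2] at hcconf
    have e3 : G.epochAt t' - 1 + 1 = G.epochAt t' := by omega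
    have hfirst : G.firstSlot (G.epochAt t' - 1 + 1) ≤ G.slotAt t' := by
      rw [e3]; exact le_epochOfSlot_iff.1 le_rfl
    refine isConfirmed_of_comparable hA.system hv ?_ hfirst hcconf (hbh.trans (hc₁.trans hcc)) ?_
    · rw [firstSlot_succ]
      have := slotsPerEpoch_pos (G := G)
      omega
    intro s' h1 h2 h hh _
    obtain ⟨h3, h4⟩ := hrange s' h1 h2
    by_cases hhe : G.epochB h = G.epochOfSlot s'
    · obtain ⟨_, _, _, _, hst', _⟩ := hA.stage_of_confirmed hκ hv hh hG' h3 (by omega) (by omega)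
      exact hst.comparable hA hκ hst' hv
    · have hs' : s' = G.firstSlot (G.epochOfSlot s') := by
        have hc := hh.2
        rw [isConfirmedNoCaching, epochAt_slotStart, slotAt_slotStart, if_neg hhe] at hc
        exact hc.1
      have hes : G.epochOfSlot s' = G.epochAt t' - 1 + 1 := by
        by_contra hcon
        -- This excludes the first slot of the previous epoch, with which the search does not start;
        -- old blocks can then only have been confirmed in the first slot of the current epoch.
        rw [show G.epochOfSlot s' = G.epochAt t' - 1 by omega] at hs'
        omega
      rw [hes] at hs' hhe
      exact hst.comparable_of_confirmed hA hκ hD (by omega) hv (hs' ▸ hh) hhe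

end Confirmed

end Gasper

theorem mainTheorem4 {V B : Type*} (G : Gasper V B) (K : Constants)
    (hSystem : G.SystemModel) (hGasper : G.GasperProperties K) (hChange : G.ChangeProperties K)
    (hBeta : G.BetaBound K) (hSlash : G.SlashBound K) (hJust : G.StrongJustification K) :
    G.IsConfirmationRule G.canonical (G.isConfirmed K) G.securityGuard :=
  Gasper.Assumptions.isConfirmationRule ⟨hSystem, hGasper, hChange, hBeta, hSlash, hJust⟩
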